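/- Let $(M,h)$ be a closed connected Riemannian surface and $(N,g)$ a closed Riemannian manifold (all manifolds, metrics and maps are smooth). Let $B$ be a smooth two-form on $N$, let $\Omega=dB$, and let $Z\in\Gamma(\operatorname{Hom}(\Lambda^2TN,TN))$ be defined by $\langle Z(\xi_1\wedge\xi_2),\eta\rangle=\Omega(\eta,\xi_1,\xi_2)$. Let $V\colon N\to\mathbb{R}$ be a smooth function. Put $|Z|_{L^\infty}=\sup|Z(u\wedge v)|$ over all orthonormal pairs $u,v\in T_yN$, $y\in N$, and $|\operatorname{Hess}V|_{L^\infty}=\sup|\operatorname{Hess}V(u,u)|$ over all unit tangent vectors $u$ of $N$, and let $|\kappa^N|\ge 0$ be a number such that every sectional curvature of $N$ is at most $|\kappa^N|$. Let $\operatorname{Scal}$ be the scalar curvature of $(M,h)$. Let $\phi\colon M\to N$ be a smooth solution of $$\tau(\phi)=Z(d\phi(e_1)\wedge d\phi(e_2))+\nabla V(\phi),$$ where $\tau(\phi)=\operatorname{Tr}\nabla d\phi$ is the tension field and $e_1,e_2$ is an orthonormal basis of each tangent space of $M$ (positively oriented, say, if $M$ is oriented). Suppose that at every point of $M$ $$\frac{\operatorname{Scal}}{2}\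 \ge\ \bigl(|Z|^2_{L^\infty}+|\kappa^N|\bigr)|d\phi|^2+|\operatorname{Hess}V|_{L^\infty}.$$ Then $|d\phi|^2$ is subharmonic, that is $\Delta|d\phi|^2\ge 0$, hence constant on $M$, and $\phi$ is trivial in the following sense: $\phi$ is a constant map, unless all terms of the assumed inequality vanish identically, that is $\operatorname{Scal}\equiv 0$, $Z\equiv 0$, $|\kappa^N|=0$ and $\operatorname{Hess}V\equiv 0$; in this degenerate case $\phi$ is totally geodesic, $\nabla d\phi=0$. -/

import Mathlib

open Set Topology Bundle
open scoped Manifold ContDiff NNReal ENNReal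

noncomputable section

namespace BosonicString

/-- The model space `ℝⁿ`. -/
abbrev E (n : ℕ) : Type := EuclideanSpace ℝ (Fin n)

/-! ### Riemannian geometry in one coordinate chart

`G : E n → E n →L[ℝ] E n →L[ℝ] ℝ` is the field of coefficients of a metric in a chart. -/

section Coordinates

variable {n m : ℕ}

/-- The trace `∑ᵢⱼ gⁱʲ b(∂ᵢ, ∂ⱼ)` of `b` with respect to the inner product `g`.
The vector `g.inverse (proj i)` is `∑ⱼ gⁱʲ ∂ⱼ`, the vector dual to the `i`-th coordinate form. -/
def metricTrace {W : Type*} [AddCommMonoid W] (g : E n →L[ℝ] E n →L[ℝ] ℝ)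
    (b : E n → E n → W) : W :=
  ∑ i : Fin n, b (EuclideanSpace.single i 1)
    (g.inverse (EuclideanSpace.proj i : E n →L[ℝ] ℝ))

/-- The Christoffel symbols `Γₚ(u, v)` of the Levi-Civita connection of `G`:
`2 G(Γ(u, v), w) = (∂ᵤG)(v, w) + (∂ᵥG)(u, w) - (∂_w G)(u, v)` for all `w`. -/
def christoffel (G : E n → E n →L[ℝ] E n →L[ℝ] ℝ) (p u v : E n) : E n :=
  (G p).inverse ((1 / 2 : ℝ) •
    (fderiv ℝ G p u v + fderiv ℝ G p v u - ((fderiv ℝ G p).flip u).flip v))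

/-- The curvature tensor `R(u, v)w = ∇ᵤ∇ᵥw - ∇ᵥ∇ᵤw - ∇_[u,v] w` of `G` at `p`. -/
def riemannTensor (G : E n → E n →L[ℝ] E n →L[ℝ] ℝ) (p u v w : E n) : E n :=
  fderiv ℝ (fun q => christoffel G q v w) p u - fderiv ℝ (fun q => christoffel G q u w) p v
    + christoffel G p u (christoffel G p v w) - christoffel G p v (christoffel G p u w)

/-- The Ricci curvature `Ric(v, w) = tr (u ↦ R(u, v)w)`. -/
def ricci (G : E n → E n →L[ℝ] E n →L[ℝ] ℝ) (p v w : E n) : ℝ :=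
  ∑ i : Fin n, (riemannTensor G p (EuclideanSpace.single i 1) v w) i

/-- The covariant Hessian `∇df` of a function in coordinates. -/
def coordHessian (G : E n → E n →L[ℝ] E n →L[ℝ] ℝ) (f : E n → ℝ) (p u v : E n) : ℝ :=
  fderiv ℝ (fderiv ℝ f) p u v - fderiv ℝ f p (christoffel G p u v)

/-- The second fundamental form `∇df` of a map `f` in coordinates, for the metric `G` on the
domain and the metric `H` on the target:
`(∇df)ᵏᵢⱼ = ∂ᵢ∂ⱼfᵏ - Γ(G)ˡᵢⱼ ∂ₗfᵏ + Γ(H)ᵏₐᵦ(f) ∂ᵢfᵃ ∂ⱼfᵇ`. -/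
def coordSecondFundForm (G : E m → E m →L[ℝ] E m →L[ℝ] ℝ) (H : E n → E n →L[ℝ] E n →L[ℝ] ℝ)
    (f : E m → E n) (p u v : E m) : E n :=
  fderiv ℝ (fderiv ℝ f) p u v - fderiv ℝ f p (christoffel G p u v)
    + christoffel H (f p) (fderiv ℝ f p u) (fderiv ℝ f p v)

end Coordinates

/-! ### Riemannian geometry on a manifold

In Mathlib the tangent space `TangentSpace (𝓡 n) x` is the model space `E n`, a vector being the
list of its components in the preferred chart `extChartAt (𝓡 n) x`.  Tensors at `x` are computed
in that chart. -/

section Manifold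

variable {n m : ℕ}
  {M : Type*} [TopologicalSpace M] [ChartedSpace (E m) M] [IsManifold (𝓡 m) ∞ M]
  {N : Type*} [TopologicalSpace N] [ChartedSpace (E n) N] [IsManifold (𝓡 n) ∞ N]

/-- Smooth Riemannian metrics on a manifold of dimension `n`. -/
abbrev RMetric (n : ℕ) (N : Type*) [TopologicalSpace N] [ChartedSpace (E n) N]
    [IsManifold (𝓡 n) ∞ N] :=
  ContMDiffRiemannianMetric (𝓡 n) ∞ (E n) (fun y : N => TangentSpace (𝓡 n) y)

/-- The derivative at `p` of the inverse of the preferred chart at `a`, a linear map from `E n` to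
the tangent space of `N` at the point `y` with coordinates `p`.  As tangent vectors at `y` are
expressed in the preferred chart at `y`, it is the Jacobian of the transition map to that chart. -/
def chartInvDeriv (n : ℕ) {N : Type*} [TopologicalSpace N] [ChartedSpace (E n) N]
    [IsManifold (𝓡 n) ∞ N] (a : N) (p : E n) : E n →L[ℝ] E n :=
  haveI : IsManifold (𝓡 n) 1 N := .of_le (n := ∞) (by simp)
  tangentCoordChange (𝓡 n) a ((extChartAt (𝓡 n) a).symm p) ((extChartAt (𝓡 n) a).symm p)

/-- The coefficients of the metric `g` in the preferred chart at `a`. -/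
def chartMetric (g : RMetric n N) (a : N) (p : E n) : E n →L[ℝ] E n →L[ℝ] ℝ :=
  (g.inner ((extChartAt (𝓡 n) a).symm p) : E n →L[ℝ] E n →L[ℝ] ℝ).bilinearComp
    (chartInvDeriv n a p) (chartInvDeriv n a p)

/-- The scalar curvature. -/
def scalarCurvature (g : RMetric n N) (y : N) : ℝ :=
  metricTrace (g.inner y) (ricci (chartMetric g y) (extChartAt (𝓡 n) y y))

/-- The sectional curvature of the plane spanned by the tangent vectors `u`, `v` at `y`. -/
def sectionalCurvature (g : RMetric n N) (y : N) (u v : TangentSpace (𝓡 n) y) : ℝ :=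
  g.inner y (riemannTensor (chartMetric g y) (extChartAt (𝓡 n) y y) u v v) u /
    (g.inner y u u * g.inner y v v - g.inner y u v ^ 2)

/-- The gradient of a function. -/
def grad (g : RMetric n N) (V : N → ℝ) (y : N) : TangentSpace (𝓡 n) y :=
  (g.inner y).inverse (mfderiv (𝓡 n) 𝓘(ℝ, ℝ) V y)

/-- The Hessian `∇dV` of a function. -/
def hess (g : RMetric n N) (V : N → ℝ) (y : N) (u v : TangentSpace (𝓡 n) y) : ℝ :=
  coordHessian (chartMetric g y) (V ∘ (extChartAt (𝓡 n) y).symm) (extChartAt (𝓡 n) y y) u v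

/-- The Laplace-Beltrami operator `Δf = tr ∇df`. -/
def laplacian (g : RMetric n N) (f : N → ℝ) (y : N) : ℝ :=
  metricTrace (g.inner y) (hess g f y)

/-- The squared norm `|dφ|²` of the differential of a map `φ : (M, h) → (N, g)`. -/
def normSqDiff (h : RMetric m M) (g : RMetric n N) (φ : M → N) (x : M) : ℝ :=
  metricTrace (h.inner x) fun u v =>
    g.inner (φ x) (mfderiv (𝓡 m) (𝓡 n) φ x u) (mfderiv (𝓡 m) (𝓡 n) φ x v)

/-- The second fundamental form `∇dφ` of a map `φ : (M, h) → (N, g)`. -/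
def secondFundForm (h : RMetric m M) (g : RMetric n N) (φ : M → N) (x : M)
    (u v : TangentSpace (𝓡 m) x) : TangentSpace (𝓡 n) (φ x) :=
  coordSecondFundForm (chartMetric h x) (chartMetric g (φ x))
    (writtenInExtChartAt (𝓡 m) (𝓡 n) x φ) (extChartAt (𝓡 m) x x) u v

/-- The tension field `τ(φ) = tr ∇dφ`. -/
def tension (h : RMetric m M) (g : RMetric n N) (φ : M → N) (x : M) :
    TangentSpace (𝓡 n) (φ x) :=
  metricTrace (h.inner x) (secondFundForm h g φ x)

/-! ### The two-form and the homomorphism `Z` -/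

/-- (Not necessarily smooth) two-forms on `N`. -/
abbrev TwoForm (n : ℕ) (N : Type*) [TopologicalSpace N] [ChartedSpace (E n) N] :=
  ∀ y : N, TangentSpace (𝓡 n) y [⋀^Fin 2]→L[ℝ] ℝ

/-- The expression of the two-form `B` in the preferred chart at `a`. -/
def chartForm (B : TwoForm n N) (a : N) (p : E n) : E n [⋀^Fin 2]→L[ℝ] ℝ :=
  (B ((extChartAt (𝓡 n) a).symm p) : E n [⋀^Fin 2]→L[ℝ] ℝ).compContinuousLinearMap
    (chartInvDeriv n a p)

/-- The two-form `B` is smooth. -/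
def IsSmoothTwoForm (B : TwoForm n N) : Prop :=
  ∀ a : N, ContDiffOn ℝ ∞ (chartForm B a) (extChartAt (𝓡 n) a).target

/-- The three-form `Ω = dB`. -/
def dTwoForm (B : TwoForm n N) (y : N) : TangentSpace (𝓡 n) y [⋀^Fin 3]→L[ℝ] ℝ :=
  (extDeriv (chartForm B y) (extChartAt (𝓡 n) y y) : E n [⋀^Fin 3]→L[ℝ] ℝ)

/-- `Z(u ∧ v)`, the vector with `⟨Z(u ∧ v), η⟩ = Ω(η, u, v)` for all `η`, where `Ω = dB`. -/
def Zmap (g : RMetric n N) (B : TwoForm n N) (y : N) (u v : TangentSpace (𝓡 n) y) :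
    TangentSpace (𝓡 n) y :=
  (g.inner y).inverse
    ((dTwoForm B y).toContinuousMultilinearMap.toContinuousLinearMap ![0, u, v] 0)

/-- `u`, `v` are orthonormal tangent vectors. -/
def OrthonormalPair (g : RMetric n N) (y : N) (u v : TangentSpace (𝓡 n) y) : Prop :=
  g.inner y u u = 1 ∧ g.inner y v v = 1 ∧ g.inner y u v = 0

/-- The norm `|Z|_{L^∞}`: the supremum of `|Z(u ∧ v)|` over all orthonormal pairs `u`, `v` of
tangent vectors of `N`, that is, over all unit simple bivectors. -/
def normZ (g : RMetric n N) (B : TwoForm n N) : ℝ≥0∞ :=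
  ⨆ (y : N) (u : TangentSpace (𝓡 n) y) (v : TangentSpace (𝓡 n) y) (_ : OrthonormalPair g y u v),
    ENNReal.ofReal (Real.sqrt (g.inner y (Zmap g B y u v) (Zmap g B y u v)))

/-- The norm `|Hess V|_{L^∞}`: the supremum of `|Hess V(u, u)|` over all unit tangent vectors `u`
of `N`, that is, the largest operator norm of the symmetric form `Hess V`. -/
def normHess (g : RMetric n N) (V : N → ℝ) : ℝ≥0∞ :=
  ⨆ (y : N) (u : TangentSpace (𝓡 n) y) (_ : g.inner y u u = 1), ENNReal.ofReal |hess g V y u u|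

end Manifold

end BosonicString

end

/-!
The proof is the Bochner method. Write `X i = dφ(eᵢ)` for an orthonormal frame of the surface, and
`F = |dφ|² = ∑ |X i|²`. The Bochner formula on a surface (`laplacian_normSqDiff`) reads
`ΔF / 2 = |∇dφ|² + ∑ ⟨∇_{eᵢ} τ, X i⟩ + (Scal / 2) F - 2 ⟨R(X 0, X 1) X 1, X 0⟩`.

As `Ω` is alternating, `Z(X 0 ∧ X 1)` is orthogonal to the image of `dφ`, so `τ` pairs with every
`dφ(u)` exactly as the gradient of `V` does (`inner_tension_mfderiv`). Differentiating this identity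
gives `∑ ⟨∇_{eᵢ} τ, X i⟩ = ∑ Hess V(X i, X i) - ⟨Z(X 0 ∧ X 1), τ⟩` (`sum_covDeriv_tension`), and no
derivative of `Z` enters. The last term is absorbed by Young's inequality, since
`|τ|² ≤ 2 |∇dφ|²` on a surface, and `|X 0 ∧ X 1|² ≤ F² / 4`. With the curvature hypothesis one gets
`ΔF / 2 ≥ (7/8 |Z|² + κ / 2) F² ≥ 0` (`bochner_inequality`). By the strong maximum principle, proved
in a chart with Hopf's barrier (`eventually_eq_of_coordLaplacian_nonneg`), `F` is constant.

If `F = 0`, then `dφ = 0` and `φ` is constant. If `F = c > 0`, then `ΔF = 0` forces `|Z| = 0` and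
`κ = 0`; the Bochner formula now leaves `|∇dφ|² ≤ 0`, so `∇dφ = 0` and `τ = 0`, and then
`Scal / 2 ≤ 0`, while `Scal / 2 ≥ |Hess V| ≥ 0` (`rigidity`).

All local computations are done in coordinates with the Christoffel symbols, and carried over to the
manifolds by the naturality of the second fundamental form and of the Hessian under changes of
charts (`exists_chart_change`, `laplacian_eq_coordLaplacian`).
-/

noncomputable section

namespace BosonicString

open Filter

/-! ### Product rules for smooth maps on open sets -/

section Calculus

variable {D F F₁ F₂ F₃ : Type*} [NormedAddCommGroup D] [NormedSpace ℝ D]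
  [NormedAddCommGroup F] [NormedSpace ℝ F] [NormedAddCommGroup F₁] [NormedSpace ℝ F₁]
  [NormedAddCommGroup F₂] [NormedSpace ℝ F₂] [NormedAddCommGroup F₃] [NormedSpace ℝ F₃]
  {U : Set D} {p : D}

theorem contDiffAt_of_isOpen {f : D → F} (hf : ContDiffOn ℝ ∞ f U) (hU : IsOpen U) (hp : p ∈ U) :
    ContDiffAt ℝ ∞ f p :=
  hf.contDiffAt (hU.mem_nhds hp)

theorem differentiableAt_of_isOpen {f : D → F} (hf : ContDiffOn ℝ ∞ f U) (hU : IsOpen U)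
    (hp : p ∈ U) : DifferentiableAt ℝ f p :=
  (contDiffAt_of_isOpen hf hU hp).differentiableAt (by simp)

theorem contDiffOn_fderiv {f : D → F} (hf : ContDiffOn ℝ ∞ f U) (hU : IsOpen U) :
    ContDiffOn ℝ ∞ (fderiv ℝ f) U :=
  hf.fderiv_of_isOpen hU (by simp)

theorem contDiffOn_clm_apply₂ [FiniteDimensional ℝ F₁] [FiniteDimensional ℝ F₂]
    {A : D → F₁ →L[ℝ] F₂ →L[ℝ] F₃}
    (h : ∀ u v, ContDiffOn ℝ ∞ (fun q => A q u v) U) : ContDiffOn ℝ ∞ A U :=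
  contDiffOn_clm_apply.2 fun u => contDiffOn_clm_apply.2 fun v => h u v

theorem fderiv_clm_apply_apply {A : D → F₁ →L[ℝ] F₂} {X : D → F₁}
    (hA : DifferentiableAt ℝ A p) (hX : DifferentiableAt ℝ X p) (w : D) :
    fderiv ℝ (fun q => A q (X q)) p w = fderiv ℝ A p w (X p) + A p (fderiv ℝ X p w) := by
  rw [fderiv_clm_apply hA hX]
  simp [add_comm]

theorem fderiv_clm_apply₂ {A : D → F₁ →L[ℝ] F₂ →L[ℝ] F₃} {X : D → F₁} {Y : D → F₂}
    (hA : DifferentiableAt ℝ A p) (hX : DifferentiableAt ℝ X p) (hY : DifferentiableAt ℝ Y p)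
    (w : D) :
    fderiv ℝ (fun q => A q (X q) (Y q)) p w =
      fderiv ℝ A p w (X p) (Y p) + A p (fderiv ℝ X p w) (Y p) + A p (X p) (fderiv ℝ Y p w) := by
  rw [fderiv_clm_apply_apply (A := fun q => A q (X q)) (hA.clm_apply hX) hY,
    fderiv_clm_apply_apply hA hX]
  simp

theorem fderiv_clm_apply_const {A : D → F₁ →L[ℝ] F₂} (hA : DifferentiableAt ℝ A p) (u : F₁)
    (w : D) : fderiv ℝ (fun q => A q u) p w = fderiv ℝ A p w u := by
  rw [fderiv_clm_apply_apply hA (differentiableAt_const u)]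
  simp

theorem fderiv_clm_apply₂_const {A : D → F₁ →L[ℝ] F₂ →L[ℝ] F₃} (hA : DifferentiableAt ℝ A p)
    (u : F₁) (v : F₂) (w : D) : fderiv ℝ (fun q => A q u v) p w = fderiv ℝ A p w u v := by
  rw [fderiv_clm_apply₂ hA (differentiableAt_const u) (differentiableAt_const v)]
  simp

theorem fderiv_fderiv_comm {f : D → F} (hf : ContDiffOn ℝ ∞ f U) (hU : IsOpen U) (hp : p ∈ U)
    (u v : D) : fderiv ℝ (fderiv ℝ f) p u v = fderiv ℝ (fderiv ℝ f) p v u :=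
  ((contDiffAt_of_isOpen hf hU hp).isSymmSndFDerivAt
    (by simpa using (WithTop.coe_le_coe.2 le_top : ((2 : ℕ∞) : ℕ∞ω) ≤ (∞ : ℕ∞ω)))).eq u v

theorem fderiv_comp_apply {H : D → F} {f : F₁ → D} {x : F₁} (hH : DifferentiableAt ℝ H (f x))
    (hf : DifferentiableAt ℝ f x) (w : F₁) :
    fderiv ℝ (fun q => H (f q)) x w = fderiv ℝ H (f x) (fderiv ℝ f x w) := by
  rw [show (fun q => H (f q)) = H ∘ f from rfl, fderiv_comp x hH hf]
  rfl

/-- The chain rule for second derivatives. -/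
theorem fderiv_fderiv_comp {V : Set F} {k : F → F₁} {f : D → F} (hf : ContDiffOn ℝ ∞ f U)
    (hk : ContDiffOn ℝ ∞ k V) (hU : IsOpen U) (hV : IsOpen V) (hfV : MapsTo f U V) (hp : p ∈ U)
    (u v : D) :
    fderiv ℝ (fderiv ℝ (k ∘ f)) p u v =
      fderiv ℝ (fderiv ℝ k) (f p) (fderiv ℝ f p u) (fderiv ℝ f p v) +
        fderiv ℝ k (f p) (fderiv ℝ (fderiv ℝ f) p u v) := by
  have h1 : ∀ q ∈ U, fderiv ℝ (k ∘ f) q v = fderiv ℝ k (f q) (fderiv ℝ f q v) := fun q hq =>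
    fderiv_comp_apply (differentiableAt_of_isOpen hk hV (hfV hq))
      (differentiableAt_of_isOpen hf hU hq) v
  have hkf : ContDiffOn ℝ ∞ (k ∘ f) U := hk.comp hf hfV
  have hdk := differentiableAt_of_isOpen (contDiffOn_fderiv hk hV) hV (hfV hp)
  have hdf := differentiableAt_of_isOpen hf hU hp
  have hdf' := differentiableAt_of_isOpen (contDiffOn_fderiv hf hU) hU hp
  rw [← fderiv_clm_apply_const (differentiableAt_of_isOpen (contDiffOn_fderiv hkf hU) hU hp),
    (show (fun q => fderiv ℝ (k ∘ f) q v) =ᶠ[𝓝 p] _ from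
      eventually_of_mem (hU.mem_nhds hp) h1).fderiv_eq,
    fderiv_clm_apply_apply (A := fun q => fderiv ℝ k (f q)) (hdk.comp p hdf)
      (hdf'.clm_apply (differentiableAt_const v)),
    fderiv_comp_apply hdk hdf, fderiv_clm_apply_const hdf']

end Calculus

/-! ### The Levi-Civita connection in coordinates -/

section Instances

variable {n m : ℕ}

-- Shortcuts for instances whose synthesis is slow.
set_option synthInstance.maxHeartbeats 400000

instance instNormedAddCommGroupForm : NormedAddCommGroup (E n →L[ℝ] ℝ) := inferInstance

instance instNormedSpaceForm : NormedSpace ℝ (E n →L[ℝ] ℝ) := inferInstance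

instance instNormedAddCommGroupBilin : NormedAddCommGroup (E n →L[ℝ] E n →L[ℝ] ℝ) := inferInstance

instance instNormedSpaceBilin : NormedSpace ℝ (E n →L[ℝ] E n →L[ℝ] ℝ) := inferInstance

instance instNormedAddCommGroupEnd : NormedAddCommGroup (E m →L[ℝ] E n) := inferInstance

instance instNormedSpaceEnd : NormedSpace ℝ (E m →L[ℝ] E n) := inferInstance

instance instNormedAddCommGroupBilinMap : NormedAddCommGroup (E m →L[ℝ] E m →L[ℝ] E n) :=
  inferInstance

instance instNormedSpaceBilinMap : NormedSpace ℝ (E m →L[ℝ] E m →L[ℝ] E n) := inferInstance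

end Instances

section LeviCivita

variable {n m : ℕ}

/-- `G` is a smooth field of inner products on the open set `U`. -/
structure IsMetricOn (G : E n → E n →L[ℝ] E n →L[ℝ] ℝ) (U : Set (E n)) : Prop where
  isOpen : IsOpen U
  contDiffOn : ContDiffOn ℝ ∞ G U
  symm : ∀ p ∈ U, ∀ u v, G p u v = G p v u
  pos : ∀ p ∈ U, ∀ u, u ≠ 0 → 0 < G p u u

theorem isInvertible_of_pos {g : E n →L[ℝ] E n →L[ℝ] ℝ} (hpos : ∀ u, u ≠ 0 → 0 < g u u) :
    g.IsInvertible := by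
  have hinj : Function.Injective g := by
    refine (injective_iff_map_eq_zero g).2 fun u hu => ?_
    by_contra h
    have := hpos u h
    simp [hu] at this
  let e₁ : (E n →ₗ[ℝ] ℝ) ≃ₗ[ℝ] (E n →L[ℝ] ℝ) := LinearMap.toContinuousLinearMap
  have hdim : Module.finrank ℝ (E n) = Module.finrank ℝ (E n →L[ℝ] ℝ) := by
    rw [← e₁.finrank_eq]
    exact (Subspace.dual_finrank_eq (K := ℝ) (V := E n)).symm
  let e := LinearEquiv.ofInjectiveOfFinrankEq (g : E n →ₗ[ℝ] E n →L[ℝ] ℝ) hinj hdim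
  exact ⟨e.toContinuousLinearEquiv, by ext; rfl⟩

namespace IsMetricOn

variable {G : E n → E n →L[ℝ] E n →L[ℝ] ℝ} {U : Set (E n)} {p : E n}

theorem mono (hG : IsMetricOn G U) {V : Set (E n)} (hV : IsOpen V) (h : V ⊆ U) :
    IsMetricOn G V :=
  ⟨hV, hG.contDiffOn.mono h, fun p hp => hG.symm p (h hp), fun p hp => hG.pos p (h hp)⟩

theorem isInvertible (hG : IsMetricOn G U) (hp : p ∈ U) : (G p).IsInvertible :=
  isInvertible_of_pos (hG.pos p hp)

theorem eq_of_apply_eq (hG : IsMetricOn G U) (hp : p ∈ U) {u v : E n}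
    (h : ∀ w, G p u w = G p v w) : u = v :=
  have h' : G p u = G p v := ContinuousLinearMap.ext h
  (hG.isInvertible hp).injective h'

theorem contDiffOn_inverse (hG : IsMetricOn G U) : ContDiffOn ℝ ∞ (fun q => (G q).inverse) U :=
  fun q hq => (ContDiffAt.comp q (ContinuousLinearMap.IsInvertible.contDiffAt_map_inverse
    (hG.isInvertible hq)) (contDiffAt_of_isOpen hG.contDiffOn hG.isOpen hq)).contDiffWithinAt

theorem differentiableAt (hG : IsMetricOn G U) (hp : p ∈ U) : DifferentiableAt ℝ G p :=
  differentiableAt_of_isOpen hG.contDiffOn hG.isOpen hp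

theorem fderiv_symm (hG : IsMetricOn G U) (hp : p ∈ U) (w u v : E n) :
    fderiv ℝ G p w u v = fderiv ℝ G p w v u := by
  rw [← fderiv_clm_apply₂_const (hG.differentiableAt hp),
    ← fderiv_clm_apply₂_const (hG.differentiableAt hp)]
  refine congrArg (fun L : E n →L[ℝ] ℝ => L w) (EventuallyEq.fderiv_eq ?_)
  exact eventually_of_mem (hG.isOpen.mem_nhds hp) fun q hq => hG.symm q hq u v

/-- The Koszul formula. -/
theorem apply_christoffel (hG : IsMetricOn G U) (hp : p ∈ U) (u v w : E n) :
    2 * G p (christoffel G p u v) w =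
      fderiv ℝ G p u v w + fderiv ℝ G p v u w - fderiv ℝ G p w u v := by
  rw [christoffel, (hG.isInvertible hp).self_apply_inverse]
  simp

end IsMetricOn

/-- The Christoffel symbols as a continuous bilinear map. -/
def christoffelL (G : E n → E n →L[ℝ] E n →L[ℝ] ℝ) (p : E n) : E n →L[ℝ] E n →L[ℝ] E n :=
  LinearMap.toContinuousLinearMap <| LinearMap.toContinuousLinearMap.toLinearMap ∘ₗ
    LinearMap.mk₂ ℝ (christoffel G p)
      (fun u u' v => by
        simp only [christoffel, ← map_add, ← smul_add]; congr 2; ext w; simp; ring)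
      (fun c u v => by
        simp only [christoffel, ← map_smul]; congr 1; ext w; simp; ring)
      (fun u v v' => by
        simp only [christoffel, ← map_add, ← smul_add]; congr 2; ext w; simp; ring)
      (fun c u v => by
        simp only [christoffel, ← map_smul]; congr 1; ext w; simp; ring)

@[simp]
theorem christoffelL_apply (G : E n → E n →L[ℝ] E n →L[ℝ] ℝ) (p u v : E n) :
    christoffelL G p u v = christoffel G p u v := rfl

namespace IsMetricOn

variable {G : E n → E n →L[ℝ] E n →L[ℝ] ℝ} {U : Set (E n)} {p : E n}

theorem contDiffOn_christoffelL (hG : IsMetricOn G U) : ContDiffOn ℝ ∞ (christoffelL G) U := by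
  refine contDiffOn_clm_apply₂ fun u v => ?_
  have h1 := contDiffOn_fderiv hG.contDiffOn hG.isOpen
  refine hG.contDiffOn_inverse.clm_apply (contDiffOn_clm_apply.2 fun w => ?_)
  simp only [smul_apply, add_apply,
    sub_apply, ContinuousLinearMap.flip_apply]
  have h2 : ∀ a b c : E n, ContDiffOn ℝ ∞ (fun q => fderiv ℝ G q a b c) U := fun a b c =>
    ((h1.clm_apply contDiffOn_const).clm_apply contDiffOn_const).clm_apply contDiffOn_const
  exact (((h2 u v w).add (h2 v u w)).sub (h2 w u v)).const_smul _

theorem differentiableAt_christoffelL (hG : IsMetricOn G U) (hp : p ∈ U) :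
    DifferentiableAt ℝ (christoffelL G) p :=
  differentiableAt_of_isOpen hG.contDiffOn_christoffelL hG.isOpen hp

/-- The Levi-Civita connection has no torsion. -/
theorem christoffel_comm (hG : IsMetricOn G U) (hp : p ∈ U) (u v : E n) :
    christoffel G p u v = christoffel G p v u := by
  refine hG.eq_of_apply_eq hp fun w => ?_
  have h1 := hG.apply_christoffel hp u v w
  have h2 := hG.apply_christoffel hp v u w
  have h3 := hG.fderiv_symm hp w u v
  linarith

/-- The Levi-Civita connection preserves the metric. -/
theorem fderiv_apply (hG : IsMetricOn G U) (hp : p ∈ U) (w u v : E n) :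
    fderiv ℝ G p w u v = G p (christoffel G p w u) v + G p u (christoffel G p w v) := by
  rw [hG.symm p hp u]
  have h1 := hG.apply_christoffel hp w u v
  have h2 := hG.apply_christoffel hp w v u
  have h3 := hG.fderiv_symm hp w u v
  have h4 := hG.fderiv_symm hp v w u
  have h5 := hG.fderiv_symm hp u w v
  linarith

end IsMetricOn

/-! ### Covariant derivatives along a map -/

/-- The covariant derivative `D_u W` at `p` of a vector field `W` along the map `f`, for the
Levi-Civita connection of the metric `H` on the target. -/
def covDeriv (H : E n → E n →L[ℝ] E n →L[ℝ] ℝ) (f W : E m → E n) (p u : E m) : E n :=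
  fderiv ℝ W p u + christoffel H (f p) (fderiv ℝ f p u) (W p)

section Along

variable {H : E n → E n →L[ℝ] E n →L[ℝ] ℝ} {U : Set (E m)} {V : Set (E n)}
  {f : E m → E n} {p : E m} {W W₁ W₂ : E m → E n}

theorem contDiffOn_covDeriv (hH : IsMetricOn H V) (hU : IsOpen U) (hf : ContDiffOn ℝ ∞ f U)
    (hfV : MapsTo f U V) (hW : ContDiffOn ℝ ∞ W U) (u : E m) :
    ContDiffOn ℝ ∞ (fun q => covDeriv H f W q u) U :=
  ((contDiffOn_fderiv hW hU).clm_apply contDiffOn_const).add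
    (((hH.contDiffOn_christoffelL.comp hf hfV).clm_apply
      ((contDiffOn_fderiv hf hU).clm_apply contDiffOn_const)).clm_apply hW)

theorem covDeriv_sub (hW₁ : DifferentiableAt ℝ W₁ p) (hW₂ : DifferentiableAt ℝ W₂ p) (u : E m) :
    covDeriv H f (fun q => W₁ q - W₂ q) p u = covDeriv H f W₁ p u - covDeriv H f W₂ p u := by
  simp only [covDeriv, ← christoffelL_apply, fderiv_fun_sub hW₁ hW₂, map_sub,
    sub_apply]
  abel

theorem covDeriv_congr (h : W₁ =ᶠ[𝓝 p] W₂) (u : E m) :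
    covDeriv H f W₁ p u = covDeriv H f W₂ p u := by
  simp only [covDeriv, h.fderiv_eq, h.eq_of_nhds]

/-- The covariant derivative along a map preserves the metric of the target. -/
theorem fderiv_inner_along (hH : IsMetricOn H V) (hp : f p ∈ V) (hf : DifferentiableAt ℝ f p)
    (hW₁ : DifferentiableAt ℝ W₁ p) (hW₂ : DifferentiableAt ℝ W₂ p) (u : E m) :
    fderiv ℝ (fun q => H (f q) (W₁ q) (W₂ q)) p u =
      H (f p) (covDeriv H f W₁ p u) (W₂ p) + H (f p) (W₁ p) (covDeriv H f W₂ p u) := by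
  have hd := hH.differentiableAt hp
  rw [fderiv_clm_apply₂ (A := fun q => H (f q)) (hd.comp p hf) hW₁ hW₂, fderiv_comp_apply hd hf,
    hH.fderiv_apply hp]
  simp only [covDeriv, map_add, add_apply]
  ring

/-- The commutator of covariant derivatives along a map is the curvature of the target. -/
theorem covDeriv_covDeriv_sub (hH : IsMetricOn H V) (hU : IsOpen U) (hf : ContDiffOn ℝ ∞ f U)
    (hfV : MapsTo f U V) (hW : ContDiffOn ℝ ∞ W U) (hp : p ∈ U) (u v : E m) :
    covDeriv H f (fun q => covDeriv H f W q v) p u -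
      covDeriv H f (fun q => covDeriv H f W q u) p v =
    riemannTensor H (f p) (fderiv ℝ f p u) (fderiv ℝ f p v) (W p) := by
  have hdΓ := hH.differentiableAt_christoffelL (hfV hp)
  have hdf := differentiableAt_of_isOpen hf hU hp
  have hdf' := differentiableAt_of_isOpen (contDiffOn_fderiv hf hU) hU hp
  have hdW := differentiableAt_of_isOpen hW hU hp
  have hdW' := differentiableAt_of_isOpen (contDiffOn_fderiv hW hU) hU hp
  have key : ∀ a b : E m, fderiv ℝ (fun q => covDeriv H f W q b) p a =
      fderiv ℝ (fderiv ℝ W) p a b +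
        (fderiv ℝ (christoffelL H) (f p) (fderiv ℝ f p a) (fderiv ℝ f p b) (W p) +
          christoffelL H (f p) (fderiv ℝ (fderiv ℝ f) p a b) (W p) +
          christoffelL H (f p) (fderiv ℝ f p b) (fderiv ℝ W p a)) := by
    intro a b
    simp only [covDeriv, ← christoffelL_apply]
    have hb : DifferentiableAt ℝ (fun q => fderiv ℝ f q b) p :=
      hdf'.clm_apply (differentiableAt_const b)
    have hΓ : DifferentiableAt ℝ (fun q => christoffelL H (f q)) p := hdΓ.comp p hdf
    rw [fderiv_fun_add (hdW'.clm_apply (differentiableAt_const b))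
        ((hΓ.clm_apply hb).clm_apply hdW), add_apply,
      fderiv_clm_apply_const hdW', fderiv_clm_apply₂ hΓ hb hdW,
      fderiv_comp_apply hdΓ hdf, fderiv_clm_apply_const hdf']
  have hR : ∀ a b c : E n, fderiv ℝ (fun q => christoffel H q b c) (f p) a =
      fderiv ℝ (christoffelL H) (f p) a b c := fun a b c => fderiv_clm_apply₂_const hdΓ b c a
  have hcc : ∀ a b : E m, covDeriv H f (fun q => covDeriv H f W q b) p a =
      fderiv ℝ (fun q => covDeriv H f W q b) p a +
        christoffel H (f p) (fderiv ℝ f p a) (covDeriv H f W p b) := fun _ _ => rfl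
  rw [hcc, hcc, key, key, riemannTensor, hR, hR, fderiv_fderiv_comm hW hU hp u v,
    fderiv_fderiv_comm hf hU hp u v]
  simp only [covDeriv, ← christoffelL_apply, map_add]
  abel

/-- The endomorphism `R(u, v)` is skew-symmetric. -/
theorem IsMetricOn.riemannTensor_self (hH : IsMetricOn H V) {y : E n} (hy : y ∈ V)
    (u v w : E n) : H y (riemannTensor H y u v w) w = 0 := by
  have hid : ContDiffOn ℝ ∞ (fun q : E n => q) V := contDiffOn_id
  have hw : ContDiffOn ℝ ∞ (fun _ : E n => w) V := contDiffOn_const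
  have hcov : ∀ a, ContDiffOn ℝ ∞ (fun q => covDeriv H (fun q => q) (fun _ => w) q a) V :=
    fun a => contDiffOn_covDeriv hH hH.isOpen hid (mapsTo_id V) hw a
  -- Both mixed second derivatives of `q ↦ H q w w`, computed with the connection.
  have h1 : ∀ a, ∀ q ∈ V, fderiv ℝ (fun q => H q w w) q a =
      2 * H q (covDeriv H (fun q => q) (fun _ => w) q a) w := by
    intro a q hq
    rw [fderiv_inner_along (f := fun q => q) (W₁ := fun _ => w) (W₂ := fun _ => w) hH hq
      differentiableAt_id (differentiableAt_const w) (differentiableAt_const w), hH.symm q hq w]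
    ring
  have hsm : ContDiffOn ℝ ∞ (fun q => H q w w) V :=
    (hH.contDiffOn.clm_apply contDiffOn_const).clm_apply contDiffOn_const
  have h2 : ∀ a b, fderiv ℝ (fderiv ℝ (fun q => H q w w)) y a b =
      2 * (H y (covDeriv H (fun q => q)
          (fun q => covDeriv H (fun q => q) (fun _ => w) q b) y a) w +
        H y (covDeriv H (fun q => q) (fun _ => w) y b)
          (covDeriv H (fun q => q) (fun _ => w) y a)) := by
    intro a b
    rw [← fderiv_clm_apply_const
        (differentiableAt_of_isOpen (contDiffOn_fderiv hsm hH.isOpen) hH.isOpen hy),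
      (show (fun q => fderiv ℝ (fun q => H q w w) q b) =ᶠ[𝓝 y] _ from
        eventually_of_mem (hH.isOpen.mem_nhds hy) (h1 b)).fderiv_eq]
    have hd := differentiableAt_of_isOpen (hcov b) hH.isOpen hy
    rw [fderiv_const_mul, smul_apply, smul_eq_mul,
      fderiv_inner_along (f := fun q => q) (W₂ := fun _ => w) hH hy
        differentiableAt_id hd (differentiableAt_const w)]
    exact ((hH.differentiableAt hy).clm_apply hd).clm_apply (differentiableAt_const w)
  have h3 := covDeriv_covDeriv_sub hH hH.isOpen hid (mapsTo_id V) hw hy u v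
  simp only [fderiv_fun_id, ContinuousLinearMap.id_apply] at h3
  have h4 := fderiv_fderiv_comm hsm hH.isOpen hy u v
  rw [h2, h2, hH.symm y hy (covDeriv H (fun q => q) (fun _ => w) y u)] at h4
  rw [← h3, map_sub, sub_apply]
  linarith

theorem IsMetricOn.riemannTensor_skew (hH : IsMetricOn H V) {y : E n} (hy : y ∈ V)
    (u v w z : E n) : H y (riemannTensor H y u v w) z = -H y (riemannTensor H y u v z) w := by
  have hadd : ∀ a b, riemannTensor H y u v (a + b) =
      riemannTensor H y u v a + riemannTensor H y u v b := by
    intro a b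
    have hdΓ := hH.differentiableAt_christoffelL hy
    have hR : ∀ a b c : E n, fderiv ℝ (fun q => christoffel H q b c) y a =
        fderiv ℝ (christoffelL H) y a b c := fun a b c => fderiv_clm_apply₂_const hdΓ b c a
    simp only [riemannTensor, hR]
    simp only [← christoffelL_apply, map_add]
    abel
  have h := hH.riemannTensor_self hy u v (w + z)
  have hw := hH.riemannTensor_self hy u v w
  have hz := hH.riemannTensor_self hy u v z
  simp only [hadd, map_add, add_apply] at h
  linarith

theorem riemannTensor_swap (y u v w : E n) :
    riemannTensor H y u v w = -riemannTensor H y v u w := by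
  simp only [riemannTensor]
  abel

end Along

end LeviCivita

/-! ### Metric traces and orthonormal frames -/

section Trace

variable {n m : ℕ} {W : Type*} [NormedAddCommGroup W] [NormedSpace ℝ W]

/-- `e` is an orthonormal basis for the inner product `g`. -/
def IsOrthonormalFrame (g : E m →L[ℝ] E m →L[ℝ] ℝ) (e : Fin m → E m) : Prop :=
  ∀ i j, g (e i) (e j) = if i = j then 1 else 0

theorem sum_coord_smul_single (u : E m) :
    ∑ i, u i • (EuclideanSpace.single i (1 : ℝ) : E m) = u := by
  ext j
  simp [Finset.sum_apply, Pi.single_apply]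

theorem IsOrthonormalFrame.sum_smul {g : E m →L[ℝ] E m →L[ℝ] ℝ} {e : Fin m → E m}
    (he : IsOrthonormalFrame g e) (u : E m) : ∑ i, g u (e i) • e i = u := by
  have hli : LinearIndependent ℝ e := by
    refine linearIndependent_iff'.2 fun s c hc j hj => ?_
    have h := congrArg (fun u => g u (e j)) hc
    simpa [he _ _, hj] using h
  let b := basisOfLinearIndependentOfCardEqFinrank' e hli (by simp)
  have hb : ∀ i, b i = e i := fun i => by simp [b]
  have h : ∀ j, g u (e j) = b.repr u j := by
    intro j
    conv_lhs => rw [← b.sum_repr u]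
    simp [hb, he _ _]
  conv_rhs => rw [← b.sum_repr u]
  simp [h, hb]

/-- The metric trace is the sum over an orthonormal frame. -/
theorem IsOrthonormalFrame.metricTrace_eq {g : E m →L[ℝ] E m →L[ℝ] ℝ} {e : Fin m → E m}
    (he : IsOrthonormalFrame g e) (hg : g.IsInvertible) (b : E m →L[ℝ] E m →L[ℝ] W) :
    metricTrace g (fun u v => b u v) = ∑ i, b (e i) (e i) := by
  have hν : ∀ i, g.inverse (EuclideanSpace.proj i : E m →L[ℝ] ℝ) = ∑ a, (e a) i • e a := by
    intro i
    rw [← he.sum_smul (g.inverse (EuclideanSpace.proj i : E m →L[ℝ] ℝ))]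
    simp [hg.self_apply_inverse]
  calc metricTrace g (fun u v => b u v)
      = ∑ i, ∑ a, (e a) i • b (EuclideanSpace.single i 1) (e a) := by
        simp [metricTrace, hν]
    _ = ∑ a, b (∑ i, (e a) i • EuclideanSpace.single i (1 : ℝ)) (e a) := by
        rw [Finset.sum_comm]
        simp
    _ = ∑ a, b (e a) (e a) := by simp only [sum_coord_smul_single]

variable {G : E m → E m →L[ℝ] E m →L[ℝ] ℝ} {U : Set (E m)} {p : E m}
  {P : E m → E m →L[ℝ] E m →L[ℝ] W}

theorem contDiffOn_metricTrace (hG : IsMetricOn G U) (hP : ContDiffOn ℝ ∞ P U) :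
    ContDiffOn ℝ ∞ (fun q => metricTrace (G q) (fun u v => P q u v)) U := by
  unfold metricTrace
  exact ContDiffOn.sum fun i _ => (hP.clm_apply contDiffOn_const).clm_apply
    (hG.contDiffOn_inverse.clm_apply contDiffOn_const)

/-- The metric trace commutes with covariant differentiation. -/
theorem fderiv_metricTrace (hG : IsMetricOn G U) (hp : p ∈ U) (hP : DifferentiableAt ℝ P p)
    {e : Fin m → E m} (he : IsOrthonormalFrame (G p) e) (w : E m) :
    fderiv ℝ (fun q => metricTrace (G q) (fun u v => P q u v)) p w =
      ∑ i, (fderiv ℝ P p w (e i) (e i) - P p (christoffel G p w (e i)) (e i) -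
        P p (e i) (christoffel G p w (e i))) := by
  have hinv := hG.isInvertible hp
  -- `ν i q` is the vector dual to the `i`-th coordinate form.
  let ν : Fin m → E m → E m := fun i q => (G q).inverse (EuclideanSpace.proj i : E m →L[ℝ] ℝ)
  have hνd : ∀ i, DifferentiableAt ℝ (ν i) p := fun i =>
    differentiableAt_of_isOpen (hG.contDiffOn_inverse.clm_apply contDiffOn_const) hG.isOpen hp
  have hGν : ∀ i, ∀ q ∈ U, ∀ u, G q (ν i q) u = u i := fun i q hq u => by
    simp only [ν, (hG.isInvertible hq).self_apply_inverse]
    rfl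
  -- The derivative of `ν i` comes from differentiating `G (ν i) u = u i`.
  have hν' : ∀ i, fderiv ℝ (ν i) p w = -christoffel G p w (ν i p) -
      ∑ j, (christoffel G p w (EuclideanSpace.single j 1)) i • ν j p := by
    intro i
    refine hG.eq_of_apply_eq hp fun u => ?_
    have h1 : fderiv ℝ (fun q => G q (ν i q) u) p w = 0 := by
      rw [(show (fun q => G q (ν i q) u) =ᶠ[𝓝 p] fun _ => u i from
        eventually_of_mem (hG.isOpen.mem_nhds hp) fun q hq => hGν i q hq u).fderiv_eq]
      simp
    rw [fderiv_clm_apply₂ (hG.differentiableAt hp) (hνd i) (differentiableAt_const u),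
      hG.fderiv_apply hp, hGν i p hp] at h1
    have h2 : (christoffel G p w u) i =
        ∑ j, u j * (christoffel G p w (EuclideanSpace.single j 1)) i := by
      conv_lhs => rw [← sum_coord_smul_single u, ← christoffelL_apply, map_sum]
      simp
    simp only [map_sub, map_neg, map_sum, map_smul, sub_apply, neg_apply, sum_apply, smul_apply,
      smul_eq_mul, hGν _ p hp]
    simp only [fderiv_fun_const, Pi.zero_apply, zero_apply, map_zero, add_zero, h2] at h1
    simp only [mul_comm (u _)] at h1
    linarith
  have hstep : fderiv ℝ (fun q => metricTrace (G q) (fun u v => P q u v)) p w =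
      metricTrace (G p) (fun u v => (fderiv ℝ P p w -
        (P p).bilinearComp (christoffelL G p w) (ContinuousLinearMap.id ℝ (E m)) -
        (P p).bilinearComp (ContinuousLinearMap.id ℝ (E m)) (christoffelL G p w)) u v) := by
    have h1 : ∀ i, DifferentiableAt ℝ (fun q => P q (EuclideanSpace.single i 1) (ν i q)) p :=
      fun i => (hP.clm_apply (differentiableAt_const _)).clm_apply (hνd i)
    have h2 : fderiv ℝ (fun q => metricTrace (G q) (fun u v => P q u v)) p w =
        ∑ i, fderiv ℝ (fun q => P q (EuclideanSpace.single i 1) (ν i q)) p w := by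
      unfold metricTrace
      rw [fderiv_fun_sum fun i _ => h1 i, sum_apply]
    have h3 : ∀ i, fderiv ℝ (fun q => P q (EuclideanSpace.single i 1) (ν i q)) p w =
        fderiv ℝ P p w (EuclideanSpace.single i 1) (ν i p) -
          P p (EuclideanSpace.single i 1) (christoffel G p w (ν i p)) -
          ∑ j, (christoffel G p w (EuclideanSpace.single j 1)) i •
            P p (EuclideanSpace.single i 1) (ν j p) := by
      intro i
      rw [fderiv_clm_apply₂ hP (differentiableAt_const _) (hνd i), hν' i]
      simp only [fderiv_fun_const, Pi.zero_apply, zero_apply, map_zero, add_zero, map_sub,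
        map_neg, map_sum, map_smul]
      abel
    have h4 : ∑ i, ∑ j, (christoffel G p w (EuclideanSpace.single j 1)) i •
          P p (EuclideanSpace.single i 1) (ν j p) =
        ∑ j, P p (christoffel G p w (EuclideanSpace.single j 1)) (ν j p) := by
      rw [Finset.sum_comm]
      refine Finset.sum_congr rfl fun j _ => ?_
      conv_rhs => rw [← sum_coord_smul_single (christoffel G p w (EuclideanSpace.single j 1))]
      simp
    rw [h2, Finset.sum_congr rfl fun i _ => h3 i, Finset.sum_sub_distrib, h4,
      ← Finset.sum_sub_distrib]
    refine Finset.sum_congr rfl fun i _ => ?_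
    simp only [sub_apply, ContinuousLinearMap.bilinearComp_apply, christoffelL_apply,
      ContinuousLinearMap.id_apply]
    exact sub_right_comm _ _ _
  rw [hstep, he.metricTrace_eq hinv]
  rfl

end Trace

/-! ### The Bochner formula in coordinates -/

section Bochner

variable {n m : ℕ} {G : E m → E m →L[ℝ] E m →L[ℝ] ℝ} {H : E n → E n →L[ℝ] E n →L[ℝ] ℝ}
  {U : Set (E m)} {V : Set (E n)} {f : E m → E n} {p : E m}

/-- The second fundamental form in coordinates as a continuous bilinear map. -/
def sffL (G : E m → E m →L[ℝ] E m →L[ℝ] ℝ) (H : E n → E n →L[ℝ] E n →L[ℝ] ℝ)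
    (f : E m → E n) (p : E m) : E m →L[ℝ] E m →L[ℝ] E n :=
  fderiv ℝ (fderiv ℝ f) p -
    (ContinuousLinearMap.compL ℝ (E m) (E m) (E n) (fderiv ℝ f p)) ∘L christoffelL G p +
    (christoffelL H (f p)).bilinearComp (fderiv ℝ f p) (fderiv ℝ f p)

@[simp]
theorem sffL_apply (u v : E m) : sffL G H f p u v = coordSecondFundForm G H f p u v := by
  simp [sffL, coordSecondFundForm]

theorem contDiffOn_sffL (hG : IsMetricOn G U) (hH : IsMetricOn H V) (hf : ContDiffOn ℝ ∞ f U)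
    (hfV : MapsTo f U V) : ContDiffOn ℝ ∞ (sffL G H f) U := by
  have hf' := contDiffOn_fderiv hf hG.isOpen
  have hf'' := contDiffOn_fderiv hf' hG.isOpen
  refine contDiffOn_clm_apply₂ fun u v => ?_
  simp only [sffL_apply, coordSecondFundForm]
  exact (((hf''.clm_apply contDiffOn_const).clm_apply contDiffOn_const).sub
    (hf'.clm_apply ((hG.contDiffOn_christoffelL.clm_apply contDiffOn_const).clm_apply
      contDiffOn_const))).add
    (((hH.contDiffOn_christoffelL.comp hf hfV).clm_apply (hf'.clm_apply contDiffOn_const)).clm_apply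
      (hf'.clm_apply contDiffOn_const))

theorem contDiffOn_sff (hG : IsMetricOn G U) (hH : IsMetricOn H V) (hf : ContDiffOn ℝ ∞ f U)
    (hfV : MapsTo f U V) (u v : E m) :
    ContDiffOn ℝ ∞ (fun q => coordSecondFundForm G H f q u v) U := by
  simp only [← sffL_apply]
  exact ((contDiffOn_sffL hG hH hf hfV).clm_apply contDiffOn_const).clm_apply contDiffOn_const

theorem sff_comm (hG : IsMetricOn G U) (hH : IsMetricOn H V) (hf : ContDiffOn ℝ ∞ f U)
    (hfV : MapsTo f U V) (hp : p ∈ U) (u v : E m) :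
    coordSecondFundForm G H f p u v = coordSecondFundForm G H f p v u := by
  rw [coordSecondFundForm, coordSecondFundForm, fderiv_fderiv_comm hf hG.isOpen hp,
    hG.christoffel_comm hp, hH.christoffel_comm (hfV hp)]

/-- The covariant derivative of `q ↦ df_q(X q)` in terms of the second fundamental form. -/
theorem covDeriv_fderiv_apply (hG : IsMetricOn G U) (hf : ContDiffOn ℝ ∞ f U) (hp : p ∈ U)
    {X : E m → E m} (hX : DifferentiableAt ℝ X p) (u : E m) :
    covDeriv H f (fun q => fderiv ℝ f q (X q)) p u =
      coordSecondFundForm G H f p u (X p) +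
        fderiv ℝ f p (christoffel G p u (X p)) + fderiv ℝ f p (fderiv ℝ X p u) := by
  have hd := differentiableAt_of_isOpen (contDiffOn_fderiv hf hG.isOpen) hG.isOpen hp
  rw [covDeriv, fderiv_clm_apply_apply hd hX, coordSecondFundForm]
  abel

theorem covDeriv_fderiv_const (hG : IsMetricOn G U) (hf : ContDiffOn ℝ ∞ f U) (hp : p ∈ U)
    (u v : E m) :
    covDeriv H f (fun q => fderiv ℝ f q v) p u =
      coordSecondFundForm G H f p u v + fderiv ℝ f p (christoffel G p u v) := by
  rw [covDeriv_fderiv_apply hG hf hp (differentiableAt_const v)]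
  simp

/-- The covariant derivative `(∇_w ∇df)(u, v)` of the second fundamental form. -/
def covSff (G : E m → E m →L[ℝ] E m →L[ℝ] ℝ) (H : E n → E n →L[ℝ] E n →L[ℝ] ℝ)
    (f : E m → E n) (p w u v : E m) : E n :=
  covDeriv H f (fun q => coordSecondFundForm G H f q u v) p w -
    coordSecondFundForm G H f p (christoffel G p w u) v -
    coordSecondFundForm G H f p u (christoffel G p w v)

theorem covSff_comm_right (hG : IsMetricOn G U) (hH : IsMetricOn H V)
    (hf : ContDiffOn ℝ ∞ f U) (hfV : MapsTo f U V) (hp : p ∈ U) (w u v : E m) :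
    covSff G H f p w u v = covSff G H f p w v u := by
  have h := covDeriv_congr (H := H) (f := f) (eventually_of_mem (hG.isOpen.mem_nhds hp)
    fun q hq => sff_comm hG hH hf hfV hq u v) w
  rw [covSff, covSff, h, sff_comm hG hH hf hfV hp u, sff_comm hG hH hf hfV hp v]
  exact sub_right_comm _ _ _

/-- The Ricci identity for the second fundamental form. -/
theorem covSff_sub_covSff (hG : IsMetricOn G U) (hH : IsMetricOn H V)
    (hf : ContDiffOn ℝ ∞ f U) (hfV : MapsTo f U V) (hp : p ∈ U) (w u v : E m) :
    covSff G H f p w u v - covSff G H f p u w v =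
      riemannTensor H (f p) (fderiv ℝ f p w) (fderiv ℝ f p u) (fderiv ℝ f p v) -
        fderiv ℝ f p (riemannTensor G p w u v) := by
  have hU := hG.isOpen
  have hf' := contDiffOn_fderiv hf hU
  have hW : ContDiffOn ℝ ∞ (fun q => fderiv ℝ f q v) U := hf'.clm_apply contDiffOn_const
  have hΓ : ∀ a, ContDiffOn ℝ ∞ (fun q => christoffel G q a v) U := fun a =>
    (hG.contDiffOn_christoffelL.clm_apply contDiffOn_const).clm_apply contDiffOn_const
  have hΓd : ∀ a, DifferentiableAt ℝ (fun q => christoffel G q a v) p := fun a =>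
    differentiableAt_of_isOpen (hΓ a) hU hp
  -- The second fundamental form is `D_a (df v) - df (Γ(a, v))`.
  have key : ∀ a b, covDeriv H f (fun q => coordSecondFundForm G H f q a v) p b =
      covDeriv H f (fun q => covDeriv H f (fun q => fderiv ℝ f q v) q a) p b -
        (coordSecondFundForm G H f p b (christoffel G p a v) +
          fderiv ℝ f p (christoffel G p b (christoffel G p a v)) +
          fderiv ℝ f p (fderiv ℝ (fun q => christoffel G q a v) p b)) := by
    intro a b
    have h1 : (fun q => coordSecondFundForm G H f q a v) =ᶠ[𝓝 p] fun q =>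
        covDeriv H f (fun q => fderiv ℝ f q v) q a - fderiv ℝ f q (christoffel G q a v) :=
      eventually_of_mem (hU.mem_nhds hp) fun q hq => by
        simp [covDeriv_fderiv_const hG hf hq]
    rw [covDeriv_congr h1, covDeriv_sub, covDeriv_fderiv_apply hG hf hp (hΓd a)]
    · exact differentiableAt_of_isOpen (contDiffOn_covDeriv hH hU hf hfV hW a) hU hp
    · exact (differentiableAt_of_isOpen hf' hU hp).clm_apply (hΓd a)
  rw [covSff, covSff, key, key, ← covDeriv_covDeriv_sub hH hU hf hfV hW hp w u,
    hG.christoffel_comm hp u w, riemannTensor]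
  simp only [map_add, map_sub]
  abel

theorem contDiffOn_pullback (hH : IsMetricOn H V) (hU : IsOpen U) (hf : ContDiffOn ℝ ∞ f U)
    (hfV : MapsTo f U V) :
    ContDiffOn ℝ ∞ (fun q => (H (f q)).bilinearComp (fderiv ℝ f q) (fderiv ℝ f q)) U := by
  have hf' := contDiffOn_fderiv hf hU
  refine contDiffOn_clm_apply₂ fun u v => ?_
  simp only [ContinuousLinearMap.bilinearComp_apply]
  exact ((hH.contDiffOn.comp hf hfV).clm_apply (hf'.clm_apply contDiffOn_const)).clm_apply
    (hf'.clm_apply contDiffOn_const)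

/-- The energy density `|df|²` in coordinates. -/
def coordNormSq (G : E m → E m →L[ℝ] E m →L[ℝ] ℝ) (H : E n → E n →L[ℝ] E n →L[ℝ] ℝ)
    (f : E m → E n) (p : E m) : ℝ :=
  metricTrace (G p) fun u v => H (f p) (fderiv ℝ f p u) (fderiv ℝ f p v)

theorem contDiffOn_coordNormSq (hG : IsMetricOn G U) (hH : IsMetricOn H V)
    (hf : ContDiffOn ℝ ∞ f U) (hfV : MapsTo f U V) : ContDiffOn ℝ ∞ (coordNormSq G H f) U :=
  contDiffOn_metricTrace hG (contDiffOn_pullback hH hG.isOpen hf hfV)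

/-- The covariant derivative of the pull-back `f^*H` in the direction `w`, as a bilinear form. -/
def covPullback (G : E m → E m →L[ℝ] E m →L[ℝ] ℝ) (H : E n → E n →L[ℝ] E n →L[ℝ] ℝ)
    (f : E m → E n) (w : E m) (p : E m) : E m →L[ℝ] E m →L[ℝ] ℝ :=
  (H (f p)).bilinearComp (sffL G H f p w) (fderiv ℝ f p) +
    (H (f p)).bilinearComp (fderiv ℝ f p) (sffL G H f p w)

@[simp]
theorem covPullback_apply (w u v : E m) :
    covPullback G H f w p u v =
      H (f p) (coordSecondFundForm G H f p w u) (fderiv ℝ f p v) +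
        H (f p) (fderiv ℝ f p u) (coordSecondFundForm G H f p w v) := by
  simp [covPullback]

theorem contDiffOn_covPullback (hG : IsMetricOn G U) (hH : IsMetricOn H V)
    (hf : ContDiffOn ℝ ∞ f U) (hfV : MapsTo f U V) (w : E m) :
    ContDiffOn ℝ ∞ (covPullback G H f w) U := by
  have hf' := contDiffOn_fderiv hf hG.isOpen
  have hHf := hH.contDiffOn.comp hf hfV
  have hB := contDiffOn_sff hG hH hf hfV
  refine contDiffOn_clm_apply₂ fun u v => ?_
  simp only [covPullback_apply]
  exact ((hHf.clm_apply (hB w u)).clm_apply (hf'.clm_apply contDiffOn_const)).add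
    ((hHf.clm_apply (hf'.clm_apply contDiffOn_const)).clm_apply (hB w v))

theorem metricTrace_covPullback (hG : IsMetricOn G U) (hp : p ∈ U)
    {e : Fin m → E m} (he : IsOrthonormalFrame (G p) e) (w : E m) :
    metricTrace (G p) (fun u v => covPullback G H f w p u v) =
      ∑ i, covPullback G H f w p (e i) (e i) :=
  he.metricTrace_eq (hG.isInvertible hp) _

theorem fderiv_coordNormSq (hG : IsMetricOn G U) (hH : IsMetricOn H V)
    (hf : ContDiffOn ℝ ∞ f U) (hfV : MapsTo f U V) (hp : p ∈ U)
    {e : Fin m → E m} (he : IsOrthonormalFrame (G p) e) (w : E m) :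
    fderiv ℝ (coordNormSq G H f) p w = ∑ i, covPullback G H f w p (e i) (e i) := by
  have hU := hG.isOpen
  have hdf := differentiableAt_of_isOpen hf hU hp
  have hf' := contDiffOn_fderiv hf hU
  have hd : ∀ v, DifferentiableAt ℝ (fun q => fderiv ℝ f q v) p := fun v =>
    (differentiableAt_of_isOpen hf' hU hp).clm_apply (differentiableAt_const v)
  have hP := differentiableAt_of_isOpen (contDiffOn_pullback hH hU hf hfV) hU hp
  have h := fderiv_metricTrace hG hp hP he w
  refine h.trans (Finset.sum_congr rfl fun i _ => ?_)
  rw [← fderiv_clm_apply₂_const hP]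
  simp only [ContinuousLinearMap.bilinearComp_apply]
  rw [fderiv_inner_along hH (hfV hp) hdf (hd _) (hd _), covDeriv_fderiv_const hG hf hp]
  simp only [map_add, add_apply, covPullback_apply]
  ring

/-- The Hessian of the energy density. -/
theorem coordHessian_coordNormSq (hG : IsMetricOn G U) (hH : IsMetricOn H V)
    (hf : ContDiffOn ℝ ∞ f U) (hfV : MapsTo f U V) (hp : p ∈ U)
    {e : Fin m → E m} (hframe : ∀ q ∈ U, ∃ e, IsOrthonormalFrame (G q) e)
    (he : IsOrthonormalFrame (G p) e) (w : E m) :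
    coordHessian G (coordNormSq G H f) p w w = 2 * ∑ i,
      (H (f p) (covSff G H f p w w (e i)) (fderiv ℝ f p (e i)) +
        H (f p) (coordSecondFundForm G H f p w (e i)) (coordSecondFundForm G H f p w (e i))) := by
  have hU := hG.isOpen
  have hdf := differentiableAt_of_isOpen hf hU hp
  have hf' := contDiffOn_fderiv hf hU
  have hd : ∀ v, DifferentiableAt ℝ (fun q => fderiv ℝ f q v) p := fun v =>
    (differentiableAt_of_isOpen hf' hU hp).clm_apply (differentiableAt_const v)
  have hHf : DifferentiableAt ℝ (fun q => H (f q)) p :=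
    (hH.differentiableAt (hfV hp)).comp p hdf
  have hB : ∀ u v, DifferentiableAt ℝ (fun q => coordSecondFundForm G H f q u v) p := fun u v =>
    differentiableAt_of_isOpen (contDiffOn_sff hG hH hf hfV u v) hU hp
  have hS := differentiableAt_of_isOpen (contDiffOn_covPullback hG hH hf hfV w) hU hp
  have h1 : fderiv ℝ (fderiv ℝ (coordNormSq G H f)) p w w =
      fderiv ℝ (fun q => metricTrace (G q) fun u v => covPullback G H f w q u v) p w := by
    rw [← fderiv_clm_apply_const (differentiableAt_of_isOpen
      (contDiffOn_fderiv (contDiffOn_coordNormSq hG hH hf hfV) hU) hU hp)]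
    refine congrArg (fun L : E m →L[ℝ] ℝ => L w) (EventuallyEq.fderiv_eq ?_)
    refine eventually_of_mem (hU.mem_nhds hp) fun q hq => ?_
    obtain ⟨e', he'⟩ := hframe q hq
    simp only [fderiv_coordNormSq hG hH hf hfV hq he', metricTrace_covPullback hG hq he']
  rw [coordHessian, h1, fderiv_metricTrace hG hp hS he, fderiv_coordNormSq hG hH hf hfV hp he,
    ← Finset.sum_sub_distrib, Finset.mul_sum]
  refine Finset.sum_congr rfl fun i _ => ?_
  rw [← fderiv_clm_apply₂_const hS]
  simp only [covPullback_apply]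
  rw [fderiv_fun_add ((hHf.clm_apply (hB _ _)).clm_apply (hd _))
    ((hHf.clm_apply (hd _)).clm_apply (hB _ _)), add_apply,
    fderiv_inner_along hH (hfV hp) hdf (hd _) (hB _ _),
    fderiv_inner_along hH (hfV hp) hdf (hB _ _) (hd _), covDeriv_fderiv_const hG hf hp]
  simp only [covSff, map_add, map_sub, add_apply, sub_apply]
  have hs := hH.symm (f p) (hfV hp)
  rw [hs (fderiv ℝ f p (e i)) (covDeriv H f _ p w),
    hs (fderiv ℝ f p (e i)) (coordSecondFundForm G H f p w (christoffel G p w (e i))),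
    hs (fderiv ℝ f p (christoffel G p w (e i))),
    hs (fderiv ℝ f p (e i)) (coordSecondFundForm G H f p (christoffel G p w w) (e i))]
  ring

/-- The tension field in coordinates. -/
def coordTension (G : E m → E m →L[ℝ] E m →L[ℝ] ℝ) (H : E n → E n →L[ℝ] E n →L[ℝ] ℝ)
    (f : E m → E n) (p : E m) : E n :=
  metricTrace (G p) (coordSecondFundForm G H f p)

theorem coordTension_eq_metricTrace_sffL (q : E m) :
    coordTension G H f q = metricTrace (G q) (fun u v => sffL G H f q u v) := by
  simp [coordTension]

theorem coordTension_eq (hG : IsMetricOn G U) (hp : p ∈ U)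
    {e : Fin m → E m} (he : IsOrthonormalFrame (G p) e) :
    coordTension G H f p = ∑ i, coordSecondFundForm G H f p (e i) (e i) := by
  rw [coordTension_eq_metricTrace_sffL, he.metricTrace_eq (hG.isInvertible hp)]
  simp

theorem contDiffOn_coordTension (hG : IsMetricOn G U) (hH : IsMetricOn H V)
    (hf : ContDiffOn ℝ ∞ f U) (hfV : MapsTo f U V) : ContDiffOn ℝ ∞ (coordTension G H f) U :=
  (contDiffOn_metricTrace hG (contDiffOn_sffL hG hH hf hfV)).congr fun q _ =>
    coordTension_eq_metricTrace_sffL q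

theorem covDeriv_coordTension (hG : IsMetricOn G U) (hH : IsMetricOn H V)
    (hf : ContDiffOn ℝ ∞ f U) (hfV : MapsTo f U V) (hp : p ∈ U)
    {e : Fin m → E m} (he : IsOrthonormalFrame (G p) e) (w : E m) :
    covDeriv H f (coordTension G H f) p w = ∑ i, covSff G H f p w (e i) (e i) := by
  have hB := differentiableAt_of_isOpen (contDiffOn_sffL hG hH hf hfV) hG.isOpen hp
  have h : coordTension G H f = fun q => metricTrace (G q) (fun u v => sffL G H f q u v) :=
    funext coordTension_eq_metricTrace_sffL
  rw [covDeriv, coordTension_eq hG hp he, h, fderiv_metricTrace hG hp hB he, ← christoffelL_apply,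
    map_sum, ← Finset.sum_add_distrib]
  refine Finset.sum_congr rfl fun i _ => ?_
  rw [← fderiv_clm_apply₂_const hB]
  simp only [covSff, covDeriv, sffL_apply, christoffelL_apply]
  abel

/-- The Bochner formula for the energy density of a map. -/
theorem metricTrace_coordHessian_coordNormSq (hG : IsMetricOn G U) (hH : IsMetricOn H V)
    (hf : ContDiffOn ℝ ∞ f U) (hfV : MapsTo f U V) (hp : p ∈ U)
    {e : Fin m → E m} (hframe : ∀ q ∈ U, ∃ e, IsOrthonormalFrame (G q) e)
    (he : IsOrthonormalFrame (G p) e) :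
    ∑ k, coordHessian G (coordNormSq G H f) p (e k) (e k) = 2 *
      (∑ k, ∑ i, H (f p) (coordSecondFundForm G H f p (e k) (e i))
          (coordSecondFundForm G H f p (e k) (e i)) +
        ∑ i, H (f p) (covDeriv H f (coordTension G H f) p (e i)) (fderiv ℝ f p (e i)) +
        ∑ k, ∑ i, (H (f p) (riemannTensor H (f p) (fderiv ℝ f p (e k)) (fderiv ℝ f p (e i))
            (fderiv ℝ f p (e k))) (fderiv ℝ f p (e i)) -
          H (f p) (fderiv ℝ f p (riemannTensor G p (e k) (e i) (e k))) (fderiv ℝ f p (e i)))) := by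
  have h1 : ∀ k i, covSff G H f p (e k) (e k) (e i) = covSff G H f p (e i) (e k) (e k) +
      (riemannTensor H (f p) (fderiv ℝ f p (e k)) (fderiv ℝ f p (e i)) (fderiv ℝ f p (e k)) -
        fderiv ℝ f p (riemannTensor G p (e k) (e i) (e k))) := by
    intro k i
    rw [covSff_comm_right hG hH hf hfV hp, ← covSff_sub_covSff hG hH hf hfV hp]
    abel
  have h2 : ∑ i, H (f p) (covDeriv H f (coordTension G H f) p (e i)) (fderiv ℝ f p (e i)) =
      ∑ k, ∑ i, H (f p) (covSff G H f p (e i) (e k) (e k)) (fderiv ℝ f p (e i)) := by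
    rw [Finset.sum_comm]
    refine Finset.sum_congr rfl fun i _ => ?_
    rw [covDeriv_coordTension hG hH hf hfV hp he]
    simp
  rw [h2]
  simp only [coordHessian_coordNormSq hG hH hf hfV hp hframe he, ← Finset.mul_sum, h1,
    ← Finset.sum_add_distrib, map_add, map_sub, add_apply, sub_apply]
  refine congrArg (2 * ·) (Finset.sum_congr rfl fun k _ => Finset.sum_congr rfl fun i _ => ?_)
  ring

end Bochner

/-! ### Curvature in orthonormal frames and the Bochner formula on a surface -/

section Curvature

variable {n : ℕ} {H : E n → E n →L[ℝ] E n →L[ℝ] ℝ} {V : Set (E n)} {y : E n}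

namespace IsMetricOn

theorem nonneg (hH : IsMetricOn H V) (hy : y ∈ V) (u : E n) : 0 ≤ H y u u := by
  rcases eq_or_ne u 0 with rfl | hu
  · simp
  · exact (hH.pos y hy u hu).le

theorem riemannTensor_eq (hH : IsMetricOn H V) (hy : y ∈ V) (u v w : E n) :
    riemannTensor H y u v w =
      fderiv ℝ (christoffelL H) y u v w - fderiv ℝ (christoffelL H) y v u w +
        christoffelL H y u (christoffelL H y v w) - christoffelL H y v (christoffelL H y u w) := by
  have hdΓ := hH.differentiableAt_christoffelL hy
  rw [← fderiv_clm_apply₂_const hdΓ, ← fderiv_clm_apply₂_const hdΓ]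
  rfl

/-- The Ricci curvature is the sum of `⟨R(eₐ, v) w, eₐ⟩` over an orthonormal frame. -/
theorem ricci_eq (hH : IsMetricOn H V) (hy : y ∈ V) {e : Fin n → E n}
    (he : IsOrthonormalFrame (H y) e) (v w : E n) :
    ricci H y v w = ∑ a, H y (riemannTensor H y (e a) v w) (e a) := by
  let L : E n →ₗ[ℝ] E n :=
    { toFun := fun u => riemannTensor H y u v w
      map_add' := fun a b => by simp only [hH.riemannTensor_eq hy, map_add, add_apply]; abel
      map_smul' := fun c a => by
        simp only [hH.riemannTensor_eq hy, map_smul, smul_apply, RingHom.id_apply]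
        module }
  have hL : ∀ u, riemannTensor H y u v w = L u := fun u => rfl
  simp only [ricci, hL]
  calc ∑ i, (L (EuclideanSpace.single i 1)) i
      = ∑ i, ∑ a, H y (L (EuclideanSpace.single i 1)) (e a) * (e a) i := by
        refine Finset.sum_congr rfl fun i _ => ?_
        conv_lhs => rw [← he.sum_smul (L (EuclideanSpace.single i 1))]
        simp
    _ = ∑ a, H y (L (∑ i, (e a) i • EuclideanSpace.single i (1 : ℝ))) (e a) := by
        rw [Finset.sum_comm]
        simp [mul_comm]
    _ = ∑ a, H y (L (e a)) (e a) := by simp only [sum_coord_smul_single]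

theorem metricTrace_ricci (hH : IsMetricOn H V) (hy : y ∈ V) {e : Fin n → E n}
    (he : IsOrthonormalFrame (H y) e) :
    metricTrace (H y) (ricci H y) = ∑ b, ∑ a, H y (riemannTensor H y (e a) (e b) (e b)) (e a) := by
  let L : E n →L[ℝ] E n →L[ℝ] ℝ :=
    LinearMap.toContinuousLinearMap <| LinearMap.toContinuousLinearMap.toLinearMap ∘ₗ
      LinearMap.mk₂ ℝ (ricci H y)
        (fun v v' w => by
          simp only [hH.ricci_eq hy he, hH.riemannTensor_eq hy, map_add, map_sub, add_apply,
            sub_apply, ← Finset.sum_add_distrib]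
          exact Finset.sum_congr rfl fun _ _ => by ring)
        (fun c v w => by
          simp only [hH.ricci_eq hy he, hH.riemannTensor_eq hy, map_add, map_sub, map_smul,
            add_apply, sub_apply, smul_apply, smul_eq_mul, Finset.mul_sum]
          exact Finset.sum_congr rfl fun _ _ => by ring)
        (fun v w w' => by
          simp only [hH.ricci_eq hy he, hH.riemannTensor_eq hy, map_add, map_sub, add_apply,
            sub_apply, ← Finset.sum_add_distrib]
          exact Finset.sum_congr rfl fun _ _ => by ring)
        (fun c v w => by
          simp only [hH.ricci_eq hy he, hH.riemannTensor_eq hy, map_add, map_sub, map_smul,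
            add_apply, sub_apply, smul_apply, smul_eq_mul, Finset.mul_sum]
          exact Finset.sum_congr rfl fun _ _ => by ring)
  have hL : ricci H y = fun v w => L v w := rfl
  rw [hL, he.metricTrace_eq (hH.isInvertible hy)]
  exact Finset.sum_congr rfl fun b _ => hH.ricci_eq hy he (e b) (e b)

theorem riemannTensor_self_left (u w : E n) : riemannTensor H y u u w = 0 := by
  simp [riemannTensor]

theorem riemannTensor_eq_zero_of_not_linearIndependent (hH : IsMetricOn H V) (hy : y ∈ V)
    {u v : E n} (h : ¬ LinearIndependent ℝ ![u, v]) (w : E n) : riemannTensor H y u v w = 0 := by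
  rw [LinearIndependent.pair_iff] at h
  push Not at h
  obtain ⟨s, t, hst, hne⟩ := h
  by_cases hs : s = 0
  · have ht : t ≠ 0 := hne hs
    have hv : v = 0 := by simpa [hs, ht] using hst
    simp only [hH.riemannTensor_eq hy, hv, map_zero, zero_apply, add_zero, sub_self]
  · have hu : u = (-(s⁻¹ * t)) • v := by
      have : s⁻¹ • (s • u + t • v) = 0 := by rw [hst, smul_zero]
      rw [smul_add, smul_smul, smul_smul, inv_mul_cancel₀ hs, one_smul] at this
      rw [neg_smul]
      exact eq_neg_of_add_eq_zero_left this
    rw [hH.riemannTensor_eq hy, hu]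
    simp only [map_smul, smul_apply]
    abel

end IsMetricOn

/-- On a surface the scalar curvature is twice the Gauss curvature. -/
theorem scalar_eq_two_mul_gauss {G : E 2 → E 2 →L[ℝ] E 2 →L[ℝ] ℝ} {U : Set (E 2)} {p : E 2}
    (hG : IsMetricOn G U) (hp : p ∈ U) {e : Fin 2 → E 2} (he : IsOrthonormalFrame (G p) e) :
    metricTrace (G p) (ricci G p) = 2 * G p (riemannTensor G p (e 0) (e 1) (e 1)) (e 0) := by
  rw [hG.metricTrace_ricci hp he]
  simp only [Fin.sum_univ_two, IsMetricOn.riemannTensor_self_left, map_zero, zero_apply]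
  rw [riemannTensor_swap p (e 1) (e 0) (e 0), map_neg, neg_apply,
    hG.riemannTensor_skew hp (e 0) (e 1) (e 0) (e 1)]
  ring

theorem riemannTensor_surface {G : E 2 → E 2 →L[ℝ] E 2 →L[ℝ] ℝ} {U : Set (E 2)} {p : E 2}
    (hG : IsMetricOn G U) (hp : p ∈ U) {e : Fin 2 → E 2} (he : IsOrthonormalFrame (G p) e) :
    riemannTensor G p (e 0) (e 1) (e 0) =
      -(G p (riemannTensor G p (e 0) (e 1) (e 1)) (e 0)) • e 1 ∧
    riemannTensor G p (e 1) (e 0) (e 1) =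
      -(G p (riemannTensor G p (e 0) (e 1) (e 1)) (e 0)) • e 0 := by
  have h0 := hG.riemannTensor_self hp (e 0) (e 1) (e 0)
  have h1 := hG.riemannTensor_self hp (e 0) (e 1) (e 1)
  have h2 := hG.riemannTensor_skew hp (e 0) (e 1) (e 0) (e 1)
  constructor
  · rw [← he.sum_smul (riemannTensor G p (e 0) (e 1) (e 0)), Fin.sum_univ_two, h0, h2]
    simp
  · rw [riemannTensor_swap p (e 1) (e 0) (e 1),
      ← he.sum_smul (riemannTensor G p (e 0) (e 1) (e 1)), Fin.sum_univ_two, h1]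
    simp [he 0 0]

end Curvature

section Solution

variable {n m : ℕ} {H : E n → E n →L[ℝ] E n →L[ℝ] ℝ} {V : Set (E n)}

/-- If `⟨τ(f), df⟩ = d(v ∘ f)`, the divergence of this equation expresses `∑ᵢ ⟨∇ᵢ τ, df(eᵢ)⟩`
through the Hessian of `v`. -/
theorem sum_covDeriv_coordTension {G : E m → E m →L[ℝ] E m →L[ℝ] ℝ} {U : Set (E m)}
    {f : E m → E n} {p : E m} {v : E n → ℝ} (hG : IsMetricOn G U) (hH : IsMetricOn H V)
    (hf : ContDiffOn ℝ ∞ f U) (hfV : MapsTo f U V) (hv : ContDiffOn ℝ ∞ v V) (hp : p ∈ U)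
    {e : Fin m → E m} (he : IsOrthonormalFrame (G p) e)
    (heq : ∀ q ∈ U, ∀ u, H (f q) (coordTension G H f q) (fderiv ℝ f q u) =
      fderiv ℝ v (f q) (fderiv ℝ f q u)) :
    ∑ i, H (f p) (covDeriv H f (coordTension G H f) p (e i)) (fderiv ℝ f p (e i)) =
      ∑ i, coordHessian H v (f p) (fderiv ℝ f p (e i)) (fderiv ℝ f p (e i)) +
        fderiv ℝ v (f p) (coordTension G H f p) -
        H (f p) (coordTension G H f p) (coordTension G H f p) := by
  have hU := hG.isOpen
  have hdf := differentiableAt_of_isOpen hf hU hp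
  have hf' := differentiableAt_of_isOpen (contDiffOn_fderiv hf hU) hU hp
  have hd : ∀ u, DifferentiableAt ℝ (fun q => fderiv ℝ f q u) p := fun u =>
    hf'.clm_apply (differentiableAt_const u)
  have hv' := differentiableAt_of_isOpen (contDiffOn_fderiv hv hH.isOpen) hH.isOpen (hfV hp)
  have hτ := differentiableAt_of_isOpen (contDiffOn_coordTension hG hH hf hfV) hU hp
  have key : ∀ u, H (f p) (covDeriv H f (coordTension G H f) p u) (fderiv ℝ f p u) =
      coordHessian H v (f p) (fderiv ℝ f p u) (fderiv ℝ f p u) +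
        fderiv ℝ v (f p) (coordSecondFundForm G H f p u u) -
        H (f p) (coordTension G H f p) (coordSecondFundForm G H f p u u) := by
    intro u
    have h1 : fderiv ℝ (fun q => H (f q) (coordTension G H f q) (fderiv ℝ f q u)) p u =
        fderiv ℝ (fun q => fderiv ℝ v (f q) (fderiv ℝ f q u)) p u := by
      refine congrArg (fun L : E m →L[ℝ] ℝ => L u) (EventuallyEq.fderiv_eq ?_)
      exact eventually_of_mem (hU.mem_nhds hp) fun q hq => heq q hq u
    rw [fderiv_inner_along hH (hfV hp) hdf hτ (hd u), covDeriv_fderiv_const hG hf hp,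
      fderiv_clm_apply_apply (A := fun q => fderiv ℝ v (f q)) (hv'.comp p hdf) (hd u),
      fderiv_comp_apply hv' hdf, fderiv_clm_apply_const hf'] at h1
    have h2 := heq p hp (christoffel G p u u)
    simp only [coordHessian, coordSecondFundForm, map_add, map_sub] at h1 ⊢
    linarith
  simp only [key, Finset.sum_sub_distrib, Finset.sum_add_distrib, ← map_sum,
    ← coordTension_eq hG hp he]

/-- The Bochner formula on a surface: the Ricci curvature of the domain is the Gauss curvature times
the metric, and a single component of the curvature of the target enters. -/
theorem bochner_surface {G : E 2 → E 2 →L[ℝ] E 2 →L[ℝ] ℝ} {U : Set (E 2)}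
    {f : E 2 → E n} {p : E 2} (hG : IsMetricOn G U) (hH : IsMetricOn H V)
    (hf : ContDiffOn ℝ ∞ f U) (hfV : MapsTo f U V) (hp : p ∈ U)
    {e : Fin 2 → E 2} (hframe : ∀ q ∈ U, ∃ e, IsOrthonormalFrame (G q) e)
    (he : IsOrthonormalFrame (G p) e) :
    (∑ k, coordHessian G (coordNormSq G H f) p (e k) (e k)) / 2 =
      ∑ k, ∑ i, H (f p) (coordSecondFundForm G H f p (e k) (e i))
          (coordSecondFundForm G H f p (e k) (e i)) +
        ∑ i, H (f p) (covDeriv H f (coordTension G H f) p (e i)) (fderiv ℝ f p (e i)) +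
        metricTrace (G p) (ricci G p) / 2 *
          ∑ i, H (f p) (fderiv ℝ f p (e i)) (fderiv ℝ f p (e i)) -
        2 * H (f p) (riemannTensor H (f p) (fderiv ℝ f p (e 0)) (fderiv ℝ f p (e 1))
          (fderiv ℝ f p (e 1))) (fderiv ℝ f p (e 0)) := by
  have h1 := hH.riemannTensor_skew (hfV hp) (fderiv ℝ f p (e 0)) (fderiv ℝ f p (e 1))
    (fderiv ℝ f p (e 0)) (fderiv ℝ f p (e 1))
  have h2 := congrArg (fun X => H (f p) X (fderiv ℝ f p (e 0)))
    (riemannTensor_swap (H := H) (f p) (fderiv ℝ f p (e 1)) (fderiv ℝ f p (e 0))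
      (fderiv ℝ f p (e 1)))
  obtain ⟨h3, h4⟩ := riemannTensor_surface hG hp he
  simp only [map_neg, neg_apply] at h2
  rw [metricTrace_coordHessian_coordNormSq hG hH hf hfV hp hframe he,
    scalar_eq_two_mul_gauss hG hp he]
  simp only [Fin.sum_univ_two, IsMetricOn.riemannTensor_self_left, map_zero, zero_apply, h1, h2,
    h3, h4, map_smul, smul_apply, smul_eq_mul]
  ring

end Solution

/-! ### The strong maximum principle -/

section MaximumPrinciple

variable {m : ℕ} {G : E m → E m →L[ℝ] E m →L[ℝ] ℝ} {U : Set (E m)} {p : E m} {u v : E m → ℝ}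

/-- The Hessian in coordinates as a continuous bilinear map. -/
def hessL (G : E m → E m →L[ℝ] E m →L[ℝ] ℝ) (u : E m → ℝ) (p : E m) : E m →L[ℝ] E m →L[ℝ] ℝ :=
  fderiv ℝ (fderiv ℝ u) p -
    (ContinuousLinearMap.compL ℝ (E m) (E m) ℝ (fderiv ℝ u p)) ∘L christoffelL G p

@[simp]
theorem hessL_apply (a b : E m) : hessL G u p a b = coordHessian G u p a b := by
  simp [hessL, coordHessian]

theorem contDiffOn_hessL (hG : IsMetricOn G U) (hu : ContDiffOn ℝ ∞ u U) :
    ContDiffOn ℝ ∞ (hessL G u) U := by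
  have hu' := contDiffOn_fderiv hu hG.isOpen
  have hu'' := contDiffOn_fderiv hu' hG.isOpen
  refine contDiffOn_clm_apply₂ fun a b => ?_
  simp only [hessL_apply, coordHessian]
  exact ((hu''.clm_apply contDiffOn_const).clm_apply contDiffOn_const).sub
    (hu'.clm_apply ((hG.contDiffOn_christoffelL.clm_apply contDiffOn_const).clm_apply
      contDiffOn_const))

/-- The Laplace operator in coordinates. -/
def coordLaplacian (G : E m → E m →L[ℝ] E m →L[ℝ] ℝ) (u : E m → ℝ) (p : E m) : ℝ :=
  metricTrace (G p) (coordHessian G u p)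

theorem coordLaplacian_eq_metricTrace_hessL (q : E m) :
    coordLaplacian G u q = metricTrace (G q) (fun a b => hessL G u q a b) := by
  simp [coordLaplacian]

theorem contDiffOn_coordLaplacian (hG : IsMetricOn G U) (hu : ContDiffOn ℝ ∞ u U) :
    ContDiffOn ℝ ∞ (coordLaplacian G u) U :=
  (contDiffOn_metricTrace hG (contDiffOn_hessL hG hu)).congr fun q _ =>
    coordLaplacian_eq_metricTrace_hessL q

theorem coordLaplacian_eq (hG : IsMetricOn G U) (hp : p ∈ U)
    {e : Fin m → E m} (he : IsOrthonormalFrame (G p) e) :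
    coordLaplacian G u p = ∑ i, coordHessian G u p (e i) (e i) := by
  rw [coordLaplacian_eq_metricTrace_hessL, he.metricTrace_eq (hG.isInvertible hp)]
  simp

theorem fderiv_fderiv_nonpos_of_isLocalMax (hU : IsOpen U) (hu : ContDiffOn ℝ ∞ u U) (hp : p ∈ U)
    (hmax : IsLocalMax u p) (a : E m) : fderiv ℝ (fderiv ℝ u) p a a ≤ 0 := by
  by_contra! hpos
  have hu' := contDiffOn_fderiv hu hU
  -- Restrict `u` to the line through `p` in the direction `a`.
  let l : ℝ → E m := fun t => p + t • a
  have hl : ∀ t, HasDerivAt l a t := fun t => by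
    simpa [l] using ((hasDerivAt_id t).smul_const a).const_add p
  have hl0 : l 0 = p := by simp [l]
  have hlU : ∀ᶠ t in 𝓝 (0 : ℝ), l t ∈ U :=
    (hl 0).continuousAt.eventually (by rw [hl0]; exact hU.mem_nhds hp)
  have h1 : ∀ t, l t ∈ U → HasDerivAt (u ∘ l) (fderiv ℝ u (l t) a) t := fun t ht =>
    (differentiableAt_of_isOpen hu hU ht).hasFDerivAt.comp_hasDerivAt t (hl t)
  have hd : deriv (u ∘ l) =ᶠ[𝓝 0] fun t => fderiv ℝ u (l t) a :=
    hlU.mono fun t ht => (h1 t ht).deriv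
  have h2 : HasDerivAt (fun t => fderiv ℝ u (l t) a) (fderiv ℝ (fderiv ℝ u) p a a) 0 := by
    have h := ((differentiableAt_of_isOpen hu' hU (by rw [hl0]; exact hp)).hasFDerivAt.comp_hasDerivAt
      (0 : ℝ) (hl 0)).clm_apply (hasDerivAt_const (0 : ℝ) a)
    simpa [hl0] using h
  have hdd : deriv (deriv (u ∘ l)) 0 = fderiv ℝ (fderiv ℝ u) p a a := by
    rw [hd.deriv_eq, h2.deriv]
  have hmax' : IsLocalMax (u ∘ l) 0 := by
    have : ∀ᶠ t in 𝓝 (0 : ℝ), u (l t) ≤ u p :=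
      (hl 0).continuousAt.eventually (by rw [hl0]; exact hmax)
    simpa [IsLocalMax, IsMaxFilter, hl0] using this
  have hmin : IsLocalMin (u ∘ l) 0 :=
    isLocalMin_of_deriv_deriv_pos (by rw [hdd]; exact hpos) hmax'.deriv_eq_zero
      (h1 0 (by rw [hl0]; exact hp)).continuousAt
  -- A point that is a local minimum and a local maximum has a neighbourhood of constancy.
  have hconst : u ∘ l =ᶠ[𝓝 0] fun _ => (u ∘ l) 0 := by
    filter_upwards [hmin, hmax'] with t h1 h2 using le_antisymm h2 h1
  have h0 : deriv (deriv (u ∘ l)) 0 = 0 := by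
    have : deriv (u ∘ l) =ᶠ[𝓝 0] fun _ => 0 := by
      simpa using hconst.deriv
    rw [this.deriv_eq]
    simp
  linarith

theorem coordLaplacian_nonpos_of_isLocalMax (hG : IsMetricOn G U)
    (hu : ContDiffOn ℝ ∞ u U) (hp : p ∈ U) (hframe : ∃ e, IsOrthonormalFrame (G p) e)
    (hmax : IsLocalMax u p) : coordLaplacian G u p ≤ 0 := by
  obtain ⟨e, he⟩ := hframe
  rw [coordLaplacian_eq hG hp he]
  refine Finset.sum_nonpos fun i _ => ?_
  rw [coordHessian, hmax.fderiv_eq_zero]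
  simpa using fderiv_fderiv_nonpos_of_isLocalMax hG.isOpen hu hp hmax (e i)

theorem coordLaplacian_add_const_mul (hG : IsMetricOn G U) (hp : p ∈ U)
    (hframe : ∃ e, IsOrthonormalFrame (G p) e) (hu : ContDiffOn ℝ ∞ u U)
    (hv : ContDiffOn ℝ ∞ v U) (c : ℝ) :
    coordLaplacian G (fun q => u q + c * v q) p =
      coordLaplacian G u p + c * coordLaplacian G v p := by
  obtain ⟨e, he⟩ := hframe
  have hU := hG.isOpen
  have h1 : ∀ q ∈ U, fderiv ℝ (fun q => u q + c * v q) q = fderiv ℝ u q + c • fderiv ℝ v q := by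
    intro q hq
    have hvq := differentiableAt_of_isOpen hv hU hq
    rw [fderiv_fun_add (differentiableAt_of_isOpen hu hU hq) (hvq.const_mul c),
      fderiv_const_mul hvq]
  have h2 : fderiv ℝ (fderiv ℝ (fun q => u q + c * v q)) p =
      fderiv ℝ (fderiv ℝ u) p + c • fderiv ℝ (fderiv ℝ v) p := by
    rw [(show fderiv ℝ (fun q => u q + c * v q) =ᶠ[𝓝 p] _ from
      eventually_of_mem (hU.mem_nhds hp) h1).fderiv_eq]
    have hvp := differentiableAt_of_isOpen (contDiffOn_fderiv hv hU) hU hp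
    have hup := differentiableAt_of_isOpen (contDiffOn_fderiv hu hU) hU hp
    exact (hup.hasFDerivAt.add (hvp.hasFDerivAt.const_smul c)).fderiv
  simp only [coordLaplacian_eq hG hp he, coordHessian, h1 p hp, h2, add_apply, smul_apply,
    smul_eq_mul, Finset.mul_sum, ← Finset.sum_add_distrib]
  exact Finset.sum_congr rfl fun _ _ => by ring

/-- The Laplacian of `exp (-α s) - c`. -/
theorem coordLaplacian_exp (hG : IsMetricOn G U) (hp : p ∈ U) {e : Fin m → E m}
    (he : IsOrthonormalFrame (G p) e) {s : E m → ℝ} (hs : ContDiffOn ℝ ∞ s U) (α c : ℝ) :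
    coordLaplacian G (fun q => Real.exp (-α * s q) - c) p =
      Real.exp (-α * s p) * (α ^ 2 * ∑ i, fderiv ℝ s p (e i) ^ 2 - α * coordLaplacian G s p) := by
  have hU := hG.isOpen
  have hs' := contDiffOn_fderiv hs hU
  have h1 : ∀ q ∈ U, fderiv ℝ (fun q => Real.exp (-α * s q) - c) q =
      (Real.exp (-α * s q) * -α) • fderiv ℝ s q := by
    intro q hq
    have hsq := (differentiableAt_of_isOpen hs hU hq)
    have := ((hsq.hasFDerivAt.const_mul (-α)).exp.sub_const c).fderiv
    rw [this, smul_smul]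
  have h2 : ∀ a, fderiv ℝ (fderiv ℝ (fun q => Real.exp (-α * s q) - c)) p a a =
      Real.exp (-α * s p) * (α ^ 2 * fderiv ℝ s p a ^ 2 - α * fderiv ℝ (fderiv ℝ s) p a a) := by
    intro a
    rw [(show fderiv ℝ (fun q => Real.exp (-α * s q) - c) =ᶠ[𝓝 p] _ from
      eventually_of_mem (hU.mem_nhds hp) h1).fderiv_eq]
    have hsp := (differentiableAt_of_isOpen hs hU hp)
    have hc := (hsp.hasFDerivAt.const_mul (-α)).exp.mul_const (-α)
    have hsp' := differentiableAt_of_isOpen hs' hU hp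
    have h3 : fderiv ℝ (fun q => (Real.exp (-α * s q) * -α) • fderiv ℝ s q) p = _ :=
      (hc.smul hsp'.hasFDerivAt).fderiv
    rw [h3]
    simp
    ring
  simp only [coordLaplacian_eq hG hp he, coordHessian, h1 p hp, h2, smul_apply, smul_eq_mul,
    Finset.mul_sum, ← Finset.sum_sub_distrib]
  exact Finset.sum_congr rfl fun _ _ => by ring

/-- Away from `z`, the function `exp (-α |q - z|²)` is strictly subharmonic for large `α`. -/
theorem exists_coordLaplacian_barrier_pos (hG : IsMetricOn G U)
    (hframe : ∀ q ∈ U, ∃ e, IsOrthonormalFrame (G q) e) {K : Set (E m)} (hK : IsCompact K)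
    (hKU : K ⊆ U) {z : E m} (hz : z ∉ K) :
    ∃ α : ℝ, 0 < α ∧ ∀ c, ∀ q ∈ K,
      0 < coordLaplacian G (fun q => Real.exp (-α * ‖q - z‖ ^ 2) - c) q := by
  rcases K.eq_empty_or_nonempty with rfl | hne
  · exact ⟨1, one_pos, fun _ _ h => h.elim⟩
  let s : E m → ℝ := fun q => ‖q - z‖ ^ 2
  have hs : ContDiff ℝ ∞ s := (contDiff_id.sub contDiff_const).norm_sq ℝ
  have hsU : ContDiffOn ℝ ∞ s U := hs.contDiffOn
  have hs' : ∀ q a, fderiv ℝ s q a = 2 * inner ℝ (q - z) a := by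
    intro q a
    have h : HasFDerivAt s _ q := ((hasFDerivAt_id q).sub_const z).norm_sq
    rw [h.fderiv]
    simp [inner_sub_left]
  -- The squared norm of `ds`, which is bounded below by a positive constant on `K`.
  let A : E m → ℝ := fun q => metricTrace (G q)
    (fun a b => (fderiv ℝ s q).smulRight (fderiv ℝ s q) a b)
  have hA : ContinuousOn A K := by
    refine ((contDiffOn_metricTrace hG (contDiffOn_clm_apply₂ fun a b => ?_)).continuousOn).mono hKU
    have hd := contDiffOn_fderiv hsU hG.isOpen
    exact (hd.clm_apply contDiffOn_const).mul (hd.clm_apply contDiffOn_const)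
  have hAe : ∀ q ∈ U, ∀ e, IsOrthonormalFrame (G q) e → A q = ∑ i, fderiv ℝ s q (e i) ^ 2 := by
    intro q hq e he
    simp only [A]
    rw [he.metricTrace_eq (hG.isInvertible hq)]
    simp [pow_two]
  have hApos : ∀ q ∈ K, 0 < A q := by
    intro q hq
    obtain ⟨e, he⟩ := hframe q (hKU hq)
    rw [hAe q (hKU hq) e he]
    have hnonneg : ∀ i ∈ Finset.univ, 0 ≤ fderiv ℝ s q (e i) ^ 2 := fun i _ => sq_nonneg _
    refine (Finset.sum_nonneg hnonneg).lt_of_ne fun h0 => ?_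
    have h1 := (Finset.sum_eq_zero_iff_of_nonneg hnonneg).1 h0.symm
    have h2 : fderiv ℝ s q (q - z) = 0 := by
      rw [← he.sum_smul (q - z), map_sum]
      refine Finset.sum_eq_zero fun i hi => ?_
      rw [map_smul, pow_eq_zero_iff two_ne_zero |>.1 (h1 i hi), smul_zero]
    rw [hs', real_inner_self_eq_norm_sq] at h2
    have h3 : q - z = 0 := by simpa using h2
    exact hz (sub_eq_zero.1 h3 ▸ hq)
  obtain ⟨q₀, hq₀, hmin⟩ := hK.exists_isMinOn hne hA
  obtain ⟨C, hC⟩ := hK.exists_bound_of_continuousOn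
    ((contDiffOn_coordLaplacian hG hsU).continuousOn.mono hKU)
  have hC0 : 0 ≤ C := (norm_nonneg _).trans (hC q₀ hq₀)
  have hα : 0 < (C + 1) / A q₀ := div_pos (by linarith) (hApos q₀ hq₀)
  refine ⟨(C + 1) / A q₀, hα, fun c q hq => ?_⟩
  obtain ⟨e, he⟩ := hframe q (hKU hq)
  rw [coordLaplacian_exp hG (hKU hq) he hsU, ← hAe q (hKU hq) e he]
  refine mul_pos (Real.exp_pos _) ?_
  have h1 : coordLaplacian G s q ≤ C := (le_abs_self _).trans (hC q hq)
  have h2 : C + 1 ≤ (C + 1) / A q₀ * A q := by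
    rw [div_mul_eq_mul_div, le_div_iff₀ (hApos q₀ hq₀)]
    exact mul_le_mul_of_nonneg_left (hmin hq) (by linarith)
  have h3 : 0 < (C + 1) / A q₀ * ((C + 1) / A q₀ * A q - coordLaplacian G s q) :=
    mul_pos hα (by linarith)
  linarith

/-- The strong maximum principle: a subharmonic function with an interior maximum is locally
constant there. -/
theorem eventually_eq_of_coordLaplacian_nonneg (hG : IsMetricOn G U)
    (hframe : ∀ q ∈ U, ∃ e, IsOrthonormalFrame (G q) e) (hu : ContDiffOn ℝ ∞ u U)
    (hL : ∀ q ∈ U, 0 ≤ coordLaplacian G u q) {c : ℝ} (hc : ∀ q ∈ U, u q ≤ c) (hp : p ∈ U)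
    (hup : u p = c) : ∀ᶠ q in 𝓝 p, u q = c := by
  obtain ⟨r', hr', hball⟩ := Metric.nhds_basis_closedBall.mem_iff.1 (hG.isOpen.mem_nhds hp)
  obtain ⟨r, hr, hrr⟩ : ∃ r, 0 < r ∧ 4 * r = r' := ⟨r' / 4, by positivity, by ring⟩
  subst hrr
  filter_upwards [Metric.ball_mem_nhds p hr] with z hz
  by_contra hzc
  rw [Metric.mem_ball] at hz
  -- The contact set, and its point `q₀` closest to `z`.
  have h2r : Metric.closedBall p (2 * r) ⊆ U :=
    (Metric.closedBall_subset_closedBall (by linarith)).trans hball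
  have hS : IsCompact (Metric.closedBall p (2 * r) ∩ u ⁻¹' {c}) :=
    (isCompact_closedBall p (2 * r)).of_isClosed_subset
      ((hu.continuousOn.mono h2r).preimage_isClosed_of_isClosed Metric.isClosed_closedBall
        isClosed_singleton) inter_subset_left
  have hpS : p ∈ Metric.closedBall p (2 * r) ∩ u ⁻¹' {c} :=
    ⟨Metric.mem_closedBall_self (by linarith), hup⟩
  obtain ⟨q₀, hq₀, hdist⟩ := hS.exists_infDist_eq_dist ⟨p, hpS⟩ z
  obtain ⟨R, hR⟩ : ∃ R, R = dist z q₀ := ⟨_, rfl⟩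
  have hR0 : 0 < R := by
    rw [hR, dist_pos]
    rintro rfl
    exact hzc hq₀.2
  have hRr : R < r := by
    rw [hR, ← hdist]
    exact (Metric.infDist_le_dist_of_mem hpS).trans_lt hz
  have hlt : ∀ y, dist z y < R → u y < c := by
    intro y hy
    have hyp : dist y p ≤ 2 * r := by
      have := dist_triangle y z p
      rw [dist_comm y z] at this
      linarith
    refine lt_of_le_of_ne (hc y (h2r hyp)) fun h => ?_
    have := Metric.infDist_le_dist_of_mem (x := z)
      (show y ∈ Metric.closedBall p (2 * r) ∩ u ⁻¹' {c} from ⟨hyp, h⟩)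
    rw [hdist, ← hR] at this
    linarith
  -- A smaller ball around `z'`, whose closure meets the contact set in `q₀` alone.
  obtain ⟨b, hb⟩ : ∃ b : E m, b = (1 / 2 : ℝ) • (q₀ - z) := ⟨_, rfl⟩
  obtain ⟨z', hz'⟩ : ∃ z', z' = z + b := ⟨_, rfl⟩
  have hq₀b : q₀ = z' + b := by rw [hz', hb]; module
  have hbR : ‖b‖ = R / 2 := by
    rw [hb, norm_smul, hR, dist_comm, dist_eq_norm]
    norm_num
    ring
  have hint : ∀ y, ‖y - z'‖ ≤ R / 2 → y ≠ q₀ → u y < c := by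
    intro y hy hne
    refine hlt y ?_
    have hpar := parallelogram_law_with_norm ℝ (y - z') b
    rw [show y - z' + b = y - z by rw [hz']; abel, show y - z' - b = y - q₀ by rw [hq₀b]; abel,
      hbR] at hpar
    have hpos : 0 < ‖y - q₀‖ := norm_pos_iff.2 (sub_ne_zero.2 hne)
    rw [dist_comm, dist_eq_norm]
    nlinarith [norm_nonneg (y - z), norm_nonneg (y - z')]
  -- The barrier, on a ball around `q₀` that does not contain `z'`.
  have hKU : Metric.closedBall q₀ (R / 4) ⊆ U := by
    refine (Metric.closedBall_subset_closedBall' (ε₂ := 4 * r) ?_).trans hball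
    have := dist_triangle q₀ z p
    rw [dist_comm q₀ z] at this
    linarith
  have hz'K : z' ∉ Metric.closedBall q₀ (R / 4) := by
    rw [Metric.mem_closedBall, dist_comm, dist_eq_norm, hq₀b, add_sub_cancel_left, hbR]
    linarith
  obtain ⟨α, hα, hbar⟩ :=
    exists_coordLaplacian_barrier_pos hG hframe (isCompact_closedBall q₀ (R / 4)) hKU hz'K
  obtain ⟨w, hw⟩ : ∃ w : E m → ℝ,
      w = fun q => Real.exp (-α * ‖q - z'‖ ^ 2) - Real.exp (-α * (R / 2) ^ 2) := ⟨_, rfl⟩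
  have hwL : ∀ q ∈ Metric.closedBall q₀ (R / 4), 0 < coordLaplacian G w q := fun q hq => by
    rw [hw]
    exact hbar _ q hq
  have hws : ContDiffOn ℝ ∞ w U := by
    rw [hw]
    exact (((contDiff_const.mul ((contDiff_id.sub contDiff_const).norm_sq ℝ)).exp).sub
      contDiff_const).contDiffOn
  have hw1 : ∀ q, w q ≤ 1 := fun q => by
    have h1 : Real.exp (-α * ‖q - z'‖ ^ 2) ≤ 1 := Real.exp_le_one_iff.2 (by
      have := mul_nonneg hα.le (sq_nonneg ‖q - z'‖)
      linarith)
    have h2 := Real.exp_pos (-α * (R / 2) ^ 2)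
    rw [hw]
    dsimp only
    linarith
  have hwneg : ∀ q, R / 2 < ‖q - z'‖ → w q < 0 := fun q hq => by
    rw [hw]
    dsimp only
    have h1 : (R / 2) ^ 2 < ‖q - z'‖ ^ 2 := by gcongr
    have h2 : Real.exp (-α * ‖q - z'‖ ^ 2) < Real.exp (-α * (R / 2) ^ 2) :=
      Real.exp_lt_exp.2 (by have := mul_lt_mul_of_pos_left h1 hα; linarith)
    linarith
  have hwq₀ : w q₀ = 0 := by
    rw [hw]
    simp [hq₀b, hbR]
  -- On the part of the sphere inside the smaller ball, `u` stays below `c` by some `δ`.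
  obtain ⟨δ, hδ, hδu⟩ : ∃ δ > 0, ∀ y ∈ Metric.sphere q₀ (R / 4) ∩ Metric.closedBall z' (R / 2),
      u y ≤ c - δ := by
    have hT : IsCompact (Metric.sphere q₀ (R / 4) ∩ Metric.closedBall z' (R / 2)) :=
      (isCompact_sphere q₀ (R / 4)).inter_right Metric.isClosed_closedBall
    rcases (Metric.sphere q₀ (R / 4) ∩ Metric.closedBall z' (R / 2)).eq_empty_or_nonempty
      with h | h
    · exact ⟨1, one_pos, fun y hy => by simp [h] at hy⟩
    obtain ⟨y₀, hy₀, hmax⟩ := hT.exists_isMaxOn h (hu.continuousOn.mono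
      (inter_subset_left.trans (Metric.sphere_subset_closedBall.trans hKU)))
    refine ⟨c - u y₀, sub_pos.2 (hint y₀ ?_ ?_), fun y hy => by simpa using hmax hy⟩
    · simpa [dist_eq_norm] using hy₀.2
    · rintro rfl
      have := hy₀.1
      rw [mem_sphere_iff_norm, sub_self, norm_zero] at this
      linarith
  -- The perturbed function has an interior maximum, where its Laplacian is positive.
  have hvs : ContDiffOn ℝ ∞ (fun q => u q + δ / 2 * w q) U := hu.add (contDiffOn_const.mul hws)
  have hsphere : ∀ y ∈ Metric.sphere q₀ (R / 4), u y + δ / 2 * w y < c := by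
    intro y hy
    by_cases h : ‖y - z'‖ ≤ R / 2
    · have h1 := hδu y ⟨hy, by simpa [dist_eq_norm] using h⟩
      have h2 := mul_le_mul_of_nonneg_left (hw1 y) (half_pos hδ).le
      linarith
    · have h1 := hc y (hKU (Metric.sphere_subset_closedBall hy))
      have h2 := mul_neg_of_pos_of_neg (half_pos hδ) (hwneg y (not_le.1 h))
      linarith
  have hq₀K : q₀ ∈ Metric.closedBall q₀ (R / 4) := Metric.mem_closedBall_self (by linarith)
  obtain ⟨y, hy, hmax⟩ := (isCompact_closedBall q₀ (R / 4)).exists_isMaxOn ⟨q₀, hq₀K⟩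
    (hvs.continuousOn.mono hKU)
  have hyc : c ≤ u y + δ / 2 * w y := by
    have h : u q₀ + δ / 2 * w q₀ ≤ u y + δ / 2 * w y := hmax hq₀K
    rwa [hwq₀, mul_zero, add_zero, (show u q₀ = c from hq₀.2)] at h
  have hyball : y ∈ Metric.ball q₀ (R / 4) := by
    refine lt_of_le_of_ne (Metric.mem_closedBall.1 hy) fun h => ?_
    exact (hsphere y h).not_ge hyc
  have hloc : IsLocalMax (fun q => u q + δ / 2 * w q) y :=
    hmax.isLocalMax (mem_of_superset (Metric.isOpen_ball.mem_nhds hyball)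
      Metric.ball_subset_closedBall)
  have h1 := coordLaplacian_nonpos_of_isLocalMax hG hvs (hKU hy) (hframe y (hKU hy)) hloc
  rw [coordLaplacian_add_const_mul hG (hKU hy) (hframe y (hKU hy)) hu hws] at h1
  have h2 := hL y (hKU hy)
  have h3 := mul_pos (half_pos hδ) (hwL y hy)
  linarith

end MaximumPrinciple

/-! ### Change of coordinates -/

section CoordinateChange

variable {n m l : ℕ} {U : Set (E m)} {V : Set (E n)} {p : E m}

/-- A local isometry is totally geodesic: this is the transformation law of the Christoffel
symbols. -/
theorem coordSecondFundForm_eq_zero_of_isometry {G : E m → E m →L[ℝ] E m →L[ℝ] ℝ}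
    {H : E n → E n →L[ℝ] E n →L[ℝ] ℝ} {F : E m → E n} (hG : IsMetricOn G U)
    (hH : IsMetricOn H V) (hF : ContDiffOn ℝ ∞ F U) (hFV : MapsTo F U V)
    (hiso : ∀ q ∈ U, ∀ u v, G q u v = H (F q) (fderiv ℝ F q u) (fderiv ℝ F q v)) (hp : p ∈ U)
    (hsurj : Function.Surjective (fderiv ℝ F p)) (u v : E m) :
    coordSecondFundForm G H F p u v = 0 := by
  have hU := hG.isOpen
  have hdF := differentiableAt_of_isOpen hF hU hp
  have hd : ∀ a, DifferentiableAt ℝ (fun q => fderiv ℝ F q a) p := fun a =>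
    (differentiableAt_of_isOpen (contDiffOn_fderiv hF hU) hU hp).clm_apply
      (differentiableAt_const a)
  -- The derivative of the pulled-back metric.
  have h1 : ∀ a b c, fderiv ℝ G p a b c =
      H (F p) (covDeriv H F (fun q => fderiv ℝ F q b) p a) (fderiv ℝ F p c) +
        H (F p) (covDeriv H F (fun q => fderiv ℝ F q c) p a) (fderiv ℝ F p b) := by
    intro a b c
    rw [← fderiv_clm_apply₂_const (hG.differentiableAt hp),
      (show (fun q => G q b c) =ᶠ[𝓝 p] _ from
        eventually_of_mem (hU.mem_nhds hp) fun q hq => hiso q hq b c).fderiv_eq,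
      fderiv_inner_along hH (hFV hp) hdF (hd b) (hd c), hH.symm _ (hFV hp) (fderiv ℝ F p b)]
  -- The field `D_a (dF b)` is symmetric in `a` and `b`.
  have h2 : ∀ a b, covDeriv H F (fun q => fderiv ℝ F q b) p a =
      covDeriv H F (fun q => fderiv ℝ F q a) p b := by
    intro a b
    rw [covDeriv_fderiv_const hG hF hp, covDeriv_fderiv_const hG hF hp,
      sff_comm hG hH hF hFV hp, hG.christoffel_comm hp]
  have h3 : covDeriv H F (fun q => fderiv ℝ F q v) p u = fderiv ℝ F p (christoffel G p u v) := by
    refine hH.eq_of_apply_eq (hFV hp) fun w' => ?_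
    obtain ⟨w, rfl⟩ := hsurj w'
    have h4 := hG.apply_christoffel hp u v w
    rw [hiso p hp, h1, h1, h1, h2 v u, h2 w u, h2 w v] at h4
    linarith
  rw [covDeriv_fderiv_const hG hF hp] at h3
  exact add_eq_right.1 h3

/-- The second fundamental form of a composition. -/
theorem coordSecondFundForm_comp {G : E m → E m →L[ℝ] E m →L[ℝ] ℝ}
    {H : E n → E n →L[ℝ] E n →L[ℝ] ℝ} {K : E l → E l →L[ℝ] E l →L[ℝ] ℝ}
    {f : E m → E n} {k : E n → E l} (hU : IsOpen U) (hV : IsOpen V)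
    (hf : ContDiffOn ℝ ∞ f U) (hk : ContDiffOn ℝ ∞ k V) (hfV : MapsTo f U V) (hp : p ∈ U)
    (u v : E m) :
    coordSecondFundForm G K (k ∘ f) p u v =
      coordSecondFundForm H K k (f p) (fderiv ℝ f p u) (fderiv ℝ f p v) +
        fderiv ℝ k (f p) (coordSecondFundForm G H f p u v) := by
  have h1 : ∀ a, fderiv ℝ (k ∘ f) p a = fderiv ℝ k (f p) (fderiv ℝ f p a) := fun a =>
    fderiv_comp_apply (differentiableAt_of_isOpen hk hV (hfV hp))
      (differentiableAt_of_isOpen hf hU hp) a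
  simp only [coordSecondFundForm, fderiv_fderiv_comp hf hk hU hV hfV hp, h1, map_add, map_sub,
    Function.comp_apply]
  abel

/-- The Hessian of a function composed with a map. -/
theorem coordHessian_comp {G : E m → E m →L[ℝ] E m →L[ℝ] ℝ}
    {H : E n → E n →L[ℝ] E n →L[ℝ] ℝ} {f : E m → E n} {k : E n → ℝ} (hU : IsOpen U)
    (hV : IsOpen V) (hf : ContDiffOn ℝ ∞ f U) (hk : ContDiffOn ℝ ∞ k V) (hfV : MapsTo f U V)
    (hp : p ∈ U) (u v : E m) :
    coordHessian G (k ∘ f) p u v =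
      coordHessian H k (f p) (fderiv ℝ f p u) (fderiv ℝ f p v) +
        fderiv ℝ k (f p) (coordSecondFundForm G H f p u v) := by
  have h1 : ∀ a, fderiv ℝ (k ∘ f) p a = fderiv ℝ k (f p) (fderiv ℝ f p a) := fun a =>
    fderiv_comp_apply (differentiableAt_of_isOpen hk hV (hfV hp))
      (differentiableAt_of_isOpen hf hU hp) a
  simp only [coordHessian, coordSecondFundForm, fderiv_fderiv_comp hf hk hU hV hfV hp, h1,
    map_add, map_sub]
  ring

theorem coordSecondFundForm_congr {G : E m → E m →L[ℝ] E m →L[ℝ] ℝ}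
    {H : E n → E n →L[ℝ] E n →L[ℝ] ℝ} {f f' : E m → E n} (h : f =ᶠ[𝓝 p] f') :
    coordSecondFundForm G H f p = coordSecondFundForm G H f' p := by
  funext u v
  simp only [coordSecondFundForm, h.fderiv_eq, h.fderiv.fderiv_eq, h.eq_of_nhds]

theorem coordHessian_congr {G : E m → E m →L[ℝ] E m →L[ℝ] ℝ} {f f' : E m → ℝ}
    (h : f =ᶠ[𝓝 p] f') : coordHessian G f p = coordHessian G f' p := by
  funext u v
  simp only [coordHessian, h.fderiv_eq, h.fderiv.fderiv_eq]

end CoordinateChange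

/-! ### Charts of a Riemannian manifold -/

section Charts

variable {n : ℕ} {N : Type*} [TopologicalSpace N] [ChartedSpace (E n) N]

/-- The transition map from the preferred chart at `a` to the preferred chart at `b`. -/
def transition (n : ℕ) {N : Type*} [TopologicalSpace N] [ChartedSpace (E n) N] (a b : N) :
    E n → E n :=
  extChartAt (𝓡 n) b ∘ (extChartAt (𝓡 n) a).symm

/-- The domain of the transition map from the preferred chart at `a` to that at `b`. -/
def transitionDomain (n : ℕ) {N : Type*} [TopologicalSpace N] [ChartedSpace (E n) N] (a b : N) :
    Set (E n) :=
  (extChartAt (𝓡 n) a).target ∩ (extChartAt (𝓡 n) a).symm ⁻¹' (extChartAt (𝓡 n) b).source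

theorem isOpen_transitionDomain (a b : N) : IsOpen (transitionDomain n a b) :=
  (continuousOn_extChartAt_symm a).isOpen_inter_preimage (isOpen_extChartAt_target a)
    (isOpen_extChartAt_source b)

theorem mapsTo_transition (a b : N) :
    MapsTo (transition n a b) (transitionDomain n a b) (extChartAt (𝓡 n) b).target :=
  fun _ hp => (extChartAt (𝓡 n) b).map_source hp.2

variable [IsManifold (𝓡 n) ∞ N]

theorem contDiffOn_transition (a b : N) :
    ContDiffOn ℝ ∞ (transition n a b) (transitionDomain n a b) := by
  have h := contDiffOn_ext_coord_change (I := 𝓡 n) (n := ∞) b a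
  rwa [PartialEquiv.trans_source, PartialEquiv.symm_source] at h

theorem fderiv_transition {a b : N} {p : E n} (hp : p ∈ transitionDomain n a b) :
    fderiv ℝ (transition n a b) p =
      tangentCoordChange (𝓡 n) a b ((extChartAt (𝓡 n) a).symm p) := by
  have h := hasFDerivWithinAt_tangentCoordChange (I := 𝓡 n) (x := a) (y := b)
    ⟨(extChartAt (𝓡 n) a).map_target hp.1, hp.2⟩
  rw [(extChartAt (𝓡 n) a).right_inv hp.1, ModelWithCorners.range_eq_univ,
    hasFDerivWithinAt_univ] at h
  exact h.fderiv

theorem chartInvDeriv_transition {a b : N} {p : E n} (hp : p ∈ transitionDomain n a b) (u : E n) :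
    chartInvDeriv n b (transition n a b p) (fderiv ℝ (transition n a b) p u) =
      chartInvDeriv n a p u := by
  have h1 : (extChartAt (𝓡 n) b).symm (transition n a b p) = (extChartAt (𝓡 n) a).symm p :=
    (extChartAt (𝓡 n) b).left_inv hp.2
  rw [fderiv_transition hp, chartInvDeriv, h1]
  exact tangentCoordChange_comp ⟨⟨(extChartAt (𝓡 n) a).map_target hp.1, hp.2⟩,
    mem_extChartAt_source _⟩

theorem injective_chartInvDeriv {a : N} {p : E n} (hp : p ∈ (extChartAt (𝓡 n) a).target) :
    Function.Injective (chartInvDeriv n a p) := by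
  have h1 := (extChartAt (𝓡 n) a).map_target hp
  refine Function.LeftInverse.injective
    (g := tangentCoordChange (𝓡 n) ((extChartAt (𝓡 n) a).symm p) a
      ((extChartAt (𝓡 n) a).symm p)) fun u => ?_
  rw [chartInvDeriv, tangentCoordChange_comp ⟨⟨h1, mem_extChartAt_source _⟩, h1⟩,
    tangentCoordChange_self h1]

theorem surjective_fderiv_transition {a b : N} {p : E n} (hp : p ∈ transitionDomain n a b) :
    Function.Surjective (fderiv ℝ (transition n a b) p) := by
  have hinj : Function.Injective (fderiv ℝ (transition n a b) p) := by
    have h : Function.Injective (chartInvDeriv n b (transition n a b p) ∘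
        fderiv ℝ (transition n a b) p) := by
      have : chartInvDeriv n b (transition n a b p) ∘ fderiv ℝ (transition n a b) p =
          chartInvDeriv n a p := funext (chartInvDeriv_transition hp)
      rw [this]
      exact injective_chartInvDeriv hp.1
    exact h.of_comp
  exact LinearMap.surjective_of_injective
    (f := (fderiv ℝ (transition n a b) p : E n →ₗ[ℝ] E n)) hinj

theorem chartInvDeriv_self (a : N) :
    chartInvDeriv n a (extChartAt (𝓡 n) a a) = ContinuousLinearMap.id ℝ (E n) := by
  have h := (extChartAt (𝓡 n) a).left_inv (mem_extChartAt_source (I := 𝓡 n) a)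
  ext1 u
  rw [chartInvDeriv, h]
  exact tangentCoordChange_self (mem_extChartAt_source (I := 𝓡 n) a)

variable (g : RMetric n N)

theorem chartMetric_apply (a : N) (p u v : E n) :
    chartMetric g a p u v = g.inner ((extChartAt (𝓡 n) a).symm p) (chartInvDeriv n a p u)
      (chartInvDeriv n a p v) := rfl

theorem chartMetric_self (a : N) : chartMetric g a (extChartAt (𝓡 n) a a) = g.inner a := by
  have h := (extChartAt (𝓡 n) a).left_inv (mem_extChartAt_source (I := 𝓡 n) a)
  ext u v
  rw [chartMetric_apply, chartInvDeriv_self, h]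
  rfl

/-- Transition maps are isometries for the coordinate expressions of the metric. -/
theorem chartMetric_transition {a b : N} {p : E n} (hp : p ∈ transitionDomain n a b) (u v : E n) :
    chartMetric g a p u v = chartMetric g b (transition n a b p)
      (fderiv ℝ (transition n a b) p u) (fderiv ℝ (transition n a b) p v) := by
  have h1 : (extChartAt (𝓡 n) b).symm (transition n a b p) = (extChartAt (𝓡 n) a).symm p :=
    (extChartAt (𝓡 n) b).left_inv hp.2
  rw [chartMetric_apply, chartMetric_apply, chartInvDeriv_transition hp,
    chartInvDeriv_transition hp, h1]

theorem contDiffOn_chartMetric (a : N) :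
    ContDiffOn ℝ ∞ (chartMetric g a) (extChartAt (𝓡 n) a).target := by
  refine contDiffOn_clm_apply₂ fun u v => ?_
  let t := trivializationAt (E n) (TangentSpace (𝓡 n)) a
  have hsymm := contMDiffOn_extChartAt_symm (I := 𝓡 n) (n := ∞) a
  have hmaps : MapsTo (extChartAt (𝓡 n) a).symm (extChartAt (𝓡 n) a).target t.baseSet := by
    intro p hp
    have := (extChartAt (𝓡 n) a).map_target hp
    rwa [extChartAt_source] at this
  have hX : ∀ u : E n, ContMDiffOn (𝓡 n) ((𝓡 n).prod 𝓘(ℝ, E n)) ∞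
      (fun p => TotalSpace.mk' (E n) (E := TangentSpace (𝓡 n)) ((extChartAt (𝓡 n) a).symm p)
        (chartInvDeriv n a p u)) (extChartAt (𝓡 n) a).target := by
    intro u
    have h1 := t.contMDiffOn_symm (IB := 𝓡 n) (n := ∞)
    have h2 : ContMDiffOn (𝓡 n) ((𝓡 n).prod 𝓘(ℝ, E n)) ∞
        (fun p => ((extChartAt (𝓡 n) a).symm p, u)) (extChartAt (𝓡 n) a).target :=
      hsymm.prodMk contMDiffOn_const
    refine (h1.comp h2 fun p hp => ?_).congr fun p hp => ?_
    · rw [mem_preimage, Trivialization.mem_target]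
      exact hmaps hp
    · have h3 := TangentBundle.symmL_trivializationAt_eq_core (I := 𝓡 n) (hmaps hp)
      have h4 : chartInvDeriv n a p u = t.symm ((extChartAt (𝓡 n) a).symm p) u :=
        (congrArg (fun L : E n →L[ℝ] E n => L u) h3).symm.trans
          (t.symmL_apply (R := ℝ) (hmaps hp) u)
      rw [h4]
      exact t.mk_symm (hmaps hp) u
  have h5 : ContMDiffOn (𝓡 n) 𝓘(ℝ, ℝ) ∞ (fun p => chartMetric g a p u v)
      (extChartAt (𝓡 n) a).target := by
    intro p hp
    have h : ContMDiffWithinAt (𝓡 n) ((𝓡 n).prod 𝓘(ℝ)) ∞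
        (fun q => TotalSpace.mk' ℝ (E := Bundle.Trivial N ℝ) ((extChartAt (𝓡 n) a).symm q)
          (g.inner ((extChartAt (𝓡 n) a).symm q) (chartInvDeriv n a q u)
            (chartInvDeriv n a q v))) (extChartAt (𝓡 n) a).target p := by
      apply ContMDiffWithinAt.clm_bundle_apply₂ (F₁ := E n) (F₂ := E n)
      · exact ContMDiffAt.comp_contMDiffWithinAt p g.contMDiff.contMDiffAt (hsymm p hp)
      · exact hX u p hp
      · exact hX v p hp
    simp only [contMDiffWithinAt_totalSpace] at h
    exact h.2
  exact contMDiffOn_iff_contDiffOn.1 h5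

theorem isMetricOn_chartMetric (a : N) :
    IsMetricOn (chartMetric g a) (extChartAt (𝓡 n) a).target where
  isOpen := isOpen_extChartAt_target a
  contDiffOn := contDiffOn_chartMetric g a
  symm p _ u v := by
    rw [chartMetric_apply, chartMetric_apply]
    exact g.symm ((extChartAt (𝓡 n) a).symm p) _ _
  pos p hp u hu := by
    rw [chartMetric_apply]
    refine g.pos ((extChartAt (𝓡 n) a).symm p) (chartInvDeriv n a p u) fun h => hu ?_
    have h0 : chartInvDeriv n a p u = chartInvDeriv n a p 0 := by
      rw [map_zero]
      exact h
    exact injective_chartInvDeriv hp h0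

end Charts

/-! ### Tensors of a map in a fixed pair of charts -/

section Frames

variable {m n : ℕ}

/-- An orthonormal frame can be pulled back by a surjective isometry. -/
theorem IsOrthonormalFrame.exists_lift {g k : E m →L[ℝ] E m →L[ℝ] ℝ} {e : Fin m → E m}
    (he : IsOrthonormalFrame g e) {T : E m →L[ℝ] E m} (hT : Function.Surjective T)
    (hk : ∀ u v, k u v = g (T u) (T v)) :
    ∃ e', IsOrthonormalFrame k e' ∧ ∀ i, T (e' i) = e i := by
  choose e' he' using fun i => hT (e i)
  exact ⟨e', fun i j => by rw [hk, he', he', he], he'⟩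

end Frames

section Charts

variable {m n : ℕ} {M : Type*} [TopologicalSpace M] [ChartedSpace (E m) M]
  {N : Type*} [TopologicalSpace N] [ChartedSpace (E n) N]

/-- The points in the preferred chart at `a` that `φ` sends to the domain of the preferred chart
at `φ a`. -/
def chartDomain (m n : ℕ) {M : Type*} [TopologicalSpace M] [ChartedSpace (E m) M]
    {N : Type*} [TopologicalSpace N] [ChartedSpace (E n) N] (φ : M → N) (a : M) : Set (E m) :=
  (extChartAt (𝓡 m) a).target ∩
    (extChartAt (𝓡 m) a).symm ⁻¹' (φ ⁻¹' (extChartAt (𝓡 n) (φ a)).source)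

theorem isOpen_chartDomain {φ : M → N} (hφ : Continuous φ) (a : M) :
    IsOpen (chartDomain m n φ a) :=
  (continuousOn_extChartAt_symm a).isOpen_inter_preimage (isOpen_extChartAt_target a)
    ((isOpen_extChartAt_source (φ a)).preimage hφ)

theorem mapsTo_chartDomain (φ : M → N) (a : M) :
    MapsTo (writtenInExtChartAt (𝓡 m) (𝓡 n) a φ) (chartDomain m n φ a)
      (extChartAt (𝓡 n) (φ a)).target :=
  fun _ hp => (extChartAt (𝓡 n) (φ a)).map_source hp.2

theorem extChartAt_mem_chartDomain (φ : M → N) (a : M) :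
    extChartAt (𝓡 m) a a ∈ chartDomain m n φ a :=
  ⟨mem_extChartAt_target a, by
    rw [mem_preimage, (extChartAt (𝓡 m) a).left_inv (mem_extChartAt_source a)]
    exact mem_extChartAt_source (φ a)⟩

theorem mfderiv_eq_fderiv {φ : M → N} (hφ : ContMDiff (𝓡 m) (𝓡 n) ∞ φ) (x : M) :
    mfderiv (𝓡 m) (𝓡 n) φ x =
      fderiv ℝ (writtenInExtChartAt (𝓡 m) (𝓡 n) x φ) (extChartAt (𝓡 m) x x) := by
  rw [(hφ.mdifferentiable (by simp) x).mfderiv, ModelWithCorners.range_eq_univ, fderivWithin_univ]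

/-- A real function in two charts. -/
theorem comp_symm_eq_comp_transition (F : M → ℝ) (a x : M) {q : E m}
    (hq : q ∈ transitionDomain m a x) :
    (F ∘ (extChartAt (𝓡 m) x).symm) (transition m a x q) =
      (F ∘ (extChartAt (𝓡 m) a).symm) q := by
  simp only [Function.comp_apply, transition]
  rw [(extChartAt (𝓡 m) x).left_inv hq.2]

variable [IsManifold (𝓡 m) ∞ M] [IsManifold (𝓡 n) ∞ N]

theorem contDiffOn_writtenInExtChartAt {φ : M → N} (hφ : ContMDiff (𝓡 m) (𝓡 n) ∞ φ) (a : M) :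
    ContDiffOn ℝ ∞ (writtenInExtChartAt (𝓡 m) (𝓡 n) a φ) (chartDomain m n φ a) :=
  (contMDiff_iff.1 hφ).2 a (φ a)

theorem contDiffOn_comp_extChartAt_symm {F : M → ℝ} (hF : ContMDiff (𝓡 m) 𝓘(ℝ, ℝ) ∞ F) (a : M) :
    ContDiffOn ℝ ∞ (F ∘ (extChartAt (𝓡 m) a).symm) (extChartAt (𝓡 m) a).target :=
  contMDiffOn_iff_contDiffOn.1 (hF.comp_contMDiffOn (contMDiffOn_extChartAt_symm a))

theorem inner_grad (g : RMetric n N) {V : N → ℝ} (hV : ContMDiff (𝓡 n) 𝓘(ℝ, ℝ) ∞ V) (y : N)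
    (w : E n) : g.inner y (grad g V y) w =
      fderiv ℝ (V ∘ (extChartAt (𝓡 n) y).symm) (extChartAt (𝓡 n) y y) w := by
  have hinv : (g.inner y : E n →L[ℝ] E n →L[ℝ] ℝ).IsInvertible :=
    isInvertible_of_pos fun u hu => g.pos y u hu
  have h1 : mfderiv (𝓡 n) 𝓘(ℝ, ℝ) V y =
      fderiv ℝ (V ∘ (extChartAt (𝓡 n) y).symm) (extChartAt (𝓡 n) y y) := by
    rw [(hV.mdifferentiable (by simp) y).mfderiv, ModelWithCorners.range_eq_univ,
      fderivWithin_univ]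
    rfl
  have h2 := hinv.self_apply_inverse (mfderiv (𝓡 n) 𝓘(ℝ, ℝ) V y : E n →L[ℝ] ℝ)
  rw [← h1]
  exact congrArg (fun L : E n →L[ℝ] ℝ => L w) h2

/-- The data relating the preferred charts at `a` and `φ a` to those at `x` and `φ x`, where `q`
are the coordinates of `x` in the preferred chart at `a`. -/
theorem exists_chart_change (h : RMetric m M) (g : RMetric n N) {φ : M → N}
    (hφ : ContMDiff (𝓡 m) (𝓡 n) ∞ φ) (a x : M) {q : E m} (hq : q ∈ chartDomain m n φ a)
    (hx : (extChartAt (𝓡 m) a).symm q = x) :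
    ∃ (T : E m →L[ℝ] E m) (S : E n →L[ℝ] E n), Function.Surjective T ∧
      (∀ u v, chartMetric h a q u v = h.inner x (T u) (T v)) ∧
      (∀ u v, chartMetric g (φ a) (writtenInExtChartAt (𝓡 m) (𝓡 n) a φ q) u v =
        g.inner (φ x) (S u) (S v)) ∧
      (∀ u, mfderiv (𝓡 m) (𝓡 n) φ x (T u) =
        S (fderiv ℝ (writtenInExtChartAt (𝓡 m) (𝓡 n) a φ) q u)) ∧
      (∀ u v, secondFundForm h g φ x (T u) (T v) =
        S (coordSecondFundForm (chartMetric h a) (chartMetric g (φ a))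
          (writtenInExtChartAt (𝓡 m) (𝓡 n) a φ) q u v)) ∧
      ∀ V : N → ℝ, ContMDiff (𝓡 n) 𝓘(ℝ, ℝ) ∞ V → ∀ w,
        fderiv ℝ (V ∘ (extChartAt (𝓡 n) (φ a)).symm)
          (writtenInExtChartAt (𝓡 m) (𝓡 n) a φ q) w =
        g.inner (φ x) (grad g V (φ x)) (S w) := by
  have hφa := mapsTo_chartDomain (m := m) (n := n) φ a hq
  have hqD : q ∈ transitionDomain m a x :=
    ⟨hq.1, by rw [mem_preimage, hx]; exact mem_extChartAt_source x⟩
  have hTq : transition m a x q = extChartAt (𝓡 m) x x := by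
    rw [transition, Function.comp_apply, hx]
  have hfq : (extChartAt (𝓡 n) (φ a)).symm (writtenInExtChartAt (𝓡 m) (𝓡 n) a φ q) = φ x := by
    rw [writtenInExtChartAt, Function.comp_apply, Function.comp_apply, hx]
    refine (extChartAt (𝓡 n) (φ a)).left_inv ?_
    rw [← hx]
    exact hq.2
  have hfD : writtenInExtChartAt (𝓡 m) (𝓡 n) a φ q ∈ transitionDomain n (φ a) (φ x) :=
    ⟨hφa, by rw [mem_preimage, hfq]; exact mem_extChartAt_source (φ x)⟩
  have hSq : transition n (φ a) (φ x) (writtenInExtChartAt (𝓡 m) (𝓡 n) a φ q) =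
      extChartAt (𝓡 n) (φ x) (φ x) := by
    rw [transition, Function.comp_apply, hfq]
  -- An open set on which all the coordinate changes are defined.
  let D : Set (E m) := chartDomain m n φ a ∩
    (transitionDomain m a x ∩ transition m a x ⁻¹' chartDomain m n φ x)
  have hD : IsOpen D := (isOpen_chartDomain hφ.continuous a).inter
    ((contDiffOn_transition a x).continuousOn.isOpen_inter_preimage
      (isOpen_transitionDomain a x) (isOpen_chartDomain hφ.continuous x))
  have hqmem : q ∈ D := ⟨hq, hqD, by
    rw [mem_preimage, hTq]
    exact extChartAt_mem_chartDomain φ x⟩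
  have hTD : MapsTo (transition m a x) D (chartDomain m n φ x) := fun _ hr => hr.2.2
  have hsymm : ∀ r ∈ D, (extChartAt (𝓡 m) x).symm (transition m a x r) =
      (extChartAt (𝓡 m) a).symm r := fun r hr => (extChartAt (𝓡 m) x).left_inv hr.2.1.2
  have hwr : ∀ r ∈ D, (extChartAt (𝓡 n) (φ a)).symm
      (writtenInExtChartAt (𝓡 m) (𝓡 n) a φ r) = φ ((extChartAt (𝓡 m) a).symm r) := fun r hr =>
    (extChartAt (𝓡 n) (φ a)).left_inv hr.1.2
  have hfDD : MapsTo (writtenInExtChartAt (𝓡 m) (𝓡 n) a φ) D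
      (transitionDomain n (φ a) (φ x)) := by
    intro r hr
    refine ⟨mapsTo_chartDomain φ a hr.1, ?_⟩
    rw [mem_preimage, hwr r hr, ← hsymm r hr]
    exact (hTD hr).2
  have hcomm : ∀ r ∈ D, (writtenInExtChartAt (𝓡 m) (𝓡 n) x φ ∘ transition m a x) r =
      (transition n (φ a) (φ x) ∘ writtenInExtChartAt (𝓡 m) (𝓡 n) a φ) r := by
    intro r hr
    have h1 : (writtenInExtChartAt (𝓡 m) (𝓡 n) x φ ∘ transition m a x) r =
        extChartAt (𝓡 n) (φ x) (φ ((extChartAt (𝓡 m) x).symm (transition m a x r))) := rfl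
    have h2 : (transition n (φ a) (φ x) ∘ writtenInExtChartAt (𝓡 m) (𝓡 n) a φ) r =
        extChartAt (𝓡 n) (φ x) ((extChartAt (𝓡 n) (φ a)).symm
          (writtenInExtChartAt (𝓡 m) (𝓡 n) a φ r)) := rfl
    rw [h1, h2, hsymm r hr, hwr r hr]
  have hev : (writtenInExtChartAt (𝓡 m) (𝓡 n) x φ ∘ transition m a x) =ᶠ[𝓝 q]
      (transition n (φ a) (φ x) ∘ writtenInExtChartAt (𝓡 m) (𝓡 n) a φ) :=
    eventually_of_mem (hD.mem_nhds hqmem) hcomm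
  have hTs := (contDiffOn_transition (n := m) a x).mono (fun r (hr : r ∈ D) => hr.2.1)
  have hSs := contDiffOn_transition (n := n) (φ a) (φ x)
  have hfa := (contDiffOn_writtenInExtChartAt hφ a).mono (fun r (hr : r ∈ D) => hr.1)
  have hfx := contDiffOn_writtenInExtChartAt hφ x
  have hDx := isOpen_chartDomain (m := m) (n := n) hφ.continuous x
  have hDS := isOpen_transitionDomain (n := n) (φ a) (φ x)
  have hh := (isMetricOn_chartMetric h a).mono (isOpen_transitionDomain a x) inter_subset_left
  have hg := (isMetricOn_chartMetric g (φ a)).mono hDS inter_subset_left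
  refine ⟨fderiv ℝ (transition m a x) q,
    fderiv ℝ (transition n (φ a) (φ x)) (writtenInExtChartAt (𝓡 m) (𝓡 n) a φ q),
    surjective_fderiv_transition hqD, fun u v => ?_, fun u v => ?_, fun u => ?_, fun u v => ?_,
    fun V hV w => ?_⟩
  · rw [chartMetric_transition h hqD, hTq, chartMetric_self]
    rfl
  · rw [chartMetric_transition g hfD, hSq, chartMetric_self]
    rfl
  · have h1 := congrArg (fun L : E m →L[ℝ] E n => L u) hev.fderiv_eq
    have h2 : fderiv ℝ (writtenInExtChartAt (𝓡 m) (𝓡 n) x φ ∘ transition m a x) q u =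
        fderiv ℝ (writtenInExtChartAt (𝓡 m) (𝓡 n) x φ) (transition m a x q)
          (fderiv ℝ (transition m a x) q u) :=
      fderiv_comp_apply (differentiableAt_of_isOpen hfx hDx (hTD hqmem))
        (differentiableAt_of_isOpen hTs hD hqmem) u
    have h3 : fderiv ℝ (transition n (φ a) (φ x) ∘ writtenInExtChartAt (𝓡 m) (𝓡 n) a φ) q u =
        fderiv ℝ (transition n (φ a) (φ x)) (writtenInExtChartAt (𝓡 m) (𝓡 n) a φ q)
          (fderiv ℝ (writtenInExtChartAt (𝓡 m) (𝓡 n) a φ) q u) :=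
      fderiv_comp_apply (differentiableAt_of_isOpen hSs hDS hfD)
        (differentiableAt_of_isOpen hfa hD hqmem) u
    rw [mfderiv_eq_fderiv hφ x, ← hTq]
    exact h2.symm.trans (h1.trans h3)
  · have h1 := coordSecondFundForm_congr (G := chartMetric h a) (H := chartMetric g (φ x)) hev
    have h2 := coordSecondFundForm_comp (G := chartMetric h a) (H := chartMetric h x)
      (K := chartMetric g (φ x)) hD hDx hTs hfx hTD hqmem u v
    have h3 := coordSecondFundForm_comp (G := chartMetric h a) (H := chartMetric g (φ a))
      (K := chartMetric g (φ x)) hD hDS hfa hSs hfDD hqmem u v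
    rw [coordSecondFundForm_eq_zero_of_isometry hh (isMetricOn_chartMetric h x)
      (contDiffOn_transition a x) (mapsTo_transition a x)
      (fun r hr => chartMetric_transition h hr) hqD (surjective_fderiv_transition hqD),
      map_zero, add_zero, hTq] at h2
    rw [coordSecondFundForm_eq_zero_of_isometry hg (isMetricOn_chartMetric g (φ x))
      hSs (mapsTo_transition (φ a) (φ x))
      (fun r hr => chartMetric_transition g hr) hfD (surjective_fderiv_transition hfD),
      zero_add] at h3
    exact h2.symm.trans ((congrFun (congrFun h1 u) v).trans h3)
  · have h1 : (V ∘ (extChartAt (𝓡 n) (φ a)).symm) =ᶠ[𝓝 (writtenInExtChartAt (𝓡 m) (𝓡 n) a φ q)]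
        fun r => (V ∘ (extChartAt (𝓡 n) (φ x)).symm) (transition n (φ a) (φ x) r) :=
      eventually_of_mem (hDS.mem_nhds hfD) fun r hr =>
        (comp_symm_eq_comp_transition V (φ a) (φ x) hr).symm
    rw [h1.fderiv_eq, fderiv_comp_apply (differentiableAt_of_isOpen
      (contDiffOn_comp_extChartAt_symm hV (φ x)) (isOpen_extChartAt_target (φ x))
      (mapsTo_transition _ _ hfD)) (differentiableAt_of_isOpen hSs hDS hfD),
      inner_grad g hV, hSq]

/-- The Laplacian of a function in a fixed chart. -/
theorem laplacian_eq_coordLaplacian (h : RMetric m M)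
    (hframe : ∀ x, ∃ e, IsOrthonormalFrame (h.inner x : E m →L[ℝ] E m →L[ℝ] ℝ) e)
    {F : M → ℝ} (hF : ContMDiff (𝓡 m) 𝓘(ℝ, ℝ) ∞ F) (a : M) {q : E m}
    (hq : q ∈ (extChartAt (𝓡 m) a).target) :
    coordLaplacian (chartMetric h a) (F ∘ (extChartAt (𝓡 m) a).symm) q =
      laplacian h F ((extChartAt (𝓡 m) a).symm q) := by
  obtain ⟨x, hx⟩ : ∃ x, x = (extChartAt (𝓡 m) a).symm q := ⟨_, rfl⟩
  rw [← hx]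
  have hqD : q ∈ transitionDomain m a x :=
    ⟨hq, by rw [mem_preimage, ← hx]; exact mem_extChartAt_source x⟩
  have hTq : transition m a x q = extChartAt (𝓡 m) x x := by
    rw [transition, Function.comp_apply, hx]
  have hDo := isOpen_transitionDomain (n := m) a x
  have hmetric : ∀ u v, chartMetric h a q u v = h.inner x
      (fderiv ℝ (transition m a x) q u) (fderiv ℝ (transition m a x) q v) := fun u v => by
    rw [chartMetric_transition h hqD, hTq, chartMetric_self]
    rfl
  obtain ⟨e, he⟩ := hframe x
  obtain ⟨e', he', hTe⟩ := he.exists_lift (surjective_fderiv_transition hqD) hmetric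
  have hev : (F ∘ (extChartAt (𝓡 m) a).symm) =ᶠ[𝓝 q]
      (F ∘ (extChartAt (𝓡 m) x).symm) ∘ transition m a x :=
    eventually_of_mem (hDo.mem_nhds hqD) fun r hr =>
      (comp_symm_eq_comp_transition F a x hr).symm
  have hh := (isMetricOn_chartMetric h a).mono hDo inter_subset_left
  have hex : IsOrthonormalFrame (chartMetric h x (extChartAt (𝓡 m) x x)) e := by
    rw [chartMetric_self]
    exact he
  have hlap : laplacian h F x = coordLaplacian (chartMetric h x) (F ∘ (extChartAt (𝓡 m) x).symm)
      (extChartAt (𝓡 m) x x) := by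
    rw [coordLaplacian, chartMetric_self]
    rfl
  rw [hlap, coordLaplacian_eq (isMetricOn_chartMetric h a) hq he',
    coordLaplacian_eq (isMetricOn_chartMetric h x) (mem_extChartAt_target x) hex]
  refine Finset.sum_congr rfl fun i _ => ?_
  rw [coordHessian_congr hev, coordHessian_comp (H := chartMetric h x) hDo
    (isOpen_extChartAt_target x) (contDiffOn_transition a x)
    (contDiffOn_comp_extChartAt_symm hF x) (mapsTo_transition a x) hqD,
    coordSecondFundForm_eq_zero_of_isometry hh (isMetricOn_chartMetric h x)
      (contDiffOn_transition a x) (mapsTo_transition a x)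
      (fun r hr => chartMetric_transition h hr) hqD (surjective_fderiv_transition hqD),
    map_zero, add_zero, hTe, hTq]

end Charts

/-! ### Harmonic analysis on closed Riemannian manifolds -/

section Global

variable {m n : ℕ} {M : Type*} [TopologicalSpace M] [ChartedSpace (E m) M]
  [IsManifold (𝓡 m) ∞ M] {N : Type*} [TopologicalSpace N] [ChartedSpace (E n) N]
  [IsManifold (𝓡 n) ∞ N] {h : RMetric m M} {g : RMetric n N} {φ : M → N} {V : N → ℝ}

theorem exists_frame_chartMetric
    (hframe : ∀ x, ∃ e, IsOrthonormalFrame (h.inner x : E m →L[ℝ] E m →L[ℝ] ℝ) e) (a : M)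
    {q : E m} (hq : q ∈ (extChartAt (𝓡 m) a).target) :
    ∃ e, IsOrthonormalFrame (chartMetric h a q) e := by
  obtain ⟨e, he⟩ := hframe ((extChartAt (𝓡 m) a).symm q)
  have hsurj : Function.Surjective (chartInvDeriv m a q) :=
    LinearMap.surjective_of_injective (f := (chartInvDeriv m a q : E m →ₗ[ℝ] E m))
      (injective_chartInvDeriv hq)
  obtain ⟨e', he', -⟩ := he.exists_lift hsurj (k := chartMetric h a q)
    fun u v => chartMetric_apply h a q u v
  exact ⟨e', he'⟩

/-- A subharmonic function on a closed connected Riemannian manifold is constant. -/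
theorem exists_eq_const_of_laplacian_nonneg [CompactSpace M] [ConnectedSpace M]
    (hframe : ∀ x, ∃ e, IsOrthonormalFrame (h.inner x : E m →L[ℝ] E m →L[ℝ] ℝ) e)
    {F : M → ℝ} (hF : ContMDiff (𝓡 m) 𝓘(ℝ, ℝ) ∞ F) (hL : ∀ x, 0 ≤ laplacian h F x) :
    ∃ c, ∀ x, F x = c := by
  obtain ⟨x₀, -, hx₀⟩ := isCompact_univ.exists_isMaxOn univ_nonempty hF.continuous.continuousOn
  have hmax : ∀ x, F x ≤ F x₀ := fun x => hx₀ (mem_univ x)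
  have hclopen : IsClopen (F ⁻¹' {F x₀}) := by
    refine ⟨isClosed_singleton.preimage hF.continuous, isOpen_iff_mem_nhds.2 fun x hx => ?_⟩
    have hxx := (extChartAt (𝓡 m) x).left_inv (mem_extChartAt_source (I := 𝓡 m) x)
    have hloc := eventually_eq_of_coordLaplacian_nonneg (isMetricOn_chartMetric h x)
      (fun q hq => exists_frame_chartMetric hframe x hq) (contDiffOn_comp_extChartAt_symm hF x)
      (fun q hq => (laplacian_eq_coordLaplacian h hframe hF x hq).symm ▸ hL _)
      (c := F x₀) (fun q _ => hmax _) (mem_extChartAt_target (I := 𝓡 m) x)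
      (by rw [Function.comp_apply, hxx]; exact hx)
    filter_upwards [(continuousAt_extChartAt (I := 𝓡 m) x).eventually hloc,
      extChartAt_source_mem_nhds (I := 𝓡 m) x] with y hy hys
    rwa [Function.comp_apply, (extChartAt (𝓡 m) x).left_inv hys] at hy
  have huniv := hclopen.eq_univ ⟨x₀, rfl⟩
  exact ⟨F x₀, fun x => (huniv ▸ mem_univ x : x ∈ F ⁻¹' {F x₀})⟩

theorem normSqDiff_eq_sum {x : M} {e : Fin m → E m}
    (he : IsOrthonormalFrame (h.inner x : E m →L[ℝ] E m →L[ℝ] ℝ) e) :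
    normSqDiff h g φ x = ∑ i, g.inner (φ x) (mfderiv (𝓡 m) (𝓡 n) φ x (e i))
      (mfderiv (𝓡 m) (𝓡 n) φ x (e i)) := by
  have hinv : (h.inner x : E m →L[ℝ] E m →L[ℝ] ℝ).IsInvertible :=
    isInvertible_of_pos fun u hu => h.pos x u hu
  let d : E m →L[ℝ] E n := mfderiv (𝓡 m) (𝓡 n) φ x
  let k : E n →L[ℝ] E n →L[ℝ] ℝ := g.inner (φ x)
  exact he.metricTrace_eq hinv (k.bilinearComp d d)

theorem tension_eq_sum {x : M} {e : Fin m → E m}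
    (he : IsOrthonormalFrame (h.inner x : E m →L[ℝ] E m →L[ℝ] ℝ) e) :
    tension h g φ x = ∑ i, secondFundForm h g φ x (e i) (e i) := by
  have hx := chartMetric_self h x
  have he' : IsOrthonormalFrame (chartMetric h x (extChartAt (𝓡 m) x x)) e := by rwa [hx]
  have h1 := coordTension_eq (H := chartMetric g (φ x)) (f := writtenInExtChartAt (𝓡 m) (𝓡 n) x φ)
    (isMetricOn_chartMetric h x) (mem_extChartAt_target x) he'
  rw [coordTension, hx] at h1
  exact h1

/-- The energy density in a fixed pair of charts. -/
theorem normSqDiff_eq_coordNormSq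
    (hframe : ∀ x, ∃ e, IsOrthonormalFrame (h.inner x : E m →L[ℝ] E m →L[ℝ] ℝ) e)
    (hφ : ContMDiff (𝓡 m) (𝓡 n) ∞ φ) (a : M) {q : E m} (hq : q ∈ chartDomain m n φ a) :
    (normSqDiff h g φ ∘ (extChartAt (𝓡 m) a).symm) q =
      coordNormSq (chartMetric h a) (chartMetric g (φ a))
        (writtenInExtChartAt (𝓡 m) (𝓡 n) a φ) q := by
  obtain ⟨x, hx⟩ : ∃ x, (extChartAt (𝓡 m) a).symm q = x := ⟨_, rfl⟩
  obtain ⟨T, S, hT, hTh, hSg, hd, -, -⟩ := exists_chart_change h g hφ a x hq hx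
  obtain ⟨e, he⟩ := hframe x
  obtain ⟨e', he', hTe⟩ := he.exists_lift hT hTh
  rw [Function.comp_apply, hx, normSqDiff_eq_sum he]
  have h1 := he'.metricTrace_eq ((isMetricOn_chartMetric h a).isInvertible hq.1)
    ((chartMetric g (φ a) (writtenInExtChartAt (𝓡 m) (𝓡 n) a φ q)).bilinearComp
      (fderiv ℝ (writtenInExtChartAt (𝓡 m) (𝓡 n) a φ) q)
      (fderiv ℝ (writtenInExtChartAt (𝓡 m) (𝓡 n) a φ) q))
  refine Eq.trans ?_ h1.symm
  refine Finset.sum_congr rfl fun i _ => ?_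
  rw [ContinuousLinearMap.bilinearComp_apply, hSg, ← hd, hTe]

theorem contMDiff_normSqDiff
    (hframe : ∀ x, ∃ e, IsOrthonormalFrame (h.inner x : E m →L[ℝ] E m →L[ℝ] ℝ) e)
    (hφ : ContMDiff (𝓡 m) (𝓡 n) ∞ φ) :
    ContMDiff (𝓡 m) 𝓘(ℝ, ℝ) ∞ (normSqDiff h g φ) := by
  intro a
  have hopen := isOpen_chartDomain (m := m) (n := n) hφ.continuous a
  have hmem := extChartAt_mem_chartDomain (m := m) (n := n) φ a
  have h1 : ContDiffAt ℝ ∞ (coordNormSq (chartMetric h a) (chartMetric g (φ a))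
      (writtenInExtChartAt (𝓡 m) (𝓡 n) a φ)) (extChartAt (𝓡 m) a a) :=
    contDiffAt_of_isOpen (contDiffOn_coordNormSq
      ((isMetricOn_chartMetric h a).mono hopen inter_subset_left)
      (isMetricOn_chartMetric g (φ a)) (contDiffOn_writtenInExtChartAt hφ a)
      (mapsTo_chartDomain φ a)) hopen hmem
  have h2 := h1.contMDiffAt.comp a (contMDiffAt_extChartAt (I := 𝓡 m) (n := ∞) (x := a))
  refine h2.congr_of_eventuallyEq ?_
  filter_upwards [(continuousAt_extChartAt (I := 𝓡 m) a).eventually (hopen.mem_nhds hmem),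
    extChartAt_source_mem_nhds (I := 𝓡 m) a] with y hy hys
  have h3 := normSqDiff_eq_coordNormSq (g := g) hframe hφ a hy
  rw [Function.comp_apply, (extChartAt (𝓡 m) a).left_inv hys] at h3
  exact h3

/-- The tension field in a fixed pair of charts, paired with a differential. -/
theorem coordTension_equation
    (hframe : ∀ x, ∃ e, IsOrthonormalFrame (h.inner x : E m →L[ℝ] E m →L[ℝ] ℝ) e)
    (hφ : ContMDiff (𝓡 m) (𝓡 n) ∞ φ) (hV : ContMDiff (𝓡 n) 𝓘(ℝ, ℝ) ∞ V)
    (heq : ∀ x, ∀ u : E m, g.inner (φ x) (tension h g φ x) (mfderiv (𝓡 m) (𝓡 n) φ x u) =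
      g.inner (φ x) (grad g V (φ x)) (mfderiv (𝓡 m) (𝓡 n) φ x u)) (a : M) {q : E m}
    (hq : q ∈ chartDomain m n φ a) (u : E m) :
    chartMetric g (φ a) (writtenInExtChartAt (𝓡 m) (𝓡 n) a φ q)
      (coordTension (chartMetric h a) (chartMetric g (φ a))
        (writtenInExtChartAt (𝓡 m) (𝓡 n) a φ) q)
      (fderiv ℝ (writtenInExtChartAt (𝓡 m) (𝓡 n) a φ) q u) =
    fderiv ℝ (V ∘ (extChartAt (𝓡 n) (φ a)).symm) (writtenInExtChartAt (𝓡 m) (𝓡 n) a φ q)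
      (fderiv ℝ (writtenInExtChartAt (𝓡 m) (𝓡 n) a φ) q u) := by
  obtain ⟨x, hx⟩ : ∃ x, (extChartAt (𝓡 m) a).symm q = x := ⟨_, rfl⟩
  obtain ⟨T, S, hT, hTh, hSg, hd, hB, hVd⟩ := exists_chart_change h g hφ a x hq hx
  obtain ⟨e, he⟩ := hframe x
  obtain ⟨e', he', hTe⟩ := he.exists_lift hT hTh
  have hτ : S (coordTension (chartMetric h a) (chartMetric g (φ a))
      (writtenInExtChartAt (𝓡 m) (𝓡 n) a φ) q) = tension h g φ x := by
    rw [coordTension_eq (isMetricOn_chartMetric h a) hq.1 he', tension_eq_sum he, map_sum]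
    refine Finset.sum_congr rfl fun i _ => ?_
    rw [← hB, hTe]
  rw [hSg, hVd V hV, hτ, ← hd]
  exact heq x (T u)

theorem coordTension_eq_zero
    (hframe : ∀ x, ∃ e, IsOrthonormalFrame (h.inner x : E m →L[ℝ] E m →L[ℝ] ℝ) e)
    (hφ : ContMDiff (𝓡 m) (𝓡 n) ∞ φ) (hB0 : ∀ x u v, secondFundForm h g φ x u v = 0) (a : M)
    {q : E m} (hq : q ∈ chartDomain m n φ a) :
    coordTension (chartMetric h a) (chartMetric g (φ a))
      (writtenInExtChartAt (𝓡 m) (𝓡 n) a φ) q = 0 := by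
  obtain ⟨x, hx⟩ : ∃ x, (extChartAt (𝓡 m) a).symm q = x := ⟨_, rfl⟩
  obtain ⟨T, S, hT, hTh, hSg, hd, hB, -⟩ := exists_chart_change h g hφ a x hq hx
  obtain ⟨e', he'⟩ := exists_frame_chartMetric hframe a hq.1
  rw [coordTension_eq (isMetricOn_chartMetric h a) hq.1 he']
  refine Finset.sum_eq_zero fun i _ => ?_
  by_contra hne
  have hpos := (isMetricOn_chartMetric g (φ a)).pos _ (mapsTo_chartDomain φ a hq) _ hne
  have hB1 := (hB (e' i) (e' i)).symm.trans (hB0 x (T (e' i)) (T (e' i)))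
  rw [hSg, hB1] at hpos
  have h0 : g.inner (φ x) (0 : E n) (0 : E n) = 0 := map_zero _
  exact hpos.ne' h0

/-- A smooth map with vanishing differential on a connected manifold is constant. -/
theorem exists_eq_const_of_mfderiv_eq_zero [ConnectedSpace M] [T2Space N] (h : RMetric m M)
    (g : RMetric n N) (hφ : ContMDiff (𝓡 m) (𝓡 n) ∞ φ)
    (h0 : ∀ x, ∀ u : E m, mfderiv (𝓡 m) (𝓡 n) φ x u = 0) : ∃ y, ∀ x, φ x = y := by
  obtain ⟨x₀⟩ : Nonempty M := inferInstance
  -- In charts the derivative vanishes identically, so `φ` is locally constant.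
  have hloc : ∀ a, ∀ᶠ x in 𝓝 a, φ x = φ a := by
    intro a
    have hopen := isOpen_chartDomain (m := m) (n := n) hφ.continuous a
    have hmem := extChartAt_mem_chartDomain (m := m) (n := n) φ a
    obtain ⟨r, hr, hball⟩ := Metric.isOpen_iff.1 hopen _ hmem
    have hf := contDiffOn_writtenInExtChartAt hφ a
    have hd0 : EqOn (fderiv ℝ (writtenInExtChartAt (𝓡 m) (𝓡 n) a φ)) 0
        (Metric.ball (extChartAt (𝓡 m) a a) r) := by
      intro q hq
      ext1 u
      obtain ⟨T, S, hT, -, hSg, hd, -, -⟩ := exists_chart_change h g hφ a _ (hball hq) rfl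
      have h1 := (hd u).symm.trans (h0 _ (T u))
      by_contra hne
      have hpos := (isMetricOn_chartMetric g (φ a)).pos _ (mapsTo_chartDomain φ a (hball hq)) _ hne
      rw [hSg, h1] at hpos
      have h2 : g.inner (φ ((extChartAt (𝓡 m) a).symm q)) (0 : E n) (0 : E n) = 0 := map_zero _
      exact hpos.ne' h2
    have hconst : ∀ q ∈ Metric.ball (extChartAt (𝓡 m) a a) r,
        writtenInExtChartAt (𝓡 m) (𝓡 n) a φ q =
          writtenInExtChartAt (𝓡 m) (𝓡 n) a φ (extChartAt (𝓡 m) a a) := fun q hq =>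
      Metric.isOpen_ball.is_const_of_fderiv_eq_zero
        (convex_ball (extChartAt (𝓡 m) a a) r).isPreconnected
        (fun p hp => (differentiableAt_of_isOpen hf hopen (hball hp)).differentiableWithinAt)
        hd0 hq (Metric.mem_ball_self hr)
    filter_upwards [(continuousAt_extChartAt (I := 𝓡 m) a).eventually
      (Metric.ball_mem_nhds _ hr), extChartAt_source_mem_nhds (I := 𝓡 m) a] with x hx hxs
    have h1 := hconst _ hx
    have h2 := (hball hx).2
    simp only [writtenInExtChartAt, Function.comp_apply, mem_preimage,
      (extChartAt (𝓡 m) a).left_inv hxs,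
      (extChartAt (𝓡 m) a).left_inv (mem_extChartAt_source (I := 𝓡 m) a)] at h1 h2
    exact (extChartAt (𝓡 n) (φ a)).injOn h2 (mem_extChartAt_source (φ a)) h1
  have hclopen : IsClopen (φ ⁻¹' {φ x₀}) :=
    ⟨isClosed_singleton.preimage hφ.continuous, isOpen_iff_mem_nhds.2 fun a ha =>
      (hloc a).mono fun x hx => hx.trans ha⟩
  have huniv := hclopen.eq_univ ⟨x₀, rfl⟩
  exact ⟨φ x₀, fun x => (huniv ▸ mem_univ x : x ∈ φ ⁻¹' {φ x₀})⟩

end Global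

section Bochner

variable {n : ℕ} {M : Type*} [TopologicalSpace M] [ChartedSpace (E 2) M]
  [IsManifold (𝓡 2) ∞ M] {N : Type*} [TopologicalSpace N] [ChartedSpace (E n) N]
  [IsManifold (𝓡 n) ∞ N] {h : RMetric 2 M} {g : RMetric n N} {φ : M → N} {V : N → ℝ}

/-- The Bochner formula on a surface. The term with the covariant derivative of the tension field
is expressed in the preferred charts at `x` and `φ x`. -/
theorem laplacian_normSqDiff
    (hframe : ∀ x, ∃ e, IsOrthonormalFrame (h.inner x : E 2 →L[ℝ] E 2 →L[ℝ] ℝ) e)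
    (hφ : ContMDiff (𝓡 2) (𝓡 n) ∞ φ) (x : M) {e : Fin 2 → E 2}
    (he : IsOrthonormalFrame (h.inner x : E 2 →L[ℝ] E 2 →L[ℝ] ℝ) e) :
    laplacian h (normSqDiff h g φ) x / 2 =
      ∑ k, ∑ i, g.inner (φ x) (secondFundForm h g φ x (e k) (e i))
          (secondFundForm h g φ x (e k) (e i)) +
        ∑ i, g.inner (φ x) (covDeriv (chartMetric g (φ x))
          (writtenInExtChartAt (𝓡 2) (𝓡 n) x φ)
          (coordTension (chartMetric h x) (chartMetric g (φ x))
            (writtenInExtChartAt (𝓡 2) (𝓡 n) x φ)) (extChartAt (𝓡 2) x x) (e i))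
          (mfderiv (𝓡 2) (𝓡 n) φ x (e i)) +
        scalarCurvature h x / 2 * normSqDiff h g φ x -
        2 * g.inner (φ x) (riemannTensor (chartMetric g (φ x)) (extChartAt (𝓡 n) (φ x) (φ x))
          (mfderiv (𝓡 2) (𝓡 n) φ x (e 0)) (mfderiv (𝓡 2) (𝓡 n) φ x (e 1))
          (mfderiv (𝓡 2) (𝓡 n) φ x (e 1))) (mfderiv (𝓡 2) (𝓡 n) φ x (e 0)) := by
  have hopen := isOpen_chartDomain (m := 2) (n := n) hφ.continuous x
  have hmem := extChartAt_mem_chartDomain (m := 2) (n := n) φ x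
  have hG := (isMetricOn_chartMetric h x).mono hopen inter_subset_left
  have hxx := chartMetric_self h x
  have hyy := chartMetric_self g (φ x)
  have hfx : writtenInExtChartAt (𝓡 2) (𝓡 n) x φ (extChartAt (𝓡 2) x x) =
      extChartAt (𝓡 n) (φ x) (φ x) := by
    rw [writtenInExtChartAt, Function.comp_apply, Function.comp_apply,
      (extChartAt (𝓡 2) x).left_inv (mem_extChartAt_source x)]
  have he' : IsOrthonormalFrame (chartMetric h x (extChartAt (𝓡 2) x x)) e := by rwa [hxx]
  have hlap : laplacian h (normSqDiff h g φ) x = ∑ k, coordHessian (chartMetric h x)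
      (coordNormSq (chartMetric h x) (chartMetric g (φ x))
        (writtenInExtChartAt (𝓡 2) (𝓡 n) x φ)) (extChartAt (𝓡 2) x x) (e k) (e k) := by
    have hev : normSqDiff h g φ ∘ (extChartAt (𝓡 2) x).symm =ᶠ[𝓝 (extChartAt (𝓡 2) x x)]
        coordNormSq (chartMetric h x) (chartMetric g (φ x))
          (writtenInExtChartAt (𝓡 2) (𝓡 n) x φ) :=
      eventually_of_mem (hopen.mem_nhds hmem) fun q hq =>
        normSqDiff_eq_coordNormSq hframe hφ x hq
    rw [← coordHessian_congr hev, ← coordLaplacian_eq hG hmem he', coordLaplacian, hxx]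
    rfl
  have key := bochner_surface hG (isMetricOn_chartMetric g (φ x))
    (contDiffOn_writtenInExtChartAt hφ x) (mapsTo_chartDomain φ x) hmem
    (fun q hq => exists_frame_chartMetric hframe x hq.1) he'
  rw [← hlap, hfx, hyy, hxx, ← mfderiv_eq_fderiv hφ x] at key
  rw [normSqDiff_eq_sum he]
  exact key

/-- The term of the Bochner formula with the derivative of the tension field, if the tension field
pairs with `dφ` as the gradient of `V` does. -/
theorem sum_covDeriv_tension
    (hframe : ∀ x, ∃ e, IsOrthonormalFrame (h.inner x : E 2 →L[ℝ] E 2 →L[ℝ] ℝ) e)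
    (hφ : ContMDiff (𝓡 2) (𝓡 n) ∞ φ) (hV : ContMDiff (𝓡 n) 𝓘(ℝ, ℝ) ∞ V)
    (heq : ∀ x, ∀ u : E 2, g.inner (φ x) (tension h g φ x) (mfderiv (𝓡 2) (𝓡 n) φ x u) =
      g.inner (φ x) (grad g V (φ x)) (mfderiv (𝓡 2) (𝓡 n) φ x u)) (x : M) {e : Fin 2 → E 2}
    (he : IsOrthonormalFrame (h.inner x : E 2 →L[ℝ] E 2 →L[ℝ] ℝ) e) :
    ∑ i, g.inner (φ x) (covDeriv (chartMetric g (φ x))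
          (writtenInExtChartAt (𝓡 2) (𝓡 n) x φ)
          (coordTension (chartMetric h x) (chartMetric g (φ x))
            (writtenInExtChartAt (𝓡 2) (𝓡 n) x φ)) (extChartAt (𝓡 2) x x) (e i))
          (mfderiv (𝓡 2) (𝓡 n) φ x (e i)) =
      ∑ i, hess g V (φ x) (mfderiv (𝓡 2) (𝓡 n) φ x (e i)) (mfderiv (𝓡 2) (𝓡 n) φ x (e i)) +
        g.inner (φ x) (grad g V (φ x)) (tension h g φ x) -
        g.inner (φ x) (tension h g φ x) (tension h g φ x) := by
  have hopen := isOpen_chartDomain (m := 2) (n := n) hφ.continuous x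
  have hmem := extChartAt_mem_chartDomain (m := 2) (n := n) φ x
  have hG := (isMetricOn_chartMetric h x).mono hopen inter_subset_left
  have hxx := chartMetric_self h x
  have hyy := chartMetric_self g (φ x)
  have hfx : writtenInExtChartAt (𝓡 2) (𝓡 n) x φ (extChartAt (𝓡 2) x x) =
      extChartAt (𝓡 n) (φ x) (φ x) := by
    rw [writtenInExtChartAt, Function.comp_apply, Function.comp_apply,
      (extChartAt (𝓡 2) x).left_inv (mem_extChartAt_source x)]
  have he' : IsOrthonormalFrame (chartMetric h x (extChartAt (𝓡 2) x x)) e := by rwa [hxx]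
  have hτ : coordTension (chartMetric h x) (chartMetric g (φ x))
      (writtenInExtChartAt (𝓡 2) (𝓡 n) x φ) (extChartAt (𝓡 2) x x) = tension h g φ x := by
    rw [coordTension, hxx]
    rfl
  have key := sum_covDeriv_coordTension hG (isMetricOn_chartMetric g (φ x))
    (contDiffOn_writtenInExtChartAt hφ x) (mapsTo_chartDomain φ x)
    (contDiffOn_comp_extChartAt_symm hV (φ x)) hmem he'
    (fun q hq u => coordTension_equation hframe hφ hV heq x hq u)
  rw [hτ, hfx, hyy, ← mfderiv_eq_fderiv hφ x] at key
  have hgrad := inner_grad g hV (φ x) (tension h g φ x)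
  exact key.trans (congrArg (fun t : ℝ => _ + t - _) hgrad.symm)

theorem sum_covDeriv_tension_of_secondFundForm_eq_zero
    (hframe : ∀ x, ∃ e, IsOrthonormalFrame (h.inner x : E 2 →L[ℝ] E 2 →L[ℝ] ℝ) e)
    (hφ : ContMDiff (𝓡 2) (𝓡 n) ∞ φ) (hB0 : ∀ x u v, secondFundForm h g φ x u v = 0)
    (x : M) (e : Fin 2 → E 2) :
    ∑ i, g.inner (φ x) (covDeriv (chartMetric g (φ x))
          (writtenInExtChartAt (𝓡 2) (𝓡 n) x φ)
          (coordTension (chartMetric h x) (chartMetric g (φ x))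
            (writtenInExtChartAt (𝓡 2) (𝓡 n) x φ)) (extChartAt (𝓡 2) x x) (e i))
          (mfderiv (𝓡 2) (𝓡 n) φ x (e i)) = 0 := by
  have hopen := isOpen_chartDomain (m := 2) (n := n) hφ.continuous x
  have hmem := extChartAt_mem_chartDomain (m := 2) (n := n) φ x
  have hev : coordTension (chartMetric h x) (chartMetric g (φ x))
      (writtenInExtChartAt (𝓡 2) (𝓡 n) x φ) =ᶠ[𝓝 (extChartAt (𝓡 2) x x)] fun _ => 0 :=
    eventually_of_mem (hopen.mem_nhds hmem) fun q hq => coordTension_eq_zero hframe hφ hB0 x hq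
  refine Finset.sum_eq_zero fun i _ => ?_
  have h0 : covDeriv (chartMetric g (φ x)) (writtenInExtChartAt (𝓡 2) (𝓡 n) x φ)
      (coordTension (chartMetric h x) (chartMetric g (φ x))
        (writtenInExtChartAt (𝓡 2) (𝓡 n) x φ)) (extChartAt (𝓡 2) x x) (e i) = 0 := by
    rw [covDeriv_congr hev, covDeriv, ← christoffelL_apply, map_zero]
    simp
  rw [h0]
  exact congrArg (fun L : E n →L[ℝ] ℝ => L (mfderiv (𝓡 2) (𝓡 n) φ x (e i)))
    (map_zero (g.inner (φ x) : E n →L[ℝ] E n →L[ℝ] ℝ))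

end Bochner

/-! ### Pointwise bounds by the norms of `Z`, `Hess V` and the curvature -/

section Bounds

variable {n : ℕ}

theorem area_eq_zero_of_not_linearIndependent (k : E n →L[ℝ] E n →L[ℝ] ℝ) {u v : E n}
    (hsymm : ∀ u v, k u v = k v u) (hli : ¬ LinearIndependent ℝ ![u, v]) :
    k u u * k v v - k u v ^ 2 = 0 := by
  rw [LinearIndependent.pair_iff] at hli
  push Not at hli
  obtain ⟨s, t, hst, hne⟩ := hli
  have h1 : ∀ w, s * k u w + t * k v w = 0 := fun w => by
    have := congrArg (fun z => k z w) hst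
    simpa using this
  have hu := h1 u
  have hv := h1 v
  rw [hsymm v u] at hu
  by_cases hs : s = 0
  · have ht := hne hs
    simp only [hs, zero_mul, zero_add, mul_eq_zero, ht, false_or] at hu hv
    rw [hu, hv]
    ring
  · refine (mul_eq_zero.1 (?_ : s * (k u u * k v v - k u v ^ 2) = 0)).resolve_left hs
    linear_combination k v v * hu - k u v * hv

/-- The Gram-Schmidt process for two vectors. -/
theorem exists_orthonormal_pair (k : E n →L[ℝ] E n →L[ℝ] ℝ) (hsymm : ∀ u v, k u v = k v u)
    (hpos : ∀ u, u ≠ 0 → 0 < k u u) {u v : E n} (hli : LinearIndependent ℝ ![u, v]) :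
    ∃ (u' v' : E n) (a b c : ℝ), u = a • u' ∧ v = b • u' + c • v' ∧ k u' u' = 1 ∧ k v' v' = 1 ∧
      k u' v' = 0 ∧ 0 < a ∧ 0 < c := by
  rw [LinearIndependent.pair_iff] at hli
  have hu : u ≠ 0 := by
    rintro rfl
    exact one_ne_zero (hli 1 0 (by simp)).1
  obtain ⟨a, ha, haa⟩ : ∃ a, 0 < a ∧ a * a = k u u :=
    ⟨√(k u u), Real.sqrt_pos.2 (hpos u hu), Real.mul_self_sqrt (hpos u hu).le⟩
  obtain ⟨u', hu'⟩ : ∃ u', u' = a⁻¹ • u := ⟨_, rfl⟩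
  have huu' : u = a • u' := by rw [hu', smul_inv_smul₀ ha.ne']
  have h1 : k u' u' = 1 := by
    rw [hu']
    simp only [map_smul, smul_apply, smul_eq_mul, ← haa]
    field_simp
  obtain ⟨w, hw⟩ : ∃ w, w = v - k v u' • u' := ⟨_, rfl⟩
  have hw0 : w ≠ 0 := by
    intro h0
    have h2 : (-(k v u' * a⁻¹)) • u + (1 : ℝ) • v = 0 := by
      rw [← h0, hw, hu']
      module
    exact one_ne_zero (hli _ _ h2).2
  obtain ⟨c, hc, hcc⟩ : ∃ c, 0 < c ∧ c * c = k w w :=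
    ⟨√(k w w), Real.sqrt_pos.2 (hpos w hw0), Real.mul_self_sqrt (hpos w hw0).le⟩
  refine ⟨u', c⁻¹ • w, a, k v u', c, huu', ?_, h1, ?_, ?_, ha, hc⟩
  · rw [smul_inv_smul₀ hc.ne', hw]
    abel
  · simp only [map_smul, smul_apply, smul_eq_mul, ← hcc]
    field_simp
  · have h3 : k u' w = 0 := by
      rw [hw, map_sub, map_smul, h1, hsymm u' v, smul_eq_mul]
      ring
    rw [map_smul, h3, smul_zero]

/-- A normal form of an alternating trilinear form on a triangular pair of vectors. -/
theorem alternating_three_triangular (η : E n [⋀^Fin 3]→L[ℝ] ℝ) (w u v : E n) (a b c : ℝ) :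
    η ![w, a • u, b • u + c • v] = a * c * η ![w, u, v] := by
  have h1 : ∀ z, η ![w, a • u, z] = a * η ![w, u, z] := fun z => by
    have h := η.map_update_smul ![w, u, z] 1 a u
    have e1 : ∀ t : E n, Function.update ![w, u, z] 1 t = ![w, t, z] := fun t => by
      ext i : 1
      fin_cases i <;> rfl
    simpa only [e1, smul_eq_mul] using h
  have e2 : ∀ z t : E n, Function.update ![w, u, z] 2 t = ![w, u, t] := fun z t => by
    ext i : 1
    fin_cases i <;> rfl
  have h2 : η ![w, u, b • u + c • v] = b * η ![w, u, u] + c * η ![w, u, v] := by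
    have ha := η.map_update_add ![w, u, v] 2 (b • u) (c • v)
    have hb := η.map_update_smul ![w, u, v] 2 b u
    have hc := η.map_update_smul ![w, u, v] 2 c v
    simp only [e2, smul_eq_mul] at ha hb hc
    rw [ha, hb, hc]
  have h3 : η ![w, u, u] = 0 := η.map_eq_zero_of_eq ![w, u, u] (i := 1) (j := 2) rfl (by decide)
  rw [h1, h2, h3]
  ring

/-- If `Z` is the vector-valued two-form dual to an alternating trilinear form, a bound of
`|Z(u ∧ v)|²` for orthonormal pairs gives a bound by the squared area for all pairs. -/
theorem normSq_le_mul_area (k : E n →L[ℝ] E n →L[ℝ] ℝ) (hsymm : ∀ u v, k u v = k v u)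
    (hpos : ∀ u, u ≠ 0 → 0 < k u u) (η : E n [⋀^Fin 3]→L[ℝ] ℝ) (Z : E n → E n → E n)
    (hZ : ∀ u v w, k (Z u v) w = η ![w, u, v]) {C : ℝ}
    (hC : ∀ u v, k u u = 1 → k v v = 1 → k u v = 0 → k (Z u v) (Z u v) ≤ C) (u v : E n) :
    k (Z u v) (Z u v) ≤ C * (k u u * k v v - k u v ^ 2) := by
  have hext : ∀ a b : E n, (∀ w, k a w = k b w) → a = b := fun a b hab =>
    (isInvertible_of_pos hpos).injective (ContinuousLinearMap.ext hab : k a = k b)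
  by_cases hli : LinearIndependent ℝ ![u, v]
  · obtain ⟨u', v', a, b, c, hu, hv, h1, h2, h3, ha, hc⟩ := exists_orthonormal_pair k hsymm hpos hli
    have hZuv : Z u v = (a * c) • Z u' v' := by
      refine hext _ _ fun w => ?_
      rw [map_smul, smul_apply, hZ, hZ, hu, hv, alternating_three_triangular, smul_eq_mul]
    have hdet : k u u * k v v - k u v ^ 2 = (a * c) ^ 2 := by
      rw [hu, hv]
      simp only [map_add, map_smul, add_apply, smul_apply, smul_eq_mul, h1, h2, h3, hsymm v' u']
      ring
    rw [hdet, hZuv]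
    simp only [map_smul, smul_apply, smul_eq_mul]
    have := mul_le_mul_of_nonneg_right (hC u' v' h1 h2 h3) (sq_nonneg (a * c))
    linarith
  · have hZ0 : Z u v = 0 := by
      refine hext _ _ fun w => ?_
      rw [map_zero, zero_apply, hZ]
      refine η.toAlternatingMap.map_linearDependent ![w, u, v] fun h => hli ?_
      have h' := h.comp ![1, 2] (by decide)
      have he : ![w, u, v] ∘ ![1, 2] = ![u, v] := by
        ext i : 1
        fin_cases i <;> rfl
      rwa [he] at h'
    rw [hZ0, area_eq_zero_of_not_linearIndependent k hsymm hli]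
    simp

/-- A bound of a quadratic form on unit vectors gives a bound on all vectors. -/
theorem abs_le_mul_of_unit (k L : E n →L[ℝ] E n →L[ℝ] ℝ) (hpos : ∀ u, u ≠ 0 → 0 < k u u) {C : ℝ}
    (hC : ∀ u, k u u = 1 → |L u u| ≤ C) (u : E n) : |L u u| ≤ C * k u u := by
  rcases eq_or_ne u 0 with rfl | hu
  · simp
  obtain ⟨a, ha, haa⟩ : ∃ a, 0 < a ∧ a * a = k u u :=
    ⟨√(k u u), Real.sqrt_pos.2 (hpos u hu), Real.mul_self_sqrt (hpos u hu).le⟩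
  have h1 : k (a⁻¹ • u) (a⁻¹ • u) = 1 := by
    simp only [map_smul, smul_apply, smul_eq_mul, ← haa]
    field_simp
  have h2 : L u u = a * a * L (a⁻¹ • u) (a⁻¹ • u) := by
    simp only [map_smul, smul_apply, smul_eq_mul]
    field_simp
  rw [h2, abs_mul, abs_of_pos (mul_pos ha ha), ← haa, mul_comm]
  exact mul_le_mul_of_nonneg_right (hC _ h1) (mul_pos ha ha).le

variable {N : Type*} [TopologicalSpace N] [ChartedSpace (E n) N]
  [IsManifold (𝓡 n) ∞ N] (g : RMetric n N) (B : TwoForm n N) (V : N → ℝ)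

theorem inner_Zmap (y : N) (u v w : E n) :
    g.inner y (Zmap g B y u v) w =
      (dTwoForm B y : E n [⋀^Fin 3]→L[ℝ] ℝ) ![w, u, v] := by
  have hinv : (g.inner y : E n →L[ℝ] E n →L[ℝ] ℝ).IsInvertible :=
    isInvertible_of_pos fun u hu => g.pos y u hu
  let η : E n [⋀^Fin 3]→L[ℝ] ℝ := dTwoForm B y
  have h1 := hinv.self_apply_inverse
    (η.toContinuousMultilinearMap.toContinuousLinearMap ![0, u, v] 0)
  have h2 := congrArg (fun L : E n →L[ℝ] ℝ => L w) h1
  refine h2.trans ?_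
  have h3 : Function.update ![0, u, v] 0 w = ![w, u, v] := by
    ext i : 1
    fin_cases i <;> rfl
  exact congrArg η h3

theorem inner_Zmap_self_left (y : N) (u v : E n) : g.inner y (Zmap g B y u v) u = 0 :=
  (inner_Zmap g B y u v u).trans ((dTwoForm B y : E n [⋀^Fin 3]→L[ℝ] ℝ).map_eq_zero_of_eq
    ![u, u, v] (i := 0) (j := 1) rfl (by decide))

theorem inner_Zmap_self_right (y : N) (u v : E n) : g.inner y (Zmap g B y u v) v = 0 :=
  (inner_Zmap g B y u v v).trans ((dTwoForm B y : E n [⋀^Fin 3]→L[ℝ] ℝ).map_eq_zero_of_eq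
    ![v, u, v] (i := 0) (j := 2) rfl (by decide))

/-- `|Z(u ∧ v)|² ≤ |Z|² |u ∧ v|²`. -/
theorem inner_Zmap_Zmap_le (hZ : normZ g B ≠ ⊤) (y : N) (u v : E n) :
    g.inner y (Zmap g B y u v) (Zmap g B y u v) ≤
      (normZ g B).toReal ^ 2 * (g.inner y u u * g.inner y v v - g.inner y u v ^ 2) := by
  let k : E n →L[ℝ] E n →L[ℝ] ℝ := g.inner y
  let Z : E n → E n → E n := Zmap g B y
  refine normSq_le_mul_area k (fun u v => g.symm y u v) (fun u hu => g.pos y u hu) (dTwoForm B y) Z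
    (fun u v w => inner_Zmap g B y u v w) (fun u v h1 h2 h3 => ?_) u v
  have hle : √(k (Z u v) (Z u v)) ≤ (normZ g B).toReal :=
    (ENNReal.ofReal_le_iff_le_toReal hZ).1 (le_iSup_of_le y (le_iSup_of_le u (le_iSup_of_le v
      (le_iSup_of_le ⟨h1, h2, h3⟩ le_rfl))))
  exact (Real.sqrt_le_left ENNReal.toReal_nonneg).1 hle

theorem abs_hess_le (hV : normHess g V ≠ ⊤) (y : N) (u : E n) :
    |hess g V y u u| ≤ (normHess g V).toReal * g.inner y u u := by
  have hL : ∀ a b, hess g V y a b = hessL (chartMetric g y) (V ∘ (extChartAt (𝓡 n) y).symm)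
    (extChartAt (𝓡 n) y y) a b := fun a b => (hessL_apply _ _).symm
  have key := abs_le_mul_of_unit (g.inner y : E n →L[ℝ] E n →L[ℝ] ℝ)
    (hessL (chartMetric g y) (V ∘ (extChartAt (𝓡 n) y).symm) (extChartAt (𝓡 n) y y))
    (C := (normHess g V).toReal) (fun u hu => g.pos y u hu) (fun w hw => ?_) u
  · exact (congrArg abs (hL u u)).trans_le key
  · refine (congrArg abs (hL w w)).symm.trans_le ((ENNReal.ofReal_le_iff_le_toReal hV).1 ?_)
    exact le_iSup_of_le y (le_iSup_of_le w (le_iSup_of_le hw le_rfl))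

/-- An upper bound of the sectional curvature bounds `⟨R(u, v)v, u⟩`. -/
theorem inner_riemannTensor_le {κ : ℝ}
    (hκ : ∀ (y : N) (u v : TangentSpace (𝓡 n) y), LinearIndependent ℝ ![u, v] →
      sectionalCurvature g y u v ≤ κ) (y : N) (u v : E n) :
    g.inner y (riemannTensor (chartMetric g y) (extChartAt (𝓡 n) y y) u v v) u ≤
      κ * (g.inner y u u * g.inner y v v - g.inner y u v ^ 2) := by
  let k : E n →L[ℝ] E n →L[ℝ] ℝ := g.inner y
  have hsymm : ∀ u v, k u v = k v u := fun u v => g.symm y u v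
  have hpos : ∀ u, u ≠ 0 → 0 < k u u := fun u hu => g.pos y u hu
  change k (riemannTensor (chartMetric g y) (extChartAt (𝓡 n) y y) u v v) u ≤
      κ * (k u u * k v v - k u v ^ 2)
  by_cases hli : LinearIndependent ℝ ![u, v]
  · obtain ⟨u', v', a, b, c, hu, hv, h1, h2, h3, ha, hc⟩ := exists_orthonormal_pair k hsymm hpos hli
    have hdet : k u u * k v v - k u v ^ 2 = (a * c) ^ 2 := by
      rw [hu, hv]
      simp only [map_add, map_smul, add_apply, smul_apply, smul_eq_mul, h1, h2, h3, hsymm v' u']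
      ring
    have hD : 0 < k u u * k v v - k u v ^ 2 := by
      rw [hdet]
      positivity
    exact (div_le_iff₀ hD).1 (hκ y u v hli)
  · rw [(isMetricOn_chartMetric g y).riemannTensor_eq_zero_of_not_linearIndependent
      (mem_extChartAt_target y) hli, area_eq_zero_of_not_linearIndependent k hsymm hli]
    simp

end Bounds

/-! ### The Bochner inequality and rigidity -/

section Rigidity

theorem nonneg_of_forall_pos {n : ℕ} (k : E n →L[ℝ] E n →L[ℝ] ℝ)
    (hpos : ∀ u, u ≠ 0 → 0 < k u u) (u : E n) : 0 ≤ k u u := by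
  rcases eq_or_ne u 0 with rfl | hu
  · simp
  · exact (hpos u hu).le

/-- The pointwise estimate behind subharmonicity: the right-hand side of the Bochner formula, with
`X i = dφ(eᵢ)`, `b j i = ∇dφ(eⱼ, eᵢ)`, `a` the value of `Z`, `w` the gradient of `V`, `s i` the
Hessian of `V` on `X i`, `S` the curvature term of the target and `K` half the scalar curvature. Of
the coefficients `1` of `z²` and of `κ` in `hK`, Young's inequality for `⟨a, τ⟩` uses up `1 / 8` and
the curvature term uses up `1 / 2`. -/
theorem le_bochner_rhs {n : ℕ} (k : E n →L[ℝ] E n →L[ℝ] ℝ) (hsymm : ∀ u v, k u v = k v u)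
    (hpos : ∀ u, u ≠ 0 → 0 < k u u) (X : Fin 2 → E n) (b : Fin 2 → Fin 2 → E n) {a w τ : E n}
    (hb : τ = b 0 0 + b 1 1) (ha : τ = a + w) {s : Fin 2 → ℝ} {z κ H K S : ℝ}
    (hs : ∀ i, |s i| ≤ H * k (X i) (X i))
    (hz : k a a ≤ z ^ 2 * (k (X 0) (X 0) * k (X 1) (X 1) - k (X 0) (X 1) ^ 2))
    (hS : S ≤ κ * (k (X 0) (X 0) * k (X 1) (X 1) - k (X 0) (X 1) ^ 2)) (hκ : 0 ≤ κ)
    (hK : (z ^ 2 + κ) * ∑ i, k (X i) (X i) + H ≤ K) :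
    (7 / 8 * z ^ 2 + κ / 2) * (∑ i, k (X i) (X i)) ^ 2 ≤
      ∑ j, ∑ i, k (b j i) (b j i) + (∑ i, s i + k w τ - k τ τ) + K * ∑ i, k (X i) (X i) - 2 * S := by
  have hnn := nonneg_of_forall_pos k hpos
  -- The area of the parallelogram spanned by `X 0`, `X 1` is at most half of `|dφ|²`.
  have harea : k (X 0) (X 0) * k (X 1) (X 1) - k (X 0) (X 1) ^ 2 ≤
      (∑ i, k (X i) (X i)) ^ 2 / 4 := by
    rw [Fin.sum_univ_two]
    nlinarith [sq_nonneg (k (X 0) (X 1)), sq_nonneg (k (X 0) (X 0) - k (X 1) (X 1))]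
  have hF : 0 ≤ ∑ i, k (X i) (X i) := Finset.sum_nonneg fun i _ => hnn _
  have h1 : k w τ - k τ τ = -k a τ := by
    rw [← sub_apply, ← map_sub, ha, sub_add_cancel_right, map_neg, neg_apply]
  have h2 : 0 ≤ k a a - 2 * k a τ + k τ τ := by
    have := hnn (a - τ)
    simp only [map_sub, sub_apply, hsymm τ a] at this
    linarith
  have h3 : k τ τ ≤ 2 * (k (b 0 0) (b 0 0) + k (b 1 1) (b 1 1)) := by
    have := hnn (b 0 0 - b 1 1)
    rw [hb]
    simp only [map_sub, sub_apply, map_add, add_apply, hsymm (b 1 1) (b 0 0)] at this ⊢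
    linarith
  have h4 : k (b 0 0) (b 0 0) + k (b 1 1) (b 1 1) ≤ ∑ j, ∑ i, k (b j i) (b j i) := by
    simp only [Fin.sum_univ_two]
    linarith [hnn (b 0 1), hnn (b 1 0)]
  have h5 : -(H * ∑ i, k (X i) (X i)) ≤ ∑ i, s i := by
    rw [Finset.mul_sum, ← Finset.sum_neg_distrib]
    exact Finset.sum_le_sum fun i _ => (abs_le.1 (hs i)).1
  have h6 := mul_le_mul_of_nonneg_right hK hF
  have h7 := hz.trans (mul_le_mul_of_nonneg_left harea (sq_nonneg z))
  have h8 := hS.trans (mul_le_mul_of_nonneg_left harea hκ)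
  linarith

/-- If `Z` vanishes and the curvature term is nonpositive, the right-hand side of the Bochner formula
is at least `|∇dφ|²`. -/
theorem sum_normSq_le_bochner_rhs {n : ℕ} (k : E n →L[ℝ] E n →L[ℝ] ℝ)
    (hpos : ∀ u, u ≠ 0 → 0 < k u u) (X : Fin 2 → E n) (b : Fin 2 → Fin 2 → E n) {w τ : E n}
    (ha : τ = w) {s : Fin 2 → ℝ} {H K S : ℝ} (hs : ∀ i, |s i| ≤ H * k (X i) (X i)) (hS : S ≤ 0)
    (hK : H ≤ K) :
    ∑ j, ∑ i, k (b j i) (b j i) ≤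
      ∑ j, ∑ i, k (b j i) (b j i) + (∑ i, s i + k w τ - k τ τ) + K * ∑ i, k (X i) (X i) - 2 * S := by
  have hnn := nonneg_of_forall_pos k hpos
  have hF : 0 ≤ ∑ i, k (X i) (X i) := Finset.sum_nonneg fun i _ => hnn _
  have h5 : -(H * ∑ i, k (X i) (X i)) ≤ ∑ i, s i := by
    rw [Finset.mul_sum, ← Finset.sum_neg_distrib]
    exact Finset.sum_le_sum fun i _ => (abs_le.1 (hs i)).1
  have h6 := mul_le_mul_of_nonneg_right hK hF
  rw [ha]
  linarith

/-- The curvature hypothesis in real numbers. If `F = 0`, the product `∞ · F` vanishes, so that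
nothing can be said about `Z`. -/
theorem toReal_curvature_bound {Z H : ℝ≥0∞} {κ : ℝ≥0} {F K : ℝ}
    (h : (((Z ^ 2 + κ) * ENNReal.ofReal F + H : ℝ≥0∞) : EReal) ≤ ((K : ℝ) : EReal)) :
    H ≠ ⊤ ∧ H.toReal ≤ K ∧ (0 < F → Z ≠ ⊤ ∧ (Z.toReal ^ 2 + κ) * F + H.toReal ≤ K) := by
  have htop : (Z ^ 2 + κ) * ENNReal.ofReal F + H ≠ ⊤ := by
    intro h0
    rw [h0, EReal.coe_ennreal_top] at h
    exact absurd h (not_le.2 (EReal.coe_lt_top K))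
  have hle : ((Z ^ 2 + κ) * ENNReal.ofReal F + H).toReal ≤ K := by
    rw [← EReal.coe_le_coe_iff, EReal.coe_ennreal_toReal htop]
    exact h
  obtain ⟨h1, h2⟩ := ENNReal.add_ne_top.1 htop
  rw [ENNReal.toReal_add h1 h2] at hle
  refine ⟨h2, le_trans (le_add_of_nonneg_left ENNReal.toReal_nonneg) hle, fun hF => ?_⟩
  have hZ : Z ≠ ⊤ := by
    rintro rfl
    refine h1 ?_
    rw [ENNReal.top_pow two_ne_zero, top_add, ENNReal.top_mul (ENNReal.ofReal_pos.2 hF).ne']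
  refine ⟨hZ, ?_⟩
  rwa [ENNReal.toReal_mul, ENNReal.toReal_add (ENNReal.pow_ne_top hZ) ENNReal.coe_ne_top,
    ENNReal.toReal_pow, ENNReal.toReal_ofReal hF.le, ENNReal.coe_toReal] at hle

theorem laplacian_const {m : ℕ} {M : Type*} [TopologicalSpace M] [ChartedSpace (E m) M]
    [IsManifold (𝓡 m) ∞ M] (h : RMetric m M) (c : ℝ) (x : M) : laplacian h (fun _ => c) x = 0 := by
  have h0 : fderiv ℝ (fun _ : E m => c) = fun _ => 0 := funext fun _ => fderiv_const_apply c
  unfold laplacian metricTrace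
  refine Finset.sum_eq_zero fun i _ => ?_
  unfold hess coordHessian
  rw [show (fun _ : M => c) ∘ (extChartAt (𝓡 m) x).symm = fun _ => c from rfl, h0,
    fderiv_const_apply]
  simp

variable {n : ℕ} {M : Type*} [TopologicalSpace M] [ChartedSpace (E 2) M]
  [IsManifold (𝓡 2) ∞ M] {N : Type*} [TopologicalSpace N] [ChartedSpace (E n) N]
  [IsManifold (𝓡 n) ∞ N] {h : RMetric 2 M} {g : RMetric n N} {B : TwoForm n N} {φ : M → N}
  {V : N → ℝ} {e : ∀ _ : M, Fin 2 → E 2} {κ : ℝ≥0}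

/-- By the alternation of `Ω`, the term `Z` of the equation is orthogonal to the image of `dφ`. -/
theorem inner_tension_mfderiv
    (he : ∀ x, IsOrthonormalFrame (h.inner x : E 2 →L[ℝ] E 2 →L[ℝ] ℝ) (e x))
    (hsol : ∀ x, tension h g φ x =
      Zmap g B (φ x) (mfderiv (𝓡 2) (𝓡 n) φ x (e x 0)) (mfderiv (𝓡 2) (𝓡 n) φ x (e x 1)) +
        grad g V (φ x)) (x : M) (u : E 2) :
    g.inner (φ x) (tension h g φ x) (mfderiv (𝓡 2) (𝓡 n) φ x u) =
      g.inner (φ x) (grad g V (φ x)) (mfderiv (𝓡 2) (𝓡 n) φ x u) := by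
  let k : E n →L[ℝ] E n →L[ℝ] ℝ := g.inner (φ x)
  let d : E 2 →L[ℝ] E n := mfderiv (𝓡 2) (𝓡 n) φ x
  let a : E n := Zmap g B (φ x) (d (e x 0)) (d (e x 1))
  let w : E n := grad g V (φ x)
  have h0 : k a (d (e x 0)) = 0 := inner_Zmap_self_left g B (φ x) _ _
  have h1 : k a (d (e x 1)) = 0 := inner_Zmap_self_right g B (φ x) _ _
  have hau : k a (d u) = 0 := by
    rw [← (he x).sum_smul u]
    simp [h0, h1]
  have hτ : (tension h g φ x : E n) = a + w := hsol x
  have key : k (a + w) (d u) = k w (d u) := by rw [map_add, add_apply, hau, zero_add]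
  exact (congrArg (fun t : E n => k t (d u)) hτ).trans key

/-- The Bochner formula for a solution. -/
theorem laplacian_normSqDiff_of_solution
    (he : ∀ x, IsOrthonormalFrame (h.inner x : E 2 →L[ℝ] E 2 →L[ℝ] ℝ) (e x))
    (hφ : ContMDiff (𝓡 2) (𝓡 n) ∞ φ) (hV : ContMDiff (𝓡 n) 𝓘(ℝ, ℝ) ∞ V)
    (hsol : ∀ x, tension h g φ x =
      Zmap g B (φ x) (mfderiv (𝓡 2) (𝓡 n) φ x (e x 0)) (mfderiv (𝓡 2) (𝓡 n) φ x (e x 1)) +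
        grad g V (φ x)) (x : M) :
    laplacian h (normSqDiff h g φ) x / 2 =
      ∑ k, ∑ i, g.inner (φ x) (secondFundForm h g φ x (e x k) (e x i))
          (secondFundForm h g φ x (e x k) (e x i)) +
        (∑ i, hess g V (φ x) (mfderiv (𝓡 2) (𝓡 n) φ x (e x i))
            (mfderiv (𝓡 2) (𝓡 n) φ x (e x i)) +
          g.inner (φ x) (grad g V (φ x)) (tension h g φ x) -
          g.inner (φ x) (tension h g φ x) (tension h g φ x)) +
        scalarCurvature h x / 2 * normSqDiff h g φ x -
        2 * g.inner (φ x) (riemannTensor (chartMetric g (φ x)) (extChartAt (𝓡 n) (φ x) (φ x))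
          (mfderiv (𝓡 2) (𝓡 n) φ x (e x 0)) (mfderiv (𝓡 2) (𝓡 n) φ x (e x 1))
          (mfderiv (𝓡 2) (𝓡 n) φ x (e x 1))) (mfderiv (𝓡 2) (𝓡 n) φ x (e x 0)) := by
  have hframe : ∀ x, ∃ e, IsOrthonormalFrame (h.inner x : E 2 →L[ℝ] E 2 →L[ℝ] ℝ) e :=
    fun x => ⟨e x, he x⟩
  refine (laplacian_normSqDiff hframe hφ x (he x)).trans ?_
  exact congrArg (fun t : ℝ => _ + t + _ - _)
    (sum_covDeriv_tension hframe hφ hV (inner_tension_mfderiv he hsol) x (he x))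

theorem normSqDiff_nonneg
    (he : ∀ x, IsOrthonormalFrame (h.inner x : E 2 →L[ℝ] E 2 →L[ℝ] ℝ) (e x)) (x : M) :
    0 ≤ normSqDiff h g φ x := by
  have hH := isMetricOn_chartMetric g (φ x)
  rw [normSqDiff_eq_sum (he x)]
  refine Finset.sum_nonneg fun i _ => ?_
  have h1 := hH.nonneg (mem_extChartAt_target (φ x)) (mfderiv (𝓡 2) (𝓡 n) φ x (e x i))
  rwa [chartMetric_self] at h1

theorem mfderiv_eq_zero_of_normSqDiff_eq_zero
    (he : ∀ x, IsOrthonormalFrame (h.inner x : E 2 →L[ℝ] E 2 →L[ℝ] ℝ) (e x)) {x : M}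
    (h0 : normSqDiff h g φ x = 0) (u : E 2) : mfderiv (𝓡 2) (𝓡 n) φ x u = 0 := by
  let k : E n →L[ℝ] E n →L[ℝ] ℝ := g.inner (φ x)
  let d : E 2 →L[ℝ] E n := mfderiv (𝓡 2) (𝓡 n) φ x
  have hpos : ∀ u, u ≠ 0 → 0 < k u u := fun u hu => g.pos (φ x) u hu
  have hnn := nonneg_of_forall_pos k hpos
  have hsum : ∑ i, k (d (e x i)) (d (e x i)) = 0 := (normSqDiff_eq_sum (he x)).symm.trans h0
  have hd : ∀ i, d (e x i) = 0 := fun i => by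
    by_contra hne
    exact (hpos _ hne).ne' ((Finset.sum_eq_zero_iff_of_nonneg fun i _ => hnn _).1 hsum i
      (Finset.mem_univ i))
  change d u = 0
  rw [← (he x).sum_smul u]
  simp [hd]

theorem secondFundForm_eq_zero_of_frame
    (he : ∀ x, IsOrthonormalFrame (h.inner x : E 2 →L[ℝ] E 2 →L[ℝ] ℝ) (e x)) {x : M}
    (h0 : ∑ j, ∑ i, g.inner (φ x) (secondFundForm h g φ x (e x j) (e x i))
      (secondFundForm h g φ x (e x j) (e x i)) ≤ 0) (u v : E 2) :
    secondFundForm h g φ x u v = 0 := by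
  let k : E n →L[ℝ] E n →L[ℝ] ℝ := g.inner (φ x)
  let b : E 2 →L[ℝ] E 2 →L[ℝ] E n := sffL (chartMetric h x) (chartMetric g (φ x))
    (writtenInExtChartAt (𝓡 2) (𝓡 n) x φ) (extChartAt (𝓡 2) x x)
  have hb : ∀ u v, b u v = secondFundForm h g φ x u v := fun u v => sffL_apply u v
  have hpos : ∀ u, u ≠ 0 → 0 < k u u := fun u hu => g.pos (φ x) u hu
  have hnn := nonneg_of_forall_pos k hpos
  have hsum : ∑ j, ∑ i, k (b (e x j) (e x i)) (b (e x j) (e x i)) ≤ 0 := by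
    simp only [hb]
    exact h0
  have hz : ∀ j i, b (e x j) (e x i) = 0 := fun j i => by
    by_contra hne
    have h1 := Finset.single_le_sum (f := fun i => k (b (e x j) (e x i)) (b (e x j) (e x i)))
      (fun i _ => hnn _) (Finset.mem_univ i)
    have h2 := Finset.single_le_sum
      (f := fun j => ∑ i, k (b (e x j) (e x i)) (b (e x j) (e x i)))
      (fun j _ => Finset.sum_nonneg fun i _ => hnn _) (Finset.mem_univ j)
    exact absurd (hpos _ hne) (not_lt.2 ((h1.trans h2).trans hsum))
  refine (hb u v).symm.trans ?_
  rw [← (he x).sum_smul u, ← (he x).sum_smul v]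
  simp only [map_sum, map_smul, sum_apply, smul_apply, hz, smul_zero, Finset.sum_const_zero]
  rfl

/-- The Bochner inequality. Where `dφ` vanishes nothing is known about `normZ g B`, which may be
infinite, but `Z(dφ(e₁) ∧ dφ(e₂)) = 0` there. -/
theorem bochner_inequality
    (he : ∀ x, IsOrthonormalFrame (h.inner x : E 2 →L[ℝ] E 2 →L[ℝ] ℝ) (e x))
    (hφ : ContMDiff (𝓡 2) (𝓡 n) ∞ φ) (hV : ContMDiff (𝓡 n) 𝓘(ℝ, ℝ) ∞ V)
    (hsol : ∀ x, tension h g φ x =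
      Zmap g B (φ x) (mfderiv (𝓡 2) (𝓡 n) φ x (e x 0)) (mfderiv (𝓡 2) (𝓡 n) φ x (e x 1)) +
        grad g V (φ x))
    (hκ : ∀ (y : N) (u v : TangentSpace (𝓡 n) y), LinearIndependent ℝ ![u, v] →
      sectionalCurvature g y u v ≤ κ)
    (hScal : ∀ x, (((normZ g B ^ 2 + κ) * ENNReal.ofReal (normSqDiff h g φ x)
        + normHess g V : ℝ≥0∞) : EReal) ≤ ((scalarCurvature h x / 2 : ℝ) : EReal)) (x : M) :
    (7 / 8 * (normZ g B).toReal ^ 2 + κ / 2) * normSqDiff h g φ x ^ 2 ≤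
      laplacian h (normSqDiff h g φ) x / 2 := by
  let k : E n →L[ℝ] E n →L[ℝ] ℝ := g.inner (φ x)
  let d : E 2 →L[ℝ] E n := mfderiv (𝓡 2) (𝓡 n) φ x
  let Z : E n → E n → E n := Zmap g B (φ x)
  have hsymm : ∀ u v, k u v = k v u := fun u v => g.symm (φ x) u v
  have hpos : ∀ u, u ≠ 0 → 0 < k u u := fun u hu => g.pos (φ x) u hu
  obtain ⟨hH, hHK, hZK⟩ := toReal_curvature_bound (hScal x)
  have hFs : normSqDiff h g φ x = ∑ i, k (d (e x i)) (d (e x i)) := normSqDiff_eq_sum (he x)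
  have key : ∀ z : ℝ, k (Z (d (e x 0)) (d (e x 1))) (Z (d (e x 0)) (d (e x 1))) ≤
      z ^ 2 * (k (d (e x 0)) (d (e x 0)) * k (d (e x 1)) (d (e x 1)) -
        k (d (e x 0)) (d (e x 1)) ^ 2) →
      (z ^ 2 + κ) * normSqDiff h g φ x + (normHess g V).toReal ≤ scalarCurvature h x / 2 →
      (7 / 8 * z ^ 2 + κ / 2) * normSqDiff h g φ x ^ 2 ≤
        laplacian h (normSqDiff h g φ) x / 2 := by
    intro z hz hK
    rw [laplacian_normSqDiff_of_solution he hφ hV hsol x]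
    rw [hFs] at hK ⊢
    exact le_bochner_rhs k hsymm hpos (fun i => d (e x i))
      (fun j i => secondFundForm h g φ x (e x j) (e x i))
      ((tension_eq_sum (he x)).trans (Fin.sum_univ_two _)) (hsol x)
      (fun i => abs_hess_le g V hH (φ x) (d (e x i))) hz
      (inner_riemannTensor_le g hκ (φ x) (d (e x 0)) (d (e x 1))) κ.2 hK
  rcases (normSqDiff_nonneg (g := g) (φ := φ) he x).eq_or_lt with hF | hF
  · have hd : ∀ u, d u = 0 := mfderiv_eq_zero_of_normSqDiff_eq_zero he hF.symm
    have hZ0 : k (Z (d (e x 0)) (d (e x 1))) (Z (d (e x 0)) (d (e x 1))) = 0 := by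
      refine (inner_Zmap g B (φ x) _ _ _).trans ?_
      exact (dTwoForm B (φ x) : E n [⋀^Fin 3]→L[ℝ] ℝ).map_coord_zero (1 : Fin 3) (hd (e x 0))
    have h1 := key 0 (by rw [hZ0]; simp) (by rw [← hF]; simpa using hHK)
    rw [← hF] at h1 ⊢
    simpa using h1
  · obtain ⟨hZ, hK⟩ := hZK hF
    exact key _ (inner_Zmap_Zmap_le g B hZ (φ x) _ _) hK

/-- Rigidity: a nonconstant solution of constant energy density is totally geodesic, and all terms
of the curvature hypothesis vanish. -/
theorem rigidity [Nonempty M]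
    (he : ∀ x, IsOrthonormalFrame (h.inner x : E 2 →L[ℝ] E 2 →L[ℝ] ℝ) (e x))
    (hφ : ContMDiff (𝓡 2) (𝓡 n) ∞ φ) (hV : ContMDiff (𝓡 n) 𝓘(ℝ, ℝ) ∞ V)
    (hsol : ∀ x, tension h g φ x =
      Zmap g B (φ x) (mfderiv (𝓡 2) (𝓡 n) φ x (e x 0)) (mfderiv (𝓡 2) (𝓡 n) φ x (e x 1)) +
        grad g V (φ x))
    (hκ : ∀ (y : N) (u v : TangentSpace (𝓡 n) y), LinearIndependent ℝ ![u, v] →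
      sectionalCurvature g y u v ≤ κ)
    (hScal : ∀ x, (((normZ g B ^ 2 + κ) * ENNReal.ofReal (normSqDiff h g φ x)
        + normHess g V : ℝ≥0∞) : EReal) ≤ ((scalarCurvature h x / 2 : ℝ) : EReal))
    {c : ℝ} (hc : ∀ x, normSqDiff h g φ x = c) (hc0 : 0 < c) :
    (∀ x, scalarCurvature h x = 0) ∧ normZ g B = 0 ∧ κ = 0 ∧ normHess g V = 0 ∧
      ∀ x u v, secondFundForm h g φ x u v = 0 := by
  have hframe : ∀ x, ∃ e, IsOrthonormalFrame (h.inner x : E 2 →L[ℝ] E 2 →L[ℝ] ℝ) e :=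
    fun x => ⟨e x, he x⟩
  obtain ⟨x₀⟩ := ‹Nonempty M›
  have hlap : ∀ x, laplacian h (normSqDiff h g φ) x = 0 := fun x => by
    rw [show normSqDiff h g φ = fun _ => c from funext hc, laplacian_const]
  have hb := fun x => toReal_curvature_bound (hScal x)
  have hHtop := (hb x₀).1
  have hZtop := ((hb x₀).2.2 (by rw [hc]; exact hc0)).1
  have h1 := bochner_inequality he hφ hV hsol hκ hScal x₀
  rw [hlap, hc, zero_div] at h1
  have h2 := nonpos_of_mul_nonpos_left h1 (pow_pos hc0 2)
  have hκ0 : κ = 0 := NNReal.coe_eq_zero.1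
    (le_antisymm (by linarith [sq_nonneg (normZ g B).toReal]) κ.2)
  have hZ0 : (normZ g B).toReal = 0 :=
    pow_eq_zero_iff two_ne_zero |>.1 (le_antisymm (by linarith [κ.2]) (sq_nonneg _))
  have hB0 : ∀ x u v, secondFundForm h g φ x u v = 0 := by
    intro x
    let k : E n →L[ℝ] E n →L[ℝ] ℝ := g.inner (φ x)
    let d : E 2 →L[ℝ] E n := mfderiv (𝓡 2) (𝓡 n) φ x
    let Z : E n → E n → E n := Zmap g B (φ x)
    have hpos : ∀ u, u ≠ 0 → 0 < k u u := fun u hu => g.pos (φ x) u hu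
    have hZx : Z (d (e x 0)) (d (e x 1)) = 0 := by
      by_contra hne
      have h3 := inner_Zmap_Zmap_le g B hZtop (φ x) (d (e x 0)) (d (e x 1))
      rw [hZ0, zero_pow two_ne_zero, zero_mul] at h3
      exact absurd (hpos _ hne) (not_lt.2 h3)
    let w : E n := grad g V (φ x)
    have hτ : (tension h g φ x : E n) = w :=
      ((hsol x).trans (congrArg (fun t : E n => t + w) hZx)).trans (zero_add _)
    have hS := inner_riemannTensor_le g hκ (φ x) (d (e x 0)) (d (e x 1))
    rw [hκ0, NNReal.coe_zero, zero_mul] at hS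
    have h4 := sum_normSq_le_bochner_rhs k hpos (fun i => d (e x i))
      (fun j i => secondFundForm h g φ x (e x j) (e x i)) hτ
      (fun i => abs_hess_le g V hHtop (φ x) (d (e x i))) hS (hb x).2.1
    refine secondFundForm_eq_zero_of_frame he (h4.trans_eq ?_)
    have h5 := laplacian_normSqDiff_of_solution he hφ hV hsol x
    rw [hlap, zero_div, normSqDiff_eq_sum (he x)] at h5
    exact h5.symm
  -- The Bochner formula reduces to `0 = Scal / 2 * c - 2 ⟨R(dφ e₁, dφ e₂) dφ e₂, dφ e₁⟩`.
  have hK : ∀ x, scalarCurvature h x / 2 ≤ 0 := by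
    intro x
    let d : E 2 →L[ℝ] E n := mfderiv (𝓡 2) (𝓡 n) φ x
    have h5 := laplacian_normSqDiff (g := g) hframe hφ x (he x)
    have hS := inner_riemannTensor_le g hκ (φ x) (d (e x 0)) (d (e x 1))
    rw [hκ0, NNReal.coe_zero, zero_mul] at hS
    have h6 : ∑ j, ∑ i, g.inner (φ x) (secondFundForm h g φ x (e x j) (e x i))
        (secondFundForm h g φ x (e x j) (e x i)) = 0 := by
      refine Finset.sum_eq_zero fun j _ => Finset.sum_eq_zero fun i _ => ?_
      exact (congrArg (fun t : E n => g.inner (φ x) t t) (hB0 x (e x j) (e x i))).trans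
        (map_zero (g.inner (φ x) (0 : E n)))
    rw [hlap, zero_div, hc, sum_covDeriv_tension_of_secondFundForm_eq_zero hframe hφ hB0 x (e x),
      h6] at h5
    refine nonpos_of_mul_nonpos_left ?_ hc0
    have hS' : g.inner (φ x) (riemannTensor (chartMetric g (φ x)) (extChartAt (𝓡 n) (φ x) (φ x))
          (mfderiv (𝓡 2) (𝓡 n) φ x (e x 0)) (mfderiv (𝓡 2) (𝓡 n) φ x (e x 1))
          (mfderiv (𝓡 2) (𝓡 n) φ x (e x 1))) (mfderiv (𝓡 2) (𝓡 n) φ x (e x 0)) ≤ 0 := hS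
    linarith
  have hH0 : (normHess g V).toReal = 0 :=
    le_antisymm ((hb x₀).2.1.trans (hK x₀)) ENNReal.toReal_nonneg
  refine ⟨fun x => ?_, (ENNReal.toReal_eq_zero_iff _).1 hZ0 |>.resolve_right hZtop, hκ0,
    (ENNReal.toReal_eq_zero_iff _).1 hH0 |>.resolve_right hHtop, hB0⟩
  have h7 := (hb x).2.1
  rw [hH0] at h7
  linarith [hK x]

end Rigidity

end BosonicString

end

theorem mainTheorem5
    {M : Type*} [TopologicalSpace M] [ChartedSpace (BosonicString.E 2) M]
    [IsManifold (𝓡 2) ∞ M] [T2Space M] [CompactSpace M] [ConnectedSpace M]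
    {n : ℕ} {N : Type*} [TopologicalSpace N] [ChartedSpace (BosonicString.E n) N]
    [IsManifold (𝓡 n) ∞ N] [T2Space N] [CompactSpace N]
    (h : BosonicString.RMetric 2 M) (g : BosonicString.RMetric n N)
    (B : BosonicString.TwoForm n N) (hB : BosonicString.IsSmoothTwoForm B)
    (V : N → ℝ) (hV : ContMDiff (𝓡 n) 𝓘(ℝ, ℝ) ∞ V)
    (φ : M → N) (hφ : ContMDiff (𝓡 2) (𝓡 n) ∞ φ)
    -- an orthonormal basis of each tangent space of `M`
    (e₁ e₂ : ∀ x : M, TangentSpace (𝓡 2) x)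
    (he : ∀ x, BosonicString.OrthonormalPair h x (e₁ x) (e₂ x))
    (hsol : ∀ x, BosonicString.tension h g φ x =
      BosonicString.Zmap g B (φ x) (mfderiv (𝓡 2) (𝓡 n) φ x (e₁ x))
        (mfderiv (𝓡 2) (𝓡 n) φ x (e₂ x)) + BosonicString.grad g V (φ x))
    -- an upper bound of the sectional curvature of `N`
    (κ : ℝ≥0)
    (hκ : ∀ (y : N) (u v : TangentSpace (𝓡 n) y), LinearIndependent ℝ ![u, v] →
      BosonicString.sectionalCurvature g y u v ≤ κ)
    (hScal : ∀ x,
      (((BosonicString.normZ g B ^ 2 + κ) * ENNReal.ofReal (BosonicString.normSqDiff h g φ x)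
        + BosonicString.normHess g V : ℝ≥0∞) : EReal)
      ≤ ((BosonicString.scalarCurvature h x / 2 : ℝ) : EReal)) :
    (∀ x, 0 ≤ BosonicString.laplacian h (BosonicString.normSqDiff h g φ) x) ∧
    (∃ c : ℝ, ∀ x, BosonicString.normSqDiff h g φ x = c) ∧
    ((∃ y : N, ∀ x, φ x = y) ∨
      ((∀ x, BosonicString.scalarCurvature h x = 0) ∧ BosonicString.normZ g B = 0 ∧ κ = 0 ∧
        BosonicString.normHess g V = 0 ∧
        ∀ x u v, BosonicString.secondFundForm h g φ x u v = 0)) := by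
  have hframe : ∀ x, BosonicString.IsOrthonormalFrame
      (h.inner x : BosonicString.E 2 →L[ℝ] BosonicString.E 2 →L[ℝ] ℝ) ![e₁ x, e₂ x] := by
    intro x i j
    obtain ⟨h1, h2, h3⟩ := he x
    have h4 : h.inner x (e₂ x) (e₁ x) = 0 := (h.symm x _ _).trans h3
    fin_cases i <;> fin_cases j
    exacts [h1, h3, h4, h2]
  have hL : ∀ x, 0 ≤ BosonicString.laplacian h (BosonicString.normSqDiff h g φ) x := fun x => by
    have h1 := BosonicString.bochner_inequality hframe hφ hV hsol hκ hScal x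
    have h2 : 0 ≤ (7 / 8 * (BosonicString.normZ g B).toReal ^ 2 + κ / 2) *
        BosonicString.normSqDiff h g φ x ^ 2 := by positivity
    linarith
  obtain ⟨c, hc⟩ := BosonicString.exists_eq_const_of_laplacian_nonneg
    (fun x => ⟨_, hframe x⟩) (BosonicString.contMDiff_normSqDiff (fun x => ⟨_, hframe x⟩) hφ) hL
  refine ⟨hL, ⟨c, hc⟩, ?_⟩
  obtain ⟨x₀⟩ : Nonempty M := inferInstance
  have hc0 : 0 ≤ c := hc x₀ ▸ BosonicString.normSqDiff_nonneg hframe x₀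
  rcases hc0.eq_or_lt with hc0 | hc0
  · exact .inl (BosonicString.exists_eq_const_of_mfderiv_eq_zero h g hφ fun x =>
      BosonicString.mfderiv_eq_zero_of_normSqDiff_eq_zero hframe ((hc x).trans hc0.symm))
  · exact .inr (BosonicString.rigidity hframe hφ hV hsol hκ hScal hc hc0)
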